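/- For $r>0$ let $$V_{\rm eff}^r(x)=\frac{1}{2\pi r}\int_{-\pi r}^{\pi r}\frac{dy}{\sqrt{x^2+4r^2\sin^2\frac{y}{2r}}},\qquad x\neq 0,$$ and let $H_{\rm eff}^r=-\frac12\frac{d^2}{dx^2}-V_{\rm eff}^r$ be the self-adjoint operator in $L^2(\mathbb R)$ defined by its quadratic form on $H^1(\mathbb R)$. Let $H_C=H_C^r$ (formally $-\frac12\frac{d^2}{dx^2}+2\ln(r/2)\,\delta-{\rm fp}\frac{1}{|x|}$) be the self-adjoint operator in $L^2(\mathbb R)$ generated by the form $$t_C(f,g)=\tfrac12\langle f',g'\rangle+2\ln(r)\,\overline{f(0)}g(0)-C_0(f,g),$$ where $$C_0(f,g)=-\int_0^\infty\ln(2x)\,(\overline f g)'(x)\,dx+\int_{-\infty}^0\ln(-2x)\,(\overline f g)'(x)\,dx$$ for Schwartz functions $f,g$, extended by continuity to the form domain $H^1(\mathbb R)$. For $S\subset\mathbb R$ and $\epsilon>0$ put $S_\epsilon=\bigcup_{x\in S}(x-\epsilon,x+\epsilon)$. A real number $E$ is called an eigenvalue of even (odd) parity of an operator if it has a nonzero even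 (odd) eigenfunction with eigenvalue $E$. Then the following three statements hold. (i) Fix $a<0$ and put $A=\sigma(H_C)\cap(-\infty,a]$ and $B=\sigma(H_{\rm eff}^r)\cap(-\infty,a]$ (both depend on $r$). For every $\epsilon>0$ there is $r_\epsilon>0$ such that $B\subset A_\epsilon$ for all $0<r<r_\epsilon$. If moreover $a\notin\sigma(H_C)$ for all sufficiently small $r$, then for every $\epsilon>0$ there is $r_\epsilon>0$ such that also $A\subset B_\epsilon$ for all $0<r<r_\epsilon$. (ii) For every $r>0$ the spectrum of $H_{\rm eff}^r$ has a least element, which is a non-degenerate eigenvalue (the ground state) with an even eigenfunction, and $\sigma(H_C)$ is non-empty and bounded below. As $r\to0$, $\inf\sigma(H_{\rm eff}^r)\to-\infty$ and $$\lim_{r\to0}\left|\inf\sigma(H_C)-\inf\sigma(H_{\rm eff}^r)\right|=0.$$ (iii) Fix a compact interval $[a,b]\subset(-\infty,0)$ and a parity, and suppose that for all $0<r<r_0$ the operator $H_C$ has exactly one eigenvalue $E_C=E_C(r)$ of the given parity in $[a,b]$, and that $E_C\neq b$. Then for all small enough $r$ the operator $H_{\rm eff}^r$ has exactly one eigenvalue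 $E_{\rm eff}$ of the same parity in $[a,b]$; it is simple within that parity sector, and $$\lim_{r\to0}|E_{\rm eff}-E_C|=0.$$ -/

import Mathlib

open MeasureTheory Set Filter Topology
open scoped ContDiff ENNReal

namespace Nanotube

/-- `g` is the weak (distributional) derivative of `f` on `ℝ`. -/
def IsWeakDeriv (f g : ℝ → ℂ) : Prop :=
  ∀ φ : ℝ → ℝ, ContDiff ℝ ∞ φ → HasCompactSupport φ →
    ∫ x, deriv φ x • f x = -∫ x, φ x • g x

lemma exists_supp_Ioo {φ : ℝ → ℝ} (h : HasCompactSupport φ) :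
    ∃ M : ℝ, 0 < M ∧ ∀ x, M ≤ |x| → φ x = 0 := by
  obtain ⟨R, hR⟩ := h.isCompact.isBounded.subset_ball 0
  refine ⟨max R 1, by positivity, fun x hx => ?_⟩
  by_contra hne
  have := hR (subset_tsupport φ (Function.mem_support.2 hne))
  rw [mem_ball_zero_iff, Real.norm_eq_abs] at this
  exact absurd (le_trans (le_max_left R 1) hx) (not_le.2 this)

lemma integral_eq_of_supp {E : Type*} [NormedAddCommGroup E] [NormedSpace ℝ E] {k : ℝ → E}
    {M : ℝ} (hM : 0 < M) (hk : ∀ x, M ≤ |x| → k x = 0) : ∫ x, k x = ∫ x in (-M)..M, k x := by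
  rw [intervalIntegral.integral_of_le (by linarith), setIntegral_eq_integral_of_forall_compl_eq_zero]
  intro x hx
  apply hk
  by_contra h
  rw [not_le, abs_lt] at h
  exact hx ⟨h.1, h.2.le⟩

lemma exists_const_of_weakDeriv_zero {h : ℝ → ℂ} (hh : LocallyIntegrable h volume)
    (h0 : IsWeakDeriv h 0) : ∃ c : ℂ, ∀ᵐ x, h x = c := by
  let b : ContDiffBump (0 : ℝ) := ⟨1, 2, one_pos, one_lt_two⟩
  let ρ : ℝ → ℝ := b.normed volume
  have hρ : ContDiff ℝ ∞ ρ := b.contDiff_normed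
  have hρs : HasCompactSupport ρ := b.hasCompactSupport_normed
  have hρ1 : ∫ x, ρ x = 1 := b.integral_normed
  set c : ℂ := ∫ x, ρ x • h x with hc
  refine ⟨c, ?_⟩
  have key : ∀ᵐ x, h x - c = 0 := by
    apply ae_eq_zero_of_integral_contDiff_smul_eq_zero (hh.sub (locallyIntegrable_const c))
    intro g hg hgs
    set I : ℝ := ∫ x, g x with hI
    let k : ℝ → ℝ := fun x => g x - I * ρ x
    have hkc : ContDiff ℝ ∞ k := hg.sub (contDiff_const.mul hρ)
    have hks : HasCompactSupport k := hgs.sub (hρs.mul_left (f := fun _ => I))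
    have hgi : Integrable g := hg.continuous.integrable_of_hasCompactSupport hgs
    have hρi : Integrable ρ := hρ.continuous.integrable_of_hasCompactSupport hρs
    have hk0 : ∫ x, k x = 0 := by
      simp only [k]
      rw [integral_sub hgi (hρi.const_mul I), integral_const_mul, hρ1, mul_one, sub_self]
    obtain ⟨M, hM, hkM⟩ := exists_supp_Ioo hks
    let φ : ℝ → ℝ := fun x => ∫ t in (-M)..x, k t
    have hd : ∀ x, HasDerivAt φ (k x) x := fun x => hkc.continuous.integral_hasStrictDerivAt _ _ |>.hasDerivAt
    have hdφ : deriv φ = k := funext fun x => (hd x).deriv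
    have hφ : ContDiff ℝ ∞ φ := by
      rw [contDiff_infty_iff_deriv]
      exact ⟨fun x => (hd x).differentiableAt, hdφ ▸ hkc⟩
    have hφs : HasCompactSupport φ := by
      apply HasCompactSupport.intro (isCompact_Icc (a := -M) (b := M))
      intro x hx
      simp only [φ]
      rw [mem_Icc, not_and_or, not_le, not_le] at hx
      rcases hx with hx | hx
      · rw [intervalIntegral.integral_symm, intervalIntegral.integral_of_le hx.le, neg_eq_zero]
        apply setIntegral_eq_zero_of_forall_eq_zero
        intro t ht
        exact hkM t (by rw [le_abs]; right; linarith [ht.2])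
      · have h1 : ∫ t in (-M)..x, k t = (∫ t in (-M)..M, k t) + ∫ t in M..x, k t :=
          (intervalIntegral.integral_add_adjacent_intervals
            (hkc.continuous.intervalIntegrable _ _) (hkc.continuous.intervalIntegrable _ _)).symm
        rw [h1, ← integral_eq_of_supp hM hkM, hk0, zero_add, intervalIntegral.integral_of_le hx.le]
        apply setIntegral_eq_zero_of_forall_eq_zero
        intro t ht
        exact hkM t (by rw [le_abs]; left; linarith [ht.1])
    have := h0 φ hφ hφs
    simp only [hdφ, Pi.zero_apply, smul_zero, integral_zero, neg_zero] at this
    have hgh : Integrable fun x => g x • h x :=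
      hh.integrable_smul_left_of_hasCompactSupport hg.continuous hgs
    have hρh : Integrable fun x => ρ x • h x :=
      hh.integrable_smul_left_of_hasCompactSupport hρ.continuous hρs
    have e1 : ∫ x, k x • h x = (∫ x, g x • h x) - I • c := by
      simp only [k, sub_smul, mul_smul]
      have hIρ : Integrable fun x => I • ρ x • h x := hρh.smul I
      rw [integral_sub hgh hIρ, integral_smul]
    rw [e1] at this
    have e2 : ∫ x, g x • (h x - c) = (∫ x, g x • h x) - I • c := by
      simp only [smul_sub]
      rw [integral_sub hgh (hgi.smul_const c), integral_smul_const]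
    rw [← this, ← e2]
    rfl
  filter_upwards [key] with x hx using sub_eq_zero.1 hx

lemma real_parts {g : ℝ → ℝ} (hg : LocallyIntegrable g volume) {φ : ℝ → ℝ}
    (hφ : ContDiff ℝ ∞ φ) (hφs : HasCompactSupport φ) :
    ∫ x, deriv φ x * (∫ t in (0 : ℝ)..x, g t) = -∫ x, φ x * g x := by
  obtain ⟨M, hM, hφM⟩ := exists_supp_Ioo hφs
  obtain ⟨M', hM', hφM'⟩ := exists_supp_Ioo hφs.deriv
  set N := max M M'
  have hN : 0 < N := lt_max_of_lt_left hM
  have hgN : ∀ x y, IntervalIntegrable g volume x y := fun x y =>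
    (hg.integrableOn_isCompact isCompact_uIcc).intervalIntegrable
  rw [integral_eq_of_supp (M := N) hN fun x hx => by rw [hφM' x (le_trans (le_max_right _ _) hx), zero_mul],
    integral_eq_of_supp (k := fun x => φ x * g x) (M := N) hN fun x hx => by simp only [hφM x (le_trans (le_max_left _ _) hx), zero_mul]]
  have hG : AbsolutelyContinuousOnInterval (fun x => ∫ t in (0 : ℝ)..x, g t) (-N) N :=
    (hgN _ _).absolutelyContinuousOnInterval_intervalIntegral (by rw [uIcc_of_le (by linarith)]; constructor <;> linarith)
  have hφA : AbsolutelyContinuousOnInterval φ (-N) N :=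
    ((hφ.of_le (by exact_mod_cast le_top)).contDiffOn).absolutelyContinuousOnInterval
  have := hφA.integral_mul_deriv_eq_deriv_mul hG
  rw [hφM N ((le_max_left M M').trans (le_abs_self _)), hφM (-N) ((le_max_left M M').trans (by rw [abs_neg]; exact le_abs_self _)), zero_mul, zero_mul, sub_zero, zero_sub] at this
  rw [← neg_eq_iff_eq_neg, ← this]
  apply intervalIntegral.integral_congr_ae
  filter_upwards [_root_.LocallyIntegrable.ae_hasDerivAt_integral hg] with x hx _
  rw [(hx 0).deriv]

lemma isWeakDeriv_primitive {g : ℝ → ℂ} (hg : LocallyIntegrable g volume) :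
    IsWeakDeriv (fun x => ∫ t in (0 : ℝ)..x, g t) g := by
  intro φ hφ hφs
  have hgN : ∀ x y, IntervalIntegrable g volume x y := fun x y =>
    (hg.integrableOn_isCompact isCompact_uIcc).intervalIntegrable
  have hGc : Continuous fun x => ∫ t in (0 : ℝ)..x, g t :=
    intervalIntegral.continuous_primitive hgN 0
  have i1 : Integrable fun x => deriv φ x • (∫ t in (0 : ℝ)..x, g t) :=
    hGc.locallyIntegrable.integrable_smul_left_of_hasCompactSupport
      (hφ.continuous_deriv (by exact_mod_cast le_top)) hφs.deriv
  have i2 : Integrable fun x => φ x • g x :=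
    hg.integrable_smul_left_of_hasCompactSupport hφ.continuous hφs
  have key : ∀ L : ℂ →L[ℝ] ℝ, L (∫ x, deriv φ x • (∫ t in (0 : ℝ)..x, g t)) = L (-∫ x, φ x • g x) := by
    intro L
    have hLg : LocallyIntegrable (fun x => L (g x)) volume := fun x => by
      obtain ⟨s, hs, hi⟩ := hg x
      exact ⟨s, hs, L.integrable_comp hi⟩
    rw [map_neg, ← L.integral_comp_comm i1, ← L.integral_comp_comm i2]
    simp only [map_smul, smul_eq_mul]
    rw [← real_parts hLg hφ hφs]
    congr 1; ext x
    rw [L.intervalIntegral_comp_comm (hgN _ _)]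
  apply Complex.ext
  · exact key Complex.reCLM
  · exact key Complex.imCLM

lemma IsWeakDeriv.sub' {f g f' g' : ℝ → ℂ} (hf : LocallyIntegrable f volume)
    (hf' : LocallyIntegrable f' volume) (hg : LocallyIntegrable g volume)
    (hg' : LocallyIntegrable g' volume)
    (h : IsWeakDeriv f f') (h' : IsWeakDeriv g g') :
    IsWeakDeriv (fun x => f x - g x) (fun x => f' x - g' x) := by
  intro φ hφ hφs
  have hc := hφ.continuous_deriv (by exact_mod_cast le_top)
  simp only [smul_sub]
  rw [integral_sub (hf.integrable_smul_left_of_hasCompactSupport hc hφs.deriv)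
    (hg.integrable_smul_left_of_hasCompactSupport hc hφs.deriv),
    integral_sub (hf'.integrable_smul_left_of_hasCompactSupport hφ.continuous hφs)
    (hg'.integrable_smul_left_of_hasCompactSupport hφ.continuous hφs), h φ hφ hφs, h' φ hφ hφs]
  ring

lemma IsWeakDeriv.exists_ae_eq {f g : ℝ → ℂ} (hf : LocallyIntegrable f volume)
    (hg : LocallyIntegrable g volume) (h : IsWeakDeriv f g) :
    ∃ c : ℂ, ∀ᵐ x, f x = c + ∫ t in (0 : ℝ)..x, g t := by
  have hgN : ∀ x y, IntervalIntegrable g volume x y := fun x y =>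
    (hg.integrableOn_isCompact isCompact_uIcc).intervalIntegrable
  have hGc : Continuous fun x => ∫ t in (0 : ℝ)..x, g t :=
    intervalIntegral.continuous_primitive hgN 0
  have := h.sub' hf hg hGc.locallyIntegrable hg (isWeakDeriv_primitive hg)
  simp only [sub_self] at this
  obtain ⟨c, hc⟩ := exists_const_of_weakDeriv_zero (hf.sub hGc.locallyIntegrable) this
  refine ⟨c, ?_⟩
  filter_upwards [hc] with x hx
  rw [← hx]; simp


/-- The Hilbert space `L²(ℝ)` of complex valued functions. -/
abbrev L2 : Type := Lp ℂ 2 (volume : Measure ℝ)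

lemma L2.locallyIntegrable (f : L2) : LocallyIntegrable (f : ℝ → ℂ) volume :=
  (Lp.memLp f).locallyIntegrable one_le_two

lemma IsWeakDeriv.congr {f g f' g' : ℝ → ℂ} (h : IsWeakDeriv f g) (hf : f =ᵐ[volume] f')
    (hg : g =ᵐ[volume] g') : IsWeakDeriv f' g' := by
  intro φ hφ hφs
  have e1 : ∫ x, deriv φ x • f' x = ∫ x, deriv φ x • f x :=
    integral_congr_ae (by filter_upwards [hf] with x hx; rw [hx])
  have e2 : ∫ x, φ x • g' x = ∫ x, φ x • g x :=
    integral_congr_ae (by filter_upwards [hg] with x hx; rw [hx])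
  rw [e1, e2, h φ hφ hφs]

lemma IsWeakDeriv.add_L2 {f g f' g' : L2} (h : IsWeakDeriv f f') (h' : IsWeakDeriv g g') :
    IsWeakDeriv (f + g : L2) (f' + g' : L2) := by
  have : IsWeakDeriv (fun x => f x + g x) (fun x => f' x + g' x) := by
    intro φ hφ hφs
    have hc := hφ.continuous_deriv (by exact_mod_cast le_top)
    simp only [smul_add]
    rw [integral_add (f.locallyIntegrable.integrable_smul_left_of_hasCompactSupport hc hφs.deriv)
      (g.locallyIntegrable.integrable_smul_left_of_hasCompactSupport hc hφs.deriv),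
      integral_add (f'.locallyIntegrable.integrable_smul_left_of_hasCompactSupport hφ.continuous hφs)
      (g'.locallyIntegrable.integrable_smul_left_of_hasCompactSupport hφ.continuous hφs),
      h φ hφ hφs, h' φ hφ hφs]
    ring
  exact this.congr (Lp.coeFn_add f g).symm (Lp.coeFn_add f' g').symm

lemma IsWeakDeriv.smul_L2 {f f' : L2} (c : ℂ) (h : IsWeakDeriv f f') :
    IsWeakDeriv (c • f : L2) (c • f' : L2) := by
  have : IsWeakDeriv (fun x => c • f x) (fun x => c • f' x) := by
    intro φ hφ hφs
    simp only [smul_comm _ c]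
    rw [integral_smul, integral_smul, h φ hφ hφs, smul_neg]
  exact this.congr (Lp.coeFn_smul c f).symm (Lp.coeFn_smul c f').symm

lemma IsWeakDeriv.unique_L2 {f g g' : L2} (h : IsWeakDeriv f g) (h' : IsWeakDeriv f g') :
    g = g' := by
  apply Lp.ext
  refine ae_eq_of_integral_contDiff_smul_eq g.locallyIntegrable g'.locallyIntegrable ?_
  intro φ hφ hφs
  have := (h φ hφ hφs).symm.trans (h' φ hφ hφs)
  exact neg_injective this

/-- The Sobolev space `H¹(ℝ)`: the `L²` functions with weak derivative in `L²`. -/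
def H1 : Submodule ℂ L2 where
  carrier := {f | ∃ g : L2, IsWeakDeriv f g}
  add_mem' := fun ⟨f', hf⟩ ⟨g', hg⟩ => ⟨f' + g', hf.add_L2 hg⟩
  zero_mem' := by
    refine ⟨0, ?_⟩
    have : IsWeakDeriv (0 : ℝ → ℂ) 0 := fun φ _ _ => by simp
    exact this.congr (Lp.coeFn_zero ℂ 2 volume).symm (Lp.coeFn_zero ℂ 2 volume).symm
  smul_mem' := fun c _ ⟨f', hf⟩ => ⟨c • f', hf.smul_L2 c⟩

/-- The weak derivative of an `H¹` function. -/
noncomputable def weakDeriv : H1 →ₗ[ℂ] L2 where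
  toFun f := Classical.choose f.2
  map_add' f g := (Classical.choose_spec (f + g).2).unique_L2
    ((Classical.choose_spec f.2).add_L2 (Classical.choose_spec g.2))
  map_smul' c f := (Classical.choose_spec (c • f).2).unique_L2
    ((Classical.choose_spec f.2).smul_L2 c)

lemma isWeakDeriv_weakDeriv (f : H1) : IsWeakDeriv (f : L2) (weakDeriv f) :=
  Classical.choose_spec f.2

lemma exists_contRep (f : H1) : ∃ u : C(ℝ, ℂ), ((f : L2) : ℝ → ℂ) =ᵐ[volume] u := by
  obtain ⟨c, hc⟩ := (isWeakDeriv_weakDeriv f).exists_ae_eq (L2.locallyIntegrable _)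
    (L2.locallyIntegrable _)
  have hgN : ∀ x y, IntervalIntegrable (weakDeriv f) volume x y := fun x y =>
    ((L2.locallyIntegrable _).integrableOn_isCompact isCompact_uIcc).intervalIntegrable
  exact ⟨⟨_, continuous_const.add (intervalIntegral.continuous_primitive hgN 0)⟩, hc⟩

lemma contMap_ext {u v : C(ℝ, ℂ)} (h : (u : ℝ → ℂ) =ᵐ[volume] v) : u = v :=
  ContinuousMap.ext fun x => congrFun ((u.continuous.ae_eq_iff_eq volume v.continuous).1 h) x

/-- The continuous representative of an `H¹` function; `contRep f 0` is the value `f(0)`. -/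
noncomputable def contRep : H1 →ₗ[ℂ] C(ℝ, ℂ) where
  toFun f := Classical.choose (exists_contRep f)
  map_add' f g := contMap_ext (by
    filter_upwards [Classical.choose_spec (exists_contRep (f + g)),
      Classical.choose_spec (exists_contRep f), Classical.choose_spec (exists_contRep g),
      Lp.coeFn_add (f : L2) (g : L2)] with x h1 h2 h3 h4
    rw [← h1, ContinuousMap.add_apply, ← h2, ← h3]
    exact h4)
  map_smul' c f := contMap_ext (by
    filter_upwards [Classical.choose_spec (exists_contRep (c • f)),
      Classical.choose_spec (exists_contRep f),
      Lp.coeFn_smul c (f : L2)] with x h1 h2 h4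
    rw [← h1, ContinuousMap.smul_apply, RingHom.id_apply, ← h2]
    exact h4)

lemma contRep_ae (f : H1) : ((f : L2) : ℝ → ℂ) =ᵐ[volume] contRep f :=
  Classical.choose_spec (exists_contRep f)

lemma memLp_contRep (f : H1) : MemLp (contRep f) 2 volume :=
  (Lp.memLp (f : L2)).ae_eq (contRep_ae f)

lemma isWeakDeriv_deriv {g : ℝ → ℂ} (hg : ContDiff ℝ 1 g) : IsWeakDeriv g (deriv g) := by
  intro φ hφ hφs
  have hd : Continuous (deriv g) := hg.continuous_deriv le_rfl
  have hdφ : Continuous (deriv φ) := hφ.continuous_deriv (by exact_mod_cast le_top)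
  have := integral_bilinear_hasDerivAt_right_eq_neg_left_of_integrable
    (L := ContinuousLinearMap.lsmul ℝ ℝ) (u := φ) (v := g) (u' := deriv φ) (v' := deriv g)
    (fun x _ => (hφ.differentiable (by simp) x).hasDerivAt)
    (fun x _ => (hg.differentiable one_ne_zero x).hasDerivAt)
    (hd.locallyIntegrable.integrable_smul_left_of_hasCompactSupport hφ.continuous hφs)
    (hg.continuous.locallyIntegrable.integrable_smul_left_of_hasCompactSupport hdφ hφs.deriv)
    (hg.continuous.locallyIntegrable.integrable_smul_left_of_hasCompactSupport hφ.continuous hφs)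
  simp only [ContinuousLinearMap.lsmul_apply] at this
  rw [this, neg_neg]

lemma dense_H1 : Dense (H1 : Set L2) := by
  refine (Lp.dense_hasCompactSupport_contDiff (E := ℝ) (F := ℂ) (μ := volume) (p := 2)
    (by norm_num)).mono ?_
  rintro f ⟨g, hfg, hgs, hg⟩
  have hd : Continuous (deriv g) := hg.continuous_deriv (by exact_mod_cast le_top)
  have hm : MemLp (deriv g) 2 volume := hd.memLp_of_hasCompactSupport hgs.deriv
  refine ⟨hm.toLp, ?_⟩
  exact (isWeakDeriv_deriv (hg.of_le (by exact_mod_cast le_top))).congr hfg.symm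
    hm.coeFn_toLp.symm

/-- The weak derivative of the product of the conjugate of `f` with `g`. -/
noncomputable def derivProd (f g : H1) (x : ℝ) : ℂ :=
  star (weakDeriv f x) * contRep g x + star (contRep f x) * weakDeriv g x

/-- The Coulomb form, that is `{fp 1/|x| + ln 4 · δ}` applied to the product of the conjugate of `f`
with `g`. On Schwartz functions it is minus the integral over `x > 0` of `ln (2x)` times the
derivative of that product plus the integral over `x < 0` of `ln (-2x)` times the derivative, see
`C0_eq_of_schwartz`; these integrals need not converge on all of `H¹(ℝ)`. The formula used here is
what they become after integrating by parts on `|x| > 1/2` (where `ln (2|x|)` vanishes at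
`|x| = 1/2`); it converges absolutely for all `f, g` in `H¹(ℝ)` and is continuous in the `H¹` norm. -/
noncomputable def C0 (f g : H1) : ℂ :=
  (∫ x in Ioo (-(1 / 2) : ℝ) 0, (Real.log (-2 * x) : ℂ) * derivProd f g x)
    - (∫ x in Ioo (0 : ℝ) (1 / 2), (Real.log (2 * x) : ℂ) * derivProd f g x)
    + ∫ x in {x : ℝ | 1 / 2 < |x|}, (1 / |x| : ℝ) * (star (contRep f x) * contRep g x)

/-- The effective potential: the mean over the circumference of the Coulomb potential on the cylinder
of radius `r`. -/
noncomputable def Veff (r x : ℝ) : ℝ :=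
  1 / (2 * Real.pi * r) * ∫ y in (-(Real.pi * r))..(Real.pi * r),
    1 / √(x ^ 2 + 4 * r ^ 2 * Real.sin (y / (2 * r)) ^ 2)


lemma intervalIntegrable_abs_rpow (a b : ℝ) :
    IntervalIntegrable (fun x : ℝ => |x| ^ (-(1 / 2) : ℝ)) volume a b := by
  have h0 : ∀ c : ℝ, 0 ≤ c → IntervalIntegrable (fun x : ℝ => |x| ^ (-(1 / 2) : ℝ)) volume 0 c := by
    intro c hc
    refine (intervalIntegral.intervalIntegrable_rpow' (a := 0) (b := c) (r := -(1 / 2))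
      (by norm_num)).congr ?_
    intro x hx
    rw [uIoc_of_le hc] at hx
    simp only [abs_of_pos hx.1]
  have h1 : ∀ c : ℝ, IntervalIntegrable (fun x : ℝ => |x| ^ (-(1 / 2) : ℝ)) volume 0 c := by
    intro c
    rcases le_total 0 c with hc | hc
    · exact h0 c hc
    · rw [IntervalIntegrable.iff_comp_neg]
      simpa using h0 (-c) (by linarith)
  exact (h1 a).symm.trans (h1 b)

lemma memLp_log : MemLp (fun x : ℝ => (Real.log (2 * x) : ℂ)) 2
    (volume.restrict (Ioo (-(1 / 2)) (1 / 2))) := by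
  have hm : AEStronglyMeasurable (fun x : ℝ => (Real.log (2 * x) : ℂ))
      (volume.restrict (Ioo (-(1 / 2)) (1 / 2))) := by
    apply Measurable.aestronglyMeasurable; fun_prop
  rw [memLp_two_iff_integrable_sq_norm hm]
  have hi : IntegrableOn (fun x : ℝ => 16 * |x| ^ (-(1 / 2) : ℝ)) (Ioo (-(1 / 2)) (1 / 2)) := by
    have := (intervalIntegrable_abs_rpow (-(1 / 2)) (1 / 2)).const_mul 16
    rw [intervalIntegrable_iff_integrableOn_Ioo_of_le (by norm_num)] at this
    exact this
  refine Integrable.mono' hi (hm.norm.pow 2) ?_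
  filter_upwards [ae_restrict_mem measurableSet_Ioo] with x hx
  rcases eq_or_ne x 0 with rfl | h0
  · simp
  have hx2 : 0 < |x| := abs_pos.2 h0
  have hx1 : 2 * |x| ≤ 1 := by
    have : |x| < 1 / 2 := abs_lt.2 hx
    linarith
  have e : |Real.log (2 * x)| = Real.log ((2 * |x|)⁻¹) := by
    rw [Real.log_inv, ← Real.log_abs (2 * x), abs_mul, abs_two, abs_of_nonpos]
    exact Real.log_nonpos (by positivity) hx1
  have b1 : Real.log ((2 * |x|)⁻¹) ≤ ((2 * |x|)⁻¹) ^ (1 / 4 : ℝ) / (1 / 4) :=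
    Real.log_le_rpow_div (by positivity) (by norm_num)
  have b2 : 0 ≤ Real.log ((2 * |x|)⁻¹) := e ▸ abs_nonneg _
  simp only [norm_pow, Complex.norm_real, Real.norm_eq_abs, abs_abs]
  rw [e]
  calc Real.log ((2 * |x|)⁻¹) ^ 2 ≤ (((2 * |x|)⁻¹) ^ (1 / 4 : ℝ) / (1 / 4)) ^ 2 := by gcongr
    _ = 16 * ((2 * |x|)⁻¹) ^ (1 / 2 : ℝ) := by
      rw [div_pow, ← Real.rpow_natCast, ← Real.rpow_mul (by positivity)]; norm_num; ring
    _ ≤ 16 * (|x|⁻¹) ^ (1 / 2 : ℝ) := by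
      gcongr; linarith
    _ = 16 * |x| ^ (-(1 / 2) : ℝ) := by
      rw [Real.rpow_neg (abs_nonneg x), Real.inv_rpow (abs_nonneg x)]

lemma integrable_star_mul (f g : H1) : Integrable (fun x => star (contRep f x) * contRep g x) :=
  (memLp_contRep f).star.integrable_mul (memLp_contRep g)

lemma continuous_star_mul (f g : H1) : Continuous (fun x => star (contRep f x) * contRep g x) := by
  fun_prop

lemma integrableOn_log_derivProd (f g : H1) :
    IntegrableOn (fun x : ℝ => (Real.log (2 * x) : ℂ) * derivProd f g x)
      (Ioo (-(1 / 2)) (1 / 2)) := by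
  have aux : ∀ (w : L2) (u : C(ℝ, ℂ)), IntegrableOn
      (fun x : ℝ => (Real.log (2 * x) : ℂ) * (w x * u x)) (Ioo (-(1 / 2)) (1 / 2)) := by
    intro w u
    have h1 : IntegrableOn (fun x : ℝ => (Real.log (2 * x) : ℂ) * w x) (Icc (-(1 / 2)) (1 / 2)) := by
      rw [integrableOn_Icc_iff_integrableOn_Ioo]
      exact memLp_log.integrable_mul ((Lp.memLp w).restrict _)
    have := (h1.mul_continuousOn u.continuous.continuousOn isCompact_Icc).mono_set Ioo_subset_Icc_self
    exact this.congr (ae_of_all _ fun x => by simp only [mul_assoc])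
  have h2 := aux (weakDeriv g) (star (contRep f))
  have h1 : IntegrableOn (fun x : ℝ => (Real.log (2 * x) : ℂ) * (star (weakDeriv f x) * contRep g x))
      (Ioo (-(1 / 2)) (1 / 2)) := by
    refine (aux (star (weakDeriv f)) (contRep g)).congr ?_
    filter_upwards [ae_restrict_of_ae (Lp.coeFn_star (weakDeriv f))] with x hx
    rw [hx]; rfl
  refine (h1.add h2).congr (ae_of_all _ fun x => ?_)
  simp only [derivProd, Pi.add_apply, ContinuousMap.star_apply]
  ring

lemma derivProd_add (f g h : H1) :
    derivProd f (g + h) =ᵐ[volume] fun x => derivProd f g x + derivProd f h x := by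
  filter_upwards [Lp.coeFn_add (weakDeriv g) (weakDeriv h)] with x hx
  simp only [derivProd, map_add, ContinuousMap.add_apply, hx, Pi.add_apply]
  ring

lemma derivProd_smul (f g : H1) (c : ℂ) :
    derivProd f (c • g) =ᵐ[volume] fun x => c * derivProd f g x := by
  filter_upwards [Lp.coeFn_smul c (weakDeriv g)] with x hx
  simp only [derivProd, map_smul, ContinuousMap.smul_apply, hx, Pi.smul_apply, smul_eq_mul]
  ring

lemma integrableOn_coulomb (f g : H1) :
    IntegrableOn (fun x : ℝ => (1 / |x| : ℝ) * (star (contRep f x) * contRep g x))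
      {x : ℝ | 1 / 2 < |x|} := by
  refine Integrable.mono' ((integrable_star_mul f g).norm.const_mul 2).integrableOn ?_ ?_
  · apply AEStronglyMeasurable.mul
    · apply Measurable.aestronglyMeasurable; fun_prop
    · exact (continuous_star_mul f g).aestronglyMeasurable
  · filter_upwards [ae_restrict_mem (measurableSet_lt measurable_const (by fun_prop))] with x hx
    rw [norm_mul]
    gcongr
    rw [Complex.norm_real, Real.norm_eq_abs, abs_of_nonneg (by positivity)]
    rw [div_le_iff₀ (by linarith)]
    linarith

lemma C0_isLinear (f : H1) : IsLinearMap ℂ (C0 f) := by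
  have hneg : ∀ g : H1, IntegrableOn (fun x : ℝ => (Real.log (-2 * x) : ℂ) * derivProd f g x)
      (Ioo (-(1 / 2)) 0) := fun g => by
    have := (integrableOn_log_derivProd f g).mono_set
      (Ioo_subset_Ioo_right (by norm_num : (0 : ℝ) ≤ 1 / 2))
    refine this.congr (ae_of_all _ fun x => ?_)
    simp only [neg_mul, Real.log_neg_eq_log]
  have hpos : ∀ g : H1, IntegrableOn (fun x : ℝ => (Real.log (2 * x) : ℂ) * derivProd f g x)
      (Ioo 0 (1 / 2)) := fun g => (integrableOn_log_derivProd f g).mono_set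
      (Ioo_subset_Ioo_left (by norm_num))
  constructor
  · intro g h
    have e1 : ∀ (s : Set ℝ) (w : ℝ → ℂ), ∫ x in s, w x * derivProd f (g + h) x
        = ∫ x in s, (w x * derivProd f g x + w x * derivProd f h x) := fun s w =>
      integral_congr_ae (by
        filter_upwards [ae_restrict_of_ae (derivProd_add f g h)] with x hx
        rw [hx, mul_add])
    simp only [C0, e1, map_add, ContinuousMap.add_apply, mul_add]
    rw [integral_add (hneg g) (hneg h), integral_add (hpos g) (hpos h),
      integral_add (integrableOn_coulomb f g) (integrableOn_coulomb f h)]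
    ring
  · intro c g
    have e1 : ∀ (s : Set ℝ) (w : ℝ → ℂ), ∫ x in s, w x * derivProd f (c • g) x
        = c * ∫ x in s, w x * derivProd f g x := fun s w => by
      rw [← integral_const_mul]
      exact integral_congr_ae (by
        filter_upwards [ae_restrict_of_ae (derivProd_smul f g c)] with x hx
        rw [hx]; ring)
    have e2 : ∫ x in {x : ℝ | 1 / 2 < |x|}, ((1 / |x| : ℝ) : ℂ) * (star (contRep f x) * contRep (c • g) x)
        = c * ∫ x in {x : ℝ | 1 / 2 < |x|}, ((1 / |x| : ℝ) : ℂ) * (star (contRep f x) * contRep g x) := by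
      rw [← integral_const_mul]
      congr 1; ext x
      simp only [map_smul, ContinuousMap.smul_apply, smul_eq_mul]; ring
    simp only [C0, e1, e2, smul_eq_mul]
    ring


lemma Veff_abs (r x : ℝ) : Veff |r| x = Veff r x := by
  rcases le_total 0 r with h | h
  · rw [abs_of_nonneg h]
  · rw [abs_of_nonpos h]
    simp only [Veff, mul_neg, neg_neg, even_two.neg_pow, div_neg, Real.sin_neg]
    rw [intervalIntegral.integral_symm]
    ring

lemma continuous_Veff_integrand {r x : ℝ} (hx : x ≠ 0) :
    Continuous fun y : ℝ => 1 / √(x ^ 2 + 4 * r ^ 2 * Real.sin (y / (2 * r)) ^ 2) := by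
  refine continuous_const.div (by fun_prop) fun y => ?_
  have : 0 < x ^ 2 := by positivity
  positivity

lemma Veff_nonneg {r : ℝ} (hr : 0 < r) (x : ℝ) : 0 ≤ Veff r x := by
  have := Real.pi_pos
  refine mul_nonneg (by positivity) (intervalIntegral.integral_nonneg ?_ fun y _ => by positivity)
  have : 0 < Real.pi * r := by positivity
  linarith

lemma Veff_le_inv {r x : ℝ} (hr : 0 < r) (hx : x ≠ 0) : Veff r x ≤ 1 / |x| := by
  have hp : 0 < Real.pi * r := by positivity
  have h1 : ∫ y in (-(Real.pi * r))..(Real.pi * r),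
      1 / √(x ^ 2 + 4 * r ^ 2 * Real.sin (y / (2 * r)) ^ 2)
      ≤ ∫ y in (-(Real.pi * r))..(Real.pi * r), 1 / |x| := by
    refine intervalIntegral.integral_mono_on (by linarith)
      ((continuous_Veff_integrand hx).intervalIntegrable _ _) (by simp) fun y _ => ?_
    have : 0 < |x| := abs_pos.2 hx
    gcongr
    apply Real.le_sqrt_of_sq_le
    rw [sq_abs]
    have : 0 ≤ 4 * r ^ 2 * Real.sin (y / (2 * r)) ^ 2 := by positivity
    linarith
  rw [intervalIntegral.integral_const, smul_eq_mul] at h1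
  unfold Veff
  calc _ ≤ 1 / (2 * Real.pi * r) * ((Real.pi * r - -(Real.pi * r)) * (1 / |x|)) := by gcongr
    _ = 1 / |x| := by
      field_simp
      ring_nf

lemma Veff_le_rpow {r : ℝ} (hr : 0 < r) : ∃ C : ℝ, 0 ≤ C ∧ ∀ x : ℝ, x ≠ 0 →
    Veff r x ≤ C * |x| ^ (-(1 / 2) : ℝ) := by
  have hp : 0 < Real.pi * r := by positivity
  refine ⟨1 / (2 * Real.pi * r) *
    ∫ y in (-(Real.pi * r))..(Real.pi * r), |y| ^ (-(1 / 2) : ℝ), ?_, fun x hx => ?_⟩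
  · refine mul_nonneg (by positivity)
      (intervalIntegral.integral_nonneg (by linarith) fun y _ => by positivity)
  rw [mul_assoc, ← intervalIntegral.integral_mul_const, Veff]
  gcongr
  refine intervalIntegral.integral_mono_ae_restrict (by linarith)
      ((continuous_Veff_integrand hx).intervalIntegrable _ _)
      ((intervalIntegrable_abs_rpow _ _).mul_const _) ?_
  filter_upwards [ae_restrict_mem measurableSet_Icc,
    ae_restrict_of_ae (measure_eq_zero_iff_ae_notMem.1 (measure_singleton (0 : ℝ)))] with y hy hy0
  have hx' : 0 < |x| := abs_pos.2 hx
  have hy' : 0 < |y| := abs_pos.2 hy0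
  have hyr : |y| ≤ Real.pi * r := abs_le.2 hy
  have hs : |y| / (Real.pi * r) ≤ |Real.sin (y / (2 * r))| := by
    have h1 : |y / (2 * r)| ≤ Real.pi / 2 := by
      rw [abs_div, abs_of_pos (by positivity : 0 < 2 * r), div_le_iff₀ (by positivity)]
      linarith
    have h2 := Real.mul_le_sin (abs_nonneg _) h1
    rw [Real.abs_sin_eq_sin_abs_of_abs_le_pi (h1.trans (by linarith [Real.pi_pos]))]
    refine le_trans (le_of_eq ?_) h2
    rw [abs_div, abs_of_pos (by positivity : 0 < 2 * r)]
    field_simp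
  have hm : |x| * |y| ≤ x ^ 2 + 4 * r ^ 2 * Real.sin (y / (2 * r)) ^ 2 := by
    set s := |Real.sin (y / (2 * r))| with hsd
    have h1 : |y| ≤ s * (Real.pi * r) := (div_le_iff₀ hp).1 hs
    have h2 : |y| ≤ 4 * r * s := by
      have : s * (Real.pi * r) ≤ 4 * r * s := by
        have := mul_le_mul_of_nonneg_left Real.pi_le_four (by positivity : 0 ≤ s * r)
        linarith
      linarith
    have h3 : |x| * |y| ≤ |x| * (4 * r * s) := by gcongr
    rw [← sq_abs x, ← sq_abs (Real.sin _), ← hsd]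
    nlinarith [sq_nonneg (|x| - 2 * r * s)]
  calc 1 / √(x ^ 2 + 4 * r ^ 2 * Real.sin (y / (2 * r)) ^ 2) ≤ 1 / √(|x| * |y|) := by
        gcongr
    _ = |y| ^ (-(1 / 2) : ℝ) * |x| ^ (-(1 / 2) : ℝ) := by
      rw [Real.sqrt_eq_rpow, one_div, ← Real.rpow_neg (by positivity),
        Real.mul_rpow (by positivity) (by positivity), mul_comm]

lemma measurable_Veff {r : ℝ} (hr : 0 < r) : Measurable (Veff r) := by
  have hp : 0 < Real.pi * r := by positivity
  have hm : StronglyMeasurable fun x : ℝ => ∫ y in Ioc (-(Real.pi * r)) (Real.pi * r),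
      1 / √(x ^ 2 + 4 * r ^ 2 * Real.sin (y / (2 * r)) ^ 2) := by
    apply StronglyMeasurable.integral_prod_right'
      (f := fun p : ℝ × ℝ => 1 / √(p.1 ^ 2 + 4 * r ^ 2 * Real.sin (p.2 / (2 * r)) ^ 2))
    apply Measurable.stronglyMeasurable
    fun_prop
  have : Veff r = fun x : ℝ => 1 / (2 * Real.pi * r) * ∫ y in Ioc (-(Real.pi * r)) (Real.pi * r),
      1 / √(x ^ 2 + 4 * r ^ 2 * Real.sin (y / (2 * r)) ^ 2) := by
    ext x
    rw [Veff, intervalIntegral.integral_of_le (by linarith)]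
  rw [this]
  exact hm.measurable.const_mul _

lemma integrable_Veff (r : ℝ) (f g : H1) :
    Integrable fun x => (Veff r x : ℂ) * (star (contRep f x) * contRep g x) := by
  rcases eq_or_ne r 0 with rfl | hr0
  · simp [Veff]
  wlog hr : 0 < r generalizing r
  · have := this (-r) (neg_ne_zero.2 hr0) (by rw [Left.neg_pos_iff]; exact lt_of_le_of_ne (not_lt.1 hr) hr0)
    simpa only [← Veff_abs (-r), abs_neg, Veff_abs r] using this
  obtain ⟨C, hC, hCb⟩ := Veff_le_rpow hr
  have hmeas := (Complex.measurable_ofReal.comp (measurable_Veff hr)).aestronglyMeasurable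
    (μ := (volume : Measure ℝ))
  rw [← integrableOn_univ, ← union_compl_self (Icc (-1 : ℝ) 1), integrableOn_union]
  have hne : ∀ᵐ x : ℝ, x ≠ 0 := measure_eq_zero_iff_ae_notMem.1 (measure_singleton (0 : ℝ))
  constructor
  · refine IntegrableOn.mul_continuousOn ?_ (continuous_star_mul f g).continuousOn isCompact_Icc
    have hi : IntegrableOn (fun x : ℝ => C * |x| ^ (-(1 / 2) : ℝ)) (Icc (-1) 1) := by
      have := (intervalIntegrable_abs_rpow (-1) 1).const_mul C
      rwa [intervalIntegrable_iff_integrableOn_Icc_of_le (by norm_num)] at this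
    refine Integrable.mono' hi hmeas.restrict ?_
    filter_upwards [ae_restrict_of_ae hne] with x hx
    rw [Complex.norm_real, Real.norm_eq_abs, abs_of_nonneg (Veff_nonneg hr x)]
    exact hCb x hx
  · refine Integrable.mono' (integrable_star_mul f g).norm.integrableOn
      (hmeas.mul (continuous_star_mul f g).aestronglyMeasurable).restrict ?_
    filter_upwards [ae_restrict_of_ae hne, ae_restrict_mem measurableSet_Icc.compl] with x hx hx1
    rw [norm_mul]
    refine mul_le_of_le_one_left (norm_nonneg _) ?_
    rw [Complex.norm_real, Real.norm_eq_abs, abs_of_nonneg (Veff_nonneg hr x)]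
    refine (Veff_le_inv hr hx).trans ?_
    have : 1 < |x| := by
      by_contra h
      exact hx1 (abs_le.1 (not_lt.1 h))
    rw [div_le_one (by linarith)]
    exact this.le

/-- The form `½⟨f', g'⟩ + 2 ln(r) conj(f(0)) g(0) - C₀(f, g)` on `H¹(ℝ)`, linear in `g`. -/
noncomputable def formC (r : ℝ) (f : H1) : H1 →ₗ[ℂ] ℂ where
  toFun g := (1 / 2 : ℂ) * inner ℂ (weakDeriv f) (weakDeriv g)
    + 2 * (Real.log r : ℂ) * (star (contRep f 0) * contRep g 0) - C0 f g
  map_add' g h := by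
    simp only [map_add, inner_add_right, (C0_isLinear f).map_add, ContinuousMap.add_apply]
    ring
  map_smul' c g := by
    simp only [map_smul, inner_smul_right, (C0_isLinear f).map_smul, ContinuousMap.smul_apply,
      smul_eq_mul, RingHom.id_apply]
    ring

/-- The form `½⟨f', g'⟩ - ⟨f, V_eff g⟩` on `H¹(ℝ)`, linear in `g`. -/
noncomputable def formEff (r : ℝ) (f : H1) : H1 →ₗ[ℂ] ℂ where
  toFun g := (1 / 2 : ℂ) * inner ℂ (weakDeriv f) (weakDeriv g)
    - ∫ x, (Veff r x : ℂ) * (star (contRep f x) * contRep g x)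
  map_add' g h := by
    simp only [map_add, inner_add_right, ContinuousMap.add_apply, mul_add]
    rw [integral_add (integrable_Veff r f g) (integrable_Veff r f h)]
    ring
  map_smul' c g := by
    have : ∫ x, (Veff r x : ℂ) * (star (contRep f x) * contRep (c • g) x)
        = c * ∫ x, (Veff r x : ℂ) * (star (contRep f x) * contRep g x) := by
      rw [← integral_const_mul]
      congr 1; ext x
      simp only [map_smul, ContinuousMap.smul_apply, smul_eq_mul]; ring
    rw [this]
    simp only [map_smul, inner_smul_right, smul_eq_mul, RingHom.id_apply]
    ring

/-- The pairs `(ψ, f)` such that `ψ` is in `H¹(ℝ)` and `t(φ, ψ) = ⟨φ, f⟩` for all `φ` in `H¹(ℝ)`. -/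
def formGraph (t : H1 → H1 →ₗ[ℂ] ℂ) : Submodule ℂ (L2 × L2) where
  carrier := {p | ∃ h : p.1 ∈ H1, ∀ φ : H1, t φ ⟨p.1, h⟩ = inner ℂ (φ : L2) p.2}
  add_mem' := by
    rintro p q ⟨hp, hp'⟩ ⟨hq, hq'⟩
    refine ⟨H1.add_mem hp hq, fun φ => ?_⟩
    have : (⟨(p + q).1, H1.add_mem hp hq⟩ : H1) = ⟨p.1, hp⟩ + ⟨q.1, hq⟩ := rfl
    rw [this, map_add, hp', hq', Prod.snd_add, inner_add_right]
  zero_mem' := by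
    refine ⟨H1.zero_mem, fun φ => ?_⟩
    have : (⟨(0 : L2 × L2).1, H1.zero_mem⟩ : H1) = 0 := rfl
    rw [this, map_zero, Prod.snd_zero, inner_zero_right]
  smul_mem' := by
    rintro c p ⟨hp, hp'⟩
    refine ⟨H1.smul_mem c hp, fun φ => ?_⟩
    have : (⟨(c • p).1, H1.smul_mem c hp⟩ : H1) = c • ⟨p.1, hp⟩ := rfl
    rw [this, map_smul, hp', Prod.smul_snd, inner_smul_right, smul_eq_mul]

/-- The operator in `L²(ℝ)` generated by a form `t` with form domain `H¹(ℝ)`: its domain consists of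
the `ψ` in `H¹(ℝ)` for which there is `f` in `L²(ℝ)` with `t(φ, ψ) = ⟨φ, f⟩` for all `φ` in `H¹(ℝ)`,
and it maps `ψ` to `f`. Its graph is computed in `formOperator_graph`. -/
noncomputable def formOperator (t : H1 → H1 →ₗ[ℂ] ℂ) : L2 →ₗ.[ℂ] L2 := (formGraph t).toLinearPMap

lemma formOperator_graph (t : H1 → H1 →ₗ[ℂ] ℂ) : (formOperator t).graph = formGraph t := by
  refine Submodule.toLinearPMap_graph_eq _ ?_
  rintro ⟨u, v⟩ ⟨hu, h⟩ rfl
  have h0 : (⟨0, hu⟩ : H1) = 0 := rfl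
  simp only [h0, map_zero] at h
  exact dense_H1.eq_zero_of_inner_right ℂ fun φ hφ => (h ⟨φ, hφ⟩).symm


lemma log_parts {h : ℝ → ℂ} (hh : ContDiff ℝ 1 h) (h1 : Integrable h)
    (h2 : Integrable fun x => |x| * ‖deriv h x‖) (h3 : ∃ C : ℝ, ∀ x, x ^ 2 * ‖h x‖ ≤ C) :
    IntegrableOn (fun x : ℝ => (Real.log (2 * x) : ℂ) * deriv h x) (Ioi (1 / 2)) ∧
    ∫ x in Ioi (1 / 2 : ℝ), (Real.log (2 * x) : ℂ) * deriv h x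
      = -∫ x in Ioi (1 / 2 : ℝ), ((1 / |x| : ℝ) : ℂ) * h x := by
  have hd : Continuous (deriv h) := hh.continuous_deriv le_rfl
  have i1 : IntegrableOn (fun x : ℝ => (Real.log (2 * x) : ℂ) * deriv h x) (Ioi (1 / 2)) := by
    refine Integrable.mono' (h2.const_mul 2).integrableOn ?_ ?_
    · exact (AEStronglyMeasurable.mul (Measurable.aestronglyMeasurable (by fun_prop))
        hd.aestronglyMeasurable)
    · filter_upwards [ae_restrict_mem measurableSet_Ioi] with x hx
      have hx : 1 / 2 < x := hx
      rw [norm_mul, ← mul_assoc]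
      gcongr
      rw [Complex.norm_real, Real.norm_eq_abs, abs_of_nonneg (Real.log_nonneg (by linarith)),
        abs_of_nonneg (by linarith)]
      exact Real.log_le_self (by linarith)
  have i2 : IntegrableOn (fun x : ℝ => ((1 / x : ℝ) : ℂ) * h x) (Ioi (1 / 2)) := by
    refine Integrable.mono' (h1.norm.const_mul 2).integrableOn ?_ ?_
    · exact (AEStronglyMeasurable.mul (Measurable.aestronglyMeasurable (by fun_prop))
        hh.continuous.aestronglyMeasurable)
    · filter_upwards [ae_restrict_mem measurableSet_Ioi] with x hx
      have hx : 1 / 2 < x := hx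
      rw [norm_mul]
      gcongr
      have : 0 < x := by linarith
      rw [Complex.norm_real, Real.norm_eq_abs, abs_of_nonneg (by positivity), div_le_iff₀ this]
      linarith
  have hlog : ∀ x ∈ Ioi (1 / 2 : ℝ),
      HasDerivAt (fun x : ℝ => (Real.log (2 * x) : ℂ)) ((1 / x : ℝ) : ℂ) x := by
    intro x hx
    have hx0 : x ≠ 0 := (lt_trans (by norm_num) (mem_Ioi.1 hx)).ne'
    have := ((Real.hasDerivAt_log (mul_ne_zero two_ne_zero hx0)).comp x
      ((hasDerivAt_id x).const_mul 2)).ofReal_comp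
    convert! this using 1
    push_cast
    field_simp
  refine ⟨i1, ?_⟩
  have hz : Tendsto ((fun x : ℝ => (Real.log (2 * x) : ℂ)) * h) (𝓝[>] (1 / 2)) (𝓝 0) := by
    have hc : ContinuousAt ((fun x : ℝ => (Real.log (2 * x) : ℂ)) * h) (1 / 2) := by
      refine ContinuousAt.mul ?_ hh.continuous.continuousAt
      exact Complex.continuous_ofReal.continuousAt.comp
        (ContinuousAt.log (by fun_prop) (by norm_num))
    have := hc.tendsto.mono_left (nhdsWithin_le_nhds (s := Ioi (1 / 2 : ℝ)))
    simpa using this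
  have hinf : Tendsto ((fun x : ℝ => (Real.log (2 * x) : ℂ)) * h) atTop (𝓝 0) := by
    obtain ⟨C, hC⟩ := h3
    have hb : Tendsto (fun x : ℝ => 2 * C * x⁻¹) atTop (𝓝 0) := by
      simpa using tendsto_inv_atTop_zero.const_mul (2 * C)
    refine squeeze_zero_norm' ?_ hb
    filter_upwards [eventually_ge_atTop (1 : ℝ)] with x hx
    rw [Pi.mul_apply, norm_mul, Complex.norm_real, Real.norm_eq_abs,
      abs_of_nonneg (Real.log_nonneg (by linarith))]
    have hx0 : 0 < x := by linarith
    calc Real.log (2 * x) * ‖h x‖ ≤ 2 * x * ‖h x‖ := by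
          gcongr; exact Real.log_le_self (by linarith)
      _ = 2 * (x ^ 2 * ‖h x‖) * x⁻¹ := by field_simp
      _ ≤ 2 * C * x⁻¹ := by gcongr; exact hC x
  have := integral_Ioi_mul_deriv_eq_deriv_mul hlog
    (fun x _ => (hh.differentiable one_ne_zero x).hasDerivAt) i1 i2 hz hinf
  rw [this, sub_self, zero_sub]
  congr 1
  refine setIntegral_congr_fun measurableSet_Ioi fun x hx => ?_
  simp only [abs_of_pos (lt_trans (by norm_num) (mem_Ioi.1 hx) : (0 : ℝ) < x)]

lemma log_parts_neg {h : ℝ → ℂ} (hh : ContDiff ℝ 1 h) (h1 : Integrable h)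
    (h2 : Integrable fun x => |x| * ‖deriv h x‖) (h3 : ∃ C : ℝ, ∀ x, x ^ 2 * ‖h x‖ ≤ C) :
    IntegrableOn (fun x : ℝ => (Real.log (-2 * x) : ℂ) * deriv h x) (Iio (-(1 / 2))) ∧
    ∫ x in Iio (-(1 / 2) : ℝ), (Real.log (-2 * x) : ℂ) * deriv h x
      = ∫ x in Iio (-(1 / 2) : ℝ), ((1 / |x| : ℝ) : ℂ) * h x := by
  have hdn : ∀ x, deriv (fun y => h (-y)) x = -deriv h (-x) := fun x => deriv_comp_neg h x
  obtain ⟨k1, k2⟩ := log_parts (h := fun x => h (-x)) (hh.comp contDiff_neg) h1.comp_neg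
    (by simpa [hdn] using h2.comp_neg)
    (by obtain ⟨C, hC⟩ := h3; exact ⟨C, fun x => by simpa using hC (-x)⟩)
  have hpre : (fun x : ℝ => -x) ⁻¹' (Iio (-(1 / 2))) = Ioi (1 / 2) := by
    ext x; simp
  have mp := Measure.measurePreserving_neg (volume : Measure ℝ)
  have me := (MeasurableEquiv.neg ℝ).measurableEmbedding
  have f1 : ∀ F : ℝ → ℂ, ∫ x in Ioi (1 / 2 : ℝ), F (-x) = ∫ x in Iio (-(1 / 2) : ℝ), F x := by
    intro F
    rw [← hpre]
    exact mp.setIntegral_preimage_emb me F _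
  constructor
  · rw [← mp.integrableOn_comp_preimage me, hpre]
    refine k1.neg.congr (ae_of_all _ fun x => ?_)
    simp [hdn]
  · rw [← f1, ← f1]
    simp only [hdn, mul_neg, integral_neg, neg_inj] at k2
    simp only [abs_neg, neg_mul_neg]
    exact k2

/-- On Schwartz functions, `C0` is given by the half-line integrals of `ln(2|x|) (f̄ g)'`. -/
lemma C0_eq_of_schwartz (f g : SchwartzMap ℝ ℂ) (F G : H1)
    (hF : ((F : L2) : ℝ → ℂ) =ᵐ[volume] f) (hG : ((G : L2) : ℝ → ℂ) =ᵐ[volume] g) :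
    C0 F G = -(∫ x in Ioi (0 : ℝ), (Real.log (2 * x) : ℂ) * deriv (fun y => star (f y) * g y) x)
      + ∫ x in Iio (0 : ℝ), (Real.log (-2 * x) : ℂ) * deriv (fun y => star (f y) * g y) x := by
  have rep : ∀ (u : SchwartzMap ℝ ℂ) (U : H1), ((U : L2) : ℝ → ℂ) =ᵐ[volume] u →
      (contRep U : ℝ → ℂ) = u ∧ (weakDeriv U : ℝ → ℂ) =ᵐ[volume] deriv u := by
    intro u U hU
    refine ⟨((contRep U).continuous.ae_eq_iff_eq volume u.continuous).1
      ((contRep_ae U).symm.trans hU), ?_⟩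
    have hu : ⇑(SchwartzMap.derivCLM ℂ ℂ u) = deriv u :=
      funext fun x => SchwartzMap.derivCLM_apply ℂ u x
    have hm : MemLp (deriv u) 2 volume := hu ▸ (SchwartzMap.derivCLM ℂ ℂ u).memLp 2 volume
    have h1 : IsWeakDeriv (U : L2) (hm.toLp : L2) :=
      (isWeakDeriv_deriv (u.smooth 1)).congr hU.symm hm.coeFn_toLp.symm
    rw [(isWeakDeriv_weakDeriv U).unique_L2 h1]
    exact hm.coeFn_toLp
  obtain ⟨rF, dF⟩ := rep f F hF
  obtain ⟨rG, dG⟩ := rep g G hG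
  set h : ℝ → ℂ := fun y => star (f y) * g y with hh
  have hfd : ∀ x, HasDerivAt f (deriv f x) x := fun x =>
    ((f.smooth 1).differentiable one_ne_zero x).hasDerivAt
  have hgd : ∀ x, HasDerivAt g (deriv g x) x := fun x =>
    ((g.smooth 1).differentiable one_ne_zero x).hasDerivAt
  have hdh : ∀ x, deriv h x = star (deriv f x) * g x + star (f x) * deriv g x := fun x =>
    ((hfd x).star.mul (hgd x)).deriv
  have hP : derivProd F G =ᵐ[volume] deriv h := by
    filter_upwards [dF, dG] with x h1 h2
    rw [derivProd, h1, h2, rF, rG, hdh]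
  have hc1 : ContDiff ℝ 1 h := by
    have : ContDiff ℝ 1 fun y => star (f y) := (starL' ℝ (A := ℂ)).contDiff.comp (f.smooth 1)
    exact this.mul (g.smooth 1)
  obtain ⟨Cf, hCf0, hCf⟩ := f.decay 0 0
  obtain ⟨Cf', hCf0', hCf'⟩ := (SchwartzMap.derivCLM ℂ ℂ f).decay 0 0
  obtain ⟨Cg, hCg0, hCg⟩ := g.decay 2 0
  simp only [pow_zero, one_mul, norm_iteratedFDeriv_zero, SchwartzMap.derivCLM_apply] at hCf hCf' hCg
  have a1 : Integrable h := by
    refine Integrable.mono' (g.integrable.norm.const_mul Cf) hc1.continuous.aestronglyMeasurable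
      (ae_of_all _ fun x => ?_)
    rw [hh, norm_mul, norm_star]
    gcongr
    exact hCf x
  have a2 : Integrable fun x => |x| * ‖deriv h x‖ := by
    have e1 := (g.integrable_pow_mul volume 1).const_mul Cf'
    have e2 := ((SchwartzMap.derivCLM ℂ ℂ g).integrable_pow_mul volume 1).const_mul Cf
    refine Integrable.mono' (e1.add e2)
      (continuous_abs.mul (hc1.continuous_deriv le_rfl).norm).aestronglyMeasurable
      (ae_of_all _ fun x => ?_)
    rw [Real.norm_eq_abs, abs_of_nonneg (by positivity), hdh]
    simp only [Pi.add_apply, pow_one, SchwartzMap.derivCLM_apply, Real.norm_eq_abs]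
    calc |x| * ‖star (deriv f x) * g x + star (f x) * deriv g x‖
        ≤ |x| * (Cf' * ‖g x‖ + Cf * ‖deriv g x‖) := by
          gcongr
          refine (norm_add_le _ _).trans ?_
          rw [norm_mul, norm_mul, norm_star, norm_star]
          gcongr
          · exact hCf' x
          · exact hCf x
      _ = Cf' * (|x| * ‖g x‖) + Cf * (|x| * ‖deriv g x‖) := by ring
  have a3 : ∃ C : ℝ, ∀ x, x ^ 2 * ‖h x‖ ≤ C := by
    refine ⟨Cf * Cg, fun x => ?_⟩
    rw [hh, norm_mul, norm_star]
    have := hCg x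
    rw [Real.norm_eq_abs, sq_abs] at this
    calc x ^ 2 * (‖f x‖ * ‖g x‖) = ‖f x‖ * (x ^ 2 * ‖g x‖) := by ring
      _ ≤ Cf * Cg := by gcongr; exact hCf x
  obtain ⟨p1, p2⟩ := log_parts hc1 a1 a2 a3
  obtain ⟨n1, n2⟩ := log_parts_neg hc1 a1 a2 a3
  have L : IntegrableOn (fun x : ℝ => (Real.log (2 * x) : ℂ) * deriv h x)
      (Ioo (-(1 / 2)) (1 / 2)) := by
    refine (integrableOn_log_derivProd F G).congr ?_
    filter_upwards [ae_restrict_of_ae hP] with x hx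
    rw [hx]
  have L1 := L.mono_set (Ioo_subset_Ioo_left (by norm_num : (-(1 / 2) : ℝ) ≤ 0))
  have L3 : IntegrableOn (fun x : ℝ => (Real.log (-2 * x) : ℂ) * deriv h x) (Ioo (-(1 / 2)) 0) := by
    refine (L.mono_set (Ioo_subset_Ioo_right (by norm_num : (0 : ℝ) ≤ 1 / 2))).congr
      (ae_of_all _ fun x => ?_)
    simp only [neg_mul, Real.log_neg_eq_log]
  have s1 : ∫ x in Ioi (0 : ℝ), (Real.log (2 * x) : ℂ) * deriv h x
      = (∫ x in Ioo (0 : ℝ) (1 / 2), (Real.log (2 * x) : ℂ) * deriv h x)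
        + ∫ x in Ioi (1 / 2 : ℝ), (Real.log (2 * x) : ℂ) * deriv h x := by
    rw [← integral_Ioc_eq_integral_Ioo, ← setIntegral_union (Ioc_disjoint_Ioi le_rfl)
      measurableSet_Ioi ((integrableOn_Ioc_iff_integrableOn_Ioo).2 L1) p1,
      Ioc_union_Ioi_eq_Ioi (by norm_num)]
  have s2 : ∫ x in Iio (0 : ℝ), (Real.log (-2 * x) : ℂ) * deriv h x
      = (∫ x in Iio (-(1 / 2) : ℝ), (Real.log (-2 * x) : ℂ) * deriv h x)
        + ∫ x in Ioo (-(1 / 2) : ℝ) 0, (Real.log (-2 * x) : ℂ) * deriv h x := by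
    have hdj : Disjoint (Iio (-(1 / 2) : ℝ)) (Ico (-(1 / 2)) 0) :=
      disjoint_left.2 fun x hx hx' => absurd hx'.1 (not_le.2 hx)
    rw [← integral_Ico_eq_integral_Ioo, ← setIntegral_union hdj measurableSet_Ico n1 ((integrableOn_Ico_iff_integrableOn_Ioo).2 L3),
      Iio_union_Ico_eq_Iio (by norm_num)]
  have s3 : ∫ x in {x : ℝ | 1 / 2 < |x|}, ((1 / |x| : ℝ) : ℂ) * h x
      = (∫ x in Iio (-(1 / 2) : ℝ), ((1 / |x| : ℝ) : ℂ) * h x)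
        + ∫ x in Ioi (1 / 2 : ℝ), ((1 / |x| : ℝ) : ℂ) * h x := by
    have hs : {x : ℝ | 1 / 2 < |x|} = Iio (-(1 / 2)) ∪ Ioi (1 / 2) := by
      ext x
      simp only [mem_ofPred_eq, lt_abs, mem_union, mem_Iio, mem_Ioi]
      constructor
      · rintro (h | h)
        · exact Or.inr h
        · exact Or.inl (by linarith)
      · rintro (h | h)
        · exact Or.inr (by linarith)
        · exact Or.inl h
    have hI := integrableOn_coulomb F G
    rw [rF, rG] at hI
    rw [hs] at hI ⊢
    exact setIntegral_union (disjoint_left.2 fun x hx hx' => by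
      have h1 : x < -(1 / 2) := hx
      have h2 : 1 / 2 < x := hx'
      linarith) measurableSet_Ioi (hI.mono_set subset_union_left) (hI.mono_set subset_union_right)
  have e1 : ∀ (s : Set ℝ) (w : ℝ → ℂ), ∫ x in s, w x * derivProd F G x
      = ∫ x in s, w x * deriv h x := fun s w => integral_congr_ae (by
    filter_upwards [ae_restrict_of_ae hP] with x hx
    rw [hx])
  rw [C0, e1, e1, rF, rG, s1, s2, p2, n2]
  change _ + (∫ x in {x : ℝ | 1 / 2 < |x|}, ((1 / |x| : ℝ) : ℂ) * h x) = _
  rw [s3]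
  ring


/-- `z` is in the resolvent set of `T`: `T - z` has a bounded everywhere defined two-sided inverse `R`. -/
def IsResolventPoint (T : L2 →ₗ.[ℂ] L2) (z : ℂ) : Prop :=
  ∃ R : L2 →L[ℂ] L2,
    (∀ f : L2, ∃ h : R f ∈ T.domain, T ⟨R f, h⟩ - z • R f = f) ∧
    ∀ ψ : T.domain, R (T ψ - z • (ψ : L2)) = ψ

/-- The spectrum of `T` on the real axis. The operators below are self-adjoint, so this is their
whole spectrum. -/
def realSpectrum (T : L2 →ₗ.[ℂ] L2) : Set ℝ := {E | ¬ IsResolventPoint T (E : ℂ)}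

/-- The space of all `ψ` in the domain of `T` with `T ψ = E ψ`. -/
def eigenspace (T : L2 →ₗ.[ℂ] L2) (E : ℝ) : Submodule ℂ L2 where
  carrier := {ψ | ∃ h : ψ ∈ T.domain, T ⟨ψ, h⟩ = (E : ℂ) • ψ}
  add_mem' := by
    rintro u v ⟨hu, hu'⟩ ⟨hv, hv'⟩
    refine ⟨T.domain.add_mem hu hv, ?_⟩
    rw [← AddMemClass.mk_add_mk _ _ _ hu hv, T.map_add, hu', hv', smul_add]
  zero_mem' := ⟨T.domain.zero_mem, by
    have : (⟨0, T.domain.zero_mem⟩ : T.domain) = 0 := rfl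
    rw [this, T.map_zero, smul_zero]⟩
  smul_mem' := by
    rintro c u ⟨hu, hu'⟩
    refine ⟨T.domain.smul_mem c hu, ?_⟩
    have : (⟨c • u, T.domain.smul_mem c hu⟩ : T.domain) = c • ⟨u, hu⟩ := rfl
    rw [this, T.map_smul, hu', smul_comm]

/-- The even functions (`s = 1`) or the odd functions (`s = -1`) in `L²(ℝ)`. -/
def paritySector (s : ℤˣ) : Submodule ℂ L2 where
  carrier := {ψ | ∀ᵐ x : ℝ, ψ (-x) = ((s : ℤ) : ℂ) * ψ x}
  add_mem' := by
    intro u v hu hv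
    have h := Lp.coeFn_add u v
    have h' := (Measure.measurePreserving_neg (volume : Measure ℝ)).quasiMeasurePreserving.ae h
    filter_upwards [hu, hv, h, h'] with x h1 h2 h3 h4
    rw [h3, h4, Pi.add_apply, Pi.add_apply, h1, h2, mul_add]
  zero_mem' := by
    have h := Lp.coeFn_zero ℂ 2 (volume : Measure ℝ)
    have h' := (Measure.measurePreserving_neg (volume : Measure ℝ)).quasiMeasurePreserving.ae h
    filter_upwards [h, h'] with x h1 h2
    rw [h1, h2, Pi.zero_apply, Pi.zero_apply, mul_zero]
  smul_mem' := by
    intro c u hu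
    have h := Lp.coeFn_smul c u
    have h' := (Measure.measurePreserving_neg (volume : Measure ℝ)).quasiMeasurePreserving.ae h
    filter_upwards [hu, h, h'] with x h1 h3 h4
    rw [h3, h4, Pi.smul_apply, Pi.smul_apply, h1, smul_eq_mul, smul_eq_mul]
    ring

lemma mem_formGraph_iff (t : H1 → H1 →ₗ[ℂ] ℂ) (ψ f : L2) : (ψ, f) ∈ formGraph t ↔
    ∃ h : ψ ∈ H1, ∀ φ : H1, t φ ⟨ψ, h⟩ = inner ℂ (φ : L2) f := Iff.rfl

/-- The operator `H_C = ½ p² + 2 ln(r/2) δ - fp 1/|x|`, defined through its form. -/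
noncomputable def HC (r : ℝ) : L2 →ₗ.[ℂ] L2 := formOperator (formC r)
/-- The effective operator `H_eff = -½ d²/dx² - V_eff`, with form domain `H¹(ℝ)`. -/
noncomputable def Heff (r : ℝ) : L2 →ₗ.[ℂ] L2 := formOperator (formEff r)

/-- `E` is an eigenvalue of `T` of parity `s`: it has a nonzero eigenfunction of that parity. -/
def IsParityEigenvalue (T : L2 →ₗ.[ℂ] L2) (s : ℤˣ) (E : ℝ) : Prop :=
  eigenspace T E ⊓ paritySector s ≠ ⊥

end Nanotube

/-!
The Sobolev space `H¹(ℝ)`, realised as the graph `Sob` of the weak derivative, is a Hilbert space on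
which both quadratic forms are the forms of bounded self-adjoint operators `opC r` and `opE r`
(`formC_toH1`, `formEff_toH1`). With `ι : H¹(ℝ) → L²(ℝ)` the embedding, the spectral problem of the
operator generated by the form of `A` becomes the question where the pencil `A - E ι†ι` is
invertible. For `E < 0` the pencil is the sum of a coercive and a compact operator, so its failure to
be invertible means that there is an eigenfunction (`isUnit_pencil_formOp`).

*Comparison.* Integration by parts against the primitive of `Veff r` shows that the two operators on
`H¹(ℝ)` differ by `O(r^{1/4})` in norm (`exists_norm_sub_le`). The constant `2 log r` in the form of
`H_C` is matched by the primitive because the mean of `log (sin θ)` is `-log 2`. The lower bounds of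
the forms diverge only like `(log r)²`, so that comparison of the resolvents gives, for every
eigenvalue of one operator below a fixed negative energy, an eigenvalue of the other one with the
same parity at a distance `o(1 / |log r|)` (`eventually_near`).

*Fixed energies.* To see that such partners lie on the same side of a fixed energy `a < 0`, consider
normalised eigenfunctions along a sequence `r → 0`. They have a limit that vanishes at the origin and
solves the Coulomb equation up to a multiple of the Dirac distribution (`exists_limit_eigenfunction`).
By unique continuation from the origin (`exists_deriv_zero`) such a solution is determined by the
coefficient of the Dirac distribution if it is even, and by its derivative at the origin if it is odd.
Hence even eigenvalues keep a distance of at least `c / |log r|` from `a` (`exists_no_even_near`),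
which exceeds the distance of the partners. The odd eigenvalues of `H_C` do not depend on `r` and are
isolated (`exists_odd_isolated`). Those of the effective operator do not approach `a` from below,
because `Veff r x ≤ 1 / |x|` makes the effective form the larger one on odd functions
(`exists_no_odd_below`). The same limits show that two orthogonal eigenfunctions of equal parity cannot
have nearby energies (`false_of_pair`), which gives uniqueness and simplicity of the effective eigenvalue
in `exists_simple_eigenvalue`.

*Ground state.* Dilated bump functions supported away from the origin have negative energy, so both
spectra have a least element (`exists_isLeast`). A ground state of the effective operator that
vanishes at the origin remains one after multiplication with the sign function; the sum of the two
vanishes on a half-line and hence everywhere. So evaluation at the origin is injective on the ground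
state eigenspace, which is therefore one-dimensional and even (`exists_ground_state`). The point
interaction drives the ground state energy to `-∞` (`tendsto_sInf_Heff`), and the comparison of
eigenvalues applied to the two ground states gives the last limit (`tendsto_sInf_sub`).
-/


/-! ### Coercive and self-adjoint operators -/

namespace Nanotube

set_option linter.unusedSectionVars false

section Abstract

open ContinuousLinearMap

variable {H L : Type*} [NormedAddCommGroup H] [InnerProductSpace ℂ H] [CompleteSpace H]
  [NormedAddCommGroup L] [InnerProductSpace ℂ L] [CompleteSpace L]

lemma isUnit_of_coercive {B : H →L[ℂ] H} {γ : ℝ} (hγ : 0 < γ)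
    (h : ∀ ψ, γ * ‖ψ‖ ^ 2 ≤ (inner ℂ ψ (B ψ)).re) : IsUnit B := by
  refine isUnit_of_forall_le_norm_inner_map B (c := ⟨γ, hγ.le⟩) hγ fun x => ?_
  rw [← inner_conj_symm, RCLike.norm_conj]
  calc ‖x‖ ^ 2 * γ = γ * ‖x‖ ^ 2 := mul_comm _ _
    _ ≤ _ := h x
    _ ≤ _ := Complex.re_le_norm _

lemma norm_le_of_coercive {B : H →L[ℂ] H} {γ : ℝ} (hγ : 0 < γ)
    (h : ∀ ψ, γ * ‖ψ‖ ^ 2 ≤ (inner ℂ ψ (B ψ)).re) (ψ : H) : ‖ψ‖ ≤ γ⁻¹ * ‖B ψ‖ := by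
  rcases eq_or_ne ψ 0 with rfl | h0
  · simp
  have h1 := (h ψ).trans ((Complex.re_le_norm _).trans (norm_inner_le_norm ψ (B ψ)))
  have h2 : 0 < ‖ψ‖ := norm_pos_iff.2 h0
  rw [sq, ← mul_assoc, mul_comm ‖ψ‖ ‖B ψ‖] at h1
  rw [← div_eq_inv_mul, le_div_iff₀ hγ, mul_comm]
  exact le_of_mul_le_mul_right h1 h2

/-- The Fredholm alternative for the difference of an invertible and a compact operator. -/
lemma isUnit_sub_of_injective {Q V : H →L[ℂ] H} (hQ : IsUnit Q) (hV : IsCompactOperator V)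
    (hinj : ∀ ψ, (Q - V) ψ = 0 → ψ = 0) : IsUnit (Q - V) := by
  obtain ⟨q, rfl⟩ := hQ
  set T : H →L[ℂ] H := (↑q⁻¹ : H →L[ℂ] H) * V with hT
  have hTc : IsCompactOperator T := hV.clm_comp (↑q⁻¹ : H →L[ℂ] H)
  have hfac : (↑q : H →L[ℂ] H) - V = ↑q * (1 - T) := by
    rw [hT, mul_sub, mul_one, ← mul_assoc, Units.mul_inv, one_mul]
  rcases hTc.hasEigenvalue_or_mem_resolventSet (one_ne_zero (α := ℂ)) with h | h
  · obtain ⟨v, hv⟩ := h.exists_hasEigenvector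
    refine absurd (hinj v ?_) hv.2
    have h1 : T v = v := by simpa using hv.apply_eq_smul
    rw [hfac, mul_apply_eq_comp, sub_apply, h1, one_apply_eq_self, sub_self, map_zero]
  · rw [spectrum.mem_resolventSet_iff, map_one] at h
    rw [hfac]
    exact q.isUnit.mul h

lemma re_inner_self (x : H) : (inner ℂ x x).re = ‖x‖ ^ 2 :=
  inner_self_eq_norm_sq (𝕜 := ℂ) x

lemma isPositive_cfc {R : H →L[ℂ] H} {f : ℝ → ℝ} (hf : ∀ x ∈ spectrum ℝ R, 0 ≤ f x) (ψ : H) :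
    0 ≤ (inner ℂ ψ (cfc f R ψ)).re := by
  have h : 0 ≤ cfc f R := cfc_nonneg hf
  exact ((nonneg_iff_isPositive _).1 h).re_inner_nonneg_right ψ

/-- An approximate eigenvector of a bounded self-adjoint operator lies over a point of its
spectrum. -/
lemma exists_spectrum_near {R : L →L[ℂ] L} (hR : IsSelfAdjoint R) {f : L} (hf : f ≠ 0) {μ η : ℝ}
    (h : ‖R f - (μ : ℂ) • f‖ ≤ η * ‖f‖) : ∃ ν ∈ spectrum ℝ R, |ν - μ| ≤ η := by
  by_contra! hc
  have hη : 0 ≤ η := by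
    by_contra! h'
    have := norm_nonneg (R f - (μ : ℂ) • f)
    have := mul_neg_of_neg_of_pos h' (norm_pos_iff.2 hf)
    linarith
  obtain ⟨δ, hδ, hδ'⟩ : ∃ δ : ℝ, η < δ ∧ ∀ ν ∈ spectrum ℝ R, δ ≤ |ν - μ| := by
    rcases (spectrum ℝ R).eq_empty_or_nonempty with he | hne
    · exact ⟨η + 1, by linarith, by simp [he]⟩
    · obtain ⟨ν, hν, hmin⟩ := (spectrum.isCompact (𝕜 := ℝ) R).exists_isMinOn hne
        (f := fun ν => |ν - μ|) (by fun_prop)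
      exact ⟨|ν - μ|, hc ν hν, fun ν' hν' => hmin hν'⟩
  have hpos := isPositive_cfc (R := R) (f := fun x => (x - μ) * (x - μ) - δ ^ 2) (fun x hx => by
    have h1 := hδ' x hx
    have h2 : δ ^ 2 ≤ |x - μ| ^ 2 := by gcongr; linarith
    rw [sq_abs] at h2
    nlinarith) f
  have e1 : cfc (fun x : ℝ => x - μ) R = R - algebraMap ℝ _ μ := by
    rw [cfc_sub (fun x => x) (fun _ => μ) R, cfc_id' ℝ R, cfc_const μ R]
  have e : cfc (fun x : ℝ => (x - μ) * (x - μ) - δ ^ 2) R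
      = (R - algebraMap ℝ _ μ) * (R - algebraMap ℝ _ μ) - algebraMap ℝ _ (δ ^ 2) := by
    rw [cfc_sub (fun x => (x - μ) * (x - μ)) (fun _ => δ ^ 2) R,
      cfc_mul (fun x => x - μ) (fun x => x - μ) R, e1, cfc_const (δ ^ 2) R]
  have hg : (R - algebraMap ℝ (L →L[ℂ] L) μ) f = R f - (μ : ℂ) • f := by
    rw [sub_apply, Algebra.algebraMap_eq_smul_one]; simp
  have hsa : IsSelfAdjoint (R - algebraMap ℝ (L →L[ℂ] L) μ) :=
    hR.sub (IsSelfAdjoint.algebraMap _ (IsSelfAdjoint.all μ))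
  have e3 : inner ℂ f (((R - algebraMap ℝ (L →L[ℂ] L) μ) * (R - algebraMap ℝ _ μ)) f)
      = inner ℂ (R f - (μ : ℂ) • f) (R f - (μ : ℂ) • f) := by
    rw [mul_apply_eq_comp, ← hg, ← adjoint_inner_left, hsa.adjoint_eq]
  rw [e, sub_apply, inner_sub_right, e3, Algebra.algebraMap_eq_smul_one,
    smul_apply, one_apply_eq_self] at hpos
  rw [← Complex.coe_smul, inner_smul_right, Complex.sub_re, Complex.re_ofReal_mul, re_inner_self,
    re_inner_self] at hpos
  have h4 : ‖R f - (μ : ℂ) • f‖ ^ 2 ≤ (η * ‖f‖) ^ 2 := by gcongr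
  have h5 : 0 < ‖f‖ ^ 2 := by have := norm_pos_iff.2 hf; positivity
  have h6 : η ^ 2 < δ ^ 2 := by gcongr
  nlinarith

/-- Let `R₂ ≤ R₁` be bounded self-adjoint operators, `R₁` without spectrum in `(p, q)`. If `R₁ - R₂`
is small, then eigenvalues of `R₂` do not enter `(p, q)` through `p`. To see it, pair the eigenvalue
equation with `P f - (1 - P) f`, where `P` is the spectral projection of `R₁` for `[q, ∞)`. -/
lemma eq_zero_of_gap {R₁ R₂ : L →L[ℂ] L} (h₁ : IsSelfAdjoint R₁) {p q μ c : ℝ}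
    (hgap : ∀ ν ∈ spectrum ℝ R₁, ν ∉ Ioo p q) (hW : (R₁ - R₂).IsPositive)
    (hc : ‖R₁ - R₂‖ ≤ c) (hp : p < μ) (hq : μ + c < q) {f : L} (hf : R₂ f = (μ : ℂ) • f) :
    f = 0 := by
  have hpq : p < q := by
    have := (norm_nonneg _).trans hc
    linarith
  set W := R₁ - R₂ with hWd
  obtain ⟨χ, hχc, hχ⟩ : ∃ χ : ℝ → ℝ, Continuous χ ∧
      ∀ ν ∈ spectrum ℝ R₁, (ν ≤ p ∧ χ ν = 0) ∨ (q ≤ ν ∧ χ ν = 1) := by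
    refine ⟨fun x => max 0 (min 1 ((x - p) / (q - p))), ?_, fun ν hν => ?_⟩
    · have : q - p ≠ 0 := by linarith
      fun_prop
    have h := hgap ν hν
    rw [mem_Ioo, not_and_or, not_lt, not_lt] at h
    rcases h with h | h
    · left
      refine ⟨h, max_eq_left ((min_le_right _ _).trans ?_)⟩
      exact div_nonpos_of_nonpos_of_nonneg (by linarith) (by linarith)
    · right
      have : 1 ≤ (ν - p) / (q - p) := by rw [one_le_div (by linarith)]; linarith
      exact ⟨h, by simp only []; rw [min_eq_left this, max_eq_right zero_le_one]⟩
  set P := cfc χ R₁ with hP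
  have hPP : P * P = P := by
    rw [hP, ← cfc_mul χ χ R₁ hχc.continuousOn hχc.continuousOn]
    exact cfc_congr fun ν hν => by rcases hχ ν hν with h | h <;> simp [h.2]
  have hPs : IsSelfAdjoint P := cfc_predicate χ R₁
  set u := P f
  set v := f - P f
  have hPu : P u = u := by
    change (P * P) f = _; rw [hPP]
  have hPv : P v = 0 := by rw [map_sub, hPu, sub_self]
  have huv : f = u + v := by simp [u, v]
  have horth : inner ℂ u v = (0 : ℂ) := by
    rw [← hPu, ← adjoint_inner_right, hPs.adjoint_eq, hPv, inner_zero_right]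
  have horth' : inner ℂ v u = (0 : ℂ) := by rw [← inner_conj_symm, horth, map_zero]
  have hpos := isPositive_cfc (R := R₁) (f := fun x => (2 * χ x - 1) * (x - μ) -
      ((q - μ - (μ - p)) * χ x + (μ - p))) (fun x hx => by
    rcases hχ x hx with ⟨h, h'⟩ | ⟨h, h'⟩ <;> rw [h'] <;> linarith) f
  have e1 : cfc (fun x : ℝ => x - μ) R₁ = R₁ - algebraMap ℝ _ μ := by
    rw [cfc_sub (fun x => x) (fun _ => μ) R₁, cfc_id' ℝ R₁, cfc_const μ R₁]
  have e2 : cfc (fun x : ℝ => 2 * χ x - 1) R₁ = (2 : ℝ) • P - 1 := by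
    rw [cfc_sub (fun x => 2 * χ x) (fun _ => 1) R₁, cfc_const_mul (2 : ℝ) χ R₁ hχc.continuousOn,
      cfc_const_one ℝ R₁]
  have e3 : cfc (fun x : ℝ => (q - μ - (μ - p)) * χ x + (μ - p)) R₁
      = (q - μ - (μ - p)) • P + algebraMap ℝ _ (μ - p) := by
    rw [cfc_add R₁ (fun x => (q - μ - (μ - p)) * χ x) (fun _ => μ - p),
      cfc_const_mul (q - μ - (μ - p)) χ R₁ hχc.continuousOn, cfc_const _ R₁]
  have e : cfc (fun x : ℝ => (2 * χ x - 1) * (x - μ) - ((q - μ - (μ - p)) * χ x + (μ - p))) R₁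
      = ((2 : ℝ) • P - 1) * (R₁ - algebraMap ℝ _ μ)
        - ((q - μ - (μ - p)) • P + algebraMap ℝ _ (μ - p)) := by
    rw [cfc_sub (fun x => (2 * χ x - 1) * (x - μ))
      (fun x => (q - μ - (μ - p)) * χ x + (μ - p)) R₁,
      cfc_mul (fun x => 2 * χ x - 1) (fun x => x - μ) R₁, e1, e2, e3]
  have hRf : (R₁ - algebraMap ℝ (L →L[ℂ] L) μ) f = W f := by
    rw [sub_apply, Algebra.algebraMap_eq_smul_one, hWd, sub_apply, hf]; simp
  have e4 : inner ℂ f ((((2 : ℝ) • P - 1) * (R₁ - algebraMap ℝ (L →L[ℂ] L) μ)) f)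
      = inner ℂ (u - v) (W f) := by
    rw [mul_apply_eq_comp, hRf, ← adjoint_inner_left]
    congr 1
    have : adjoint ((2 : ℝ) • P - 1) = (2 : ℝ) • P - 1 := by
      have : IsSelfAdjoint ((2 : ℝ) • P - 1) :=
        ((IsSelfAdjoint.all (2 : ℝ)).smul hPs).sub (IsSelfAdjoint.one _)
      exact this.adjoint_eq
    rw [this, sub_apply, smul_apply, one_apply_eq_self, two_smul]
    simp only [u, v]; abel
  have e5 : (inner ℂ (u - v) (W f)).re = (inner ℂ u (W u)).re - (inner ℂ v (W v)).re := by
    have hs : (inner ℂ v (W u)).re = (inner ℂ u (W v)).re := by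
      rw [← adjoint_inner_left, hW.isSelfAdjoint.adjoint_eq, ← inner_conj_symm, Complex.conj_re]
    rw [huv, map_add, inner_sub_left, inner_add_right, inner_add_right]
    simp only [Complex.sub_re, Complex.add_re, hs]
    ring
  have e6 : (inner ℂ f (((q - μ - (μ - p)) • P + algebraMap ℝ (L →L[ℂ] L) (μ - p)) f)).re
      = (q - μ) * ‖u‖ ^ 2 + (μ - p) * ‖v‖ ^ 2 := by
    have : ((q - μ - (μ - p)) • P + algebraMap ℝ (L →L[ℂ] L) (μ - p)) f
        = ((q - μ : ℝ) : ℂ) • u + ((μ - p : ℝ) : ℂ) • v := by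
      rw [add_apply, Algebra.algebraMap_eq_smul_one, smul_apply, smul_apply, one_apply_eq_self]
      change _ • u + _ • f = _
      rw [Complex.coe_smul, Complex.coe_smul, sub_smul (q - μ)]
      simp only [v]
      rw [smul_sub]; change _ = (q - μ) • u + ((μ - p) • f - (μ - p) • u); abel
    rw [this, huv]
    simp only [inner_add_left, inner_add_right, inner_smul_right, horth, horth', add_zero,
      zero_add, Complex.add_re, Complex.re_ofReal_mul, re_inner_self]
  have b1 : (inner ℂ u (W u)).re ≤ c * ‖u‖ ^ 2 := by
    calc _ ≤ ‖inner ℂ u (W u)‖ := Complex.re_le_norm _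
      _ ≤ ‖u‖ * ‖W u‖ := norm_inner_le_norm _ _
      _ ≤ ‖u‖ * (c * ‖u‖) := by
        gcongr; exact (W.le_opNorm u).trans (by gcongr)
      _ = _ := by ring
  have b2 : 0 ≤ (inner ℂ v (W v)).re := hW.re_inner_nonneg_right v
  rw [e, sub_apply, inner_sub_right, Complex.sub_re, e4, e5, e6] at hpos
  have z1 : (q - μ - c) * ‖u‖ ^ 2 + (μ - p) * ‖v‖ ^ 2 ≤ 0 := by linarith
  have z2 : 0 ≤ (q - μ - c) * ‖u‖ ^ 2 := mul_nonneg (by linarith) (sq_nonneg _)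
  have z3 : 0 ≤ (μ - p) * ‖v‖ ^ 2 := mul_nonneg (by linarith) (sq_nonneg _)
  have hu : u = 0 := by
    have : (q - μ - c) * ‖u‖ ^ 2 = 0 := by linarith
    rcases mul_eq_zero.1 this with h | h
    · linarith
    · exact norm_eq_zero.1 (pow_eq_zero_iff two_ne_zero |>.1 h)
  have hv : v = 0 := by
    have : (μ - p) * ‖v‖ ^ 2 = 0 := by linarith
    rcases mul_eq_zero.1 this with h | h
    · linarith
    · exact norm_eq_zero.1 (pow_eq_zero_iff two_ne_zero |>.1 h)
  rw [huv, hu, hv, add_zero]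

end Abstract

end Nanotube

/-! ### Operator pencils -/

namespace Nanotube

set_option linter.unusedSectionVars false

section Pencil

open ContinuousLinearMap

variable {H L : Type*} [NormedAddCommGroup H] [InnerProductSpace ℂ H] [CompleteSpace H]
  [NormedAddCommGroup L] [InnerProductSpace ℂ L] [CompleteSpace L]

/-- The operator `A - E ι†ι`, whose form on `H` is `⟨φ, A ψ⟩ - E ⟨ι φ, ι ψ⟩`. -/
noncomputable def pencil (ι : H →L[ℂ] L) (A : H →L[ℂ] H) (E : ℝ) : H →L[ℂ] H :=
  A - (E : ℂ) • (adjoint ι).comp ι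

lemma pencil_apply (ι : H →L[ℂ] L) (A : H →L[ℂ] H) (E : ℝ) (ψ : H) :
    pencil ι A E ψ = A ψ - (E : ℂ) • adjoint ι (ι ψ) := rfl

lemma inner_pencil (ι : H →L[ℂ] L) (A : H →L[ℂ] H) (E : ℝ) (φ ψ : H) :
    inner ℂ φ (pencil ι A E ψ) = inner ℂ φ (A ψ) - E * inner ℂ (ι φ) (ι ψ) := by
  rw [pencil_apply, inner_sub_right, inner_smul_right, adjoint_inner_right]

lemma re_inner_pencil (ι : H →L[ℂ] L) (A : H →L[ℂ] H) (E : ℝ) (ψ : H) :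
    (inner ℂ ψ (pencil ι A E ψ)).re = (inner ℂ ψ (A ψ)).re - E * ‖ι ψ‖ ^ 2 := by
  rw [inner_pencil, Complex.sub_re, Complex.re_ofReal_mul, re_inner_self]

lemma isSelfAdjoint_pencil (ι : H →L[ℂ] L) {A : H →L[ℂ] H} (hA : IsSelfAdjoint A) (E : ℝ) :
    IsSelfAdjoint (pencil ι A E) := by
  refine hA.sub ?_
  have h : IsSelfAdjoint ((adjoint ι).comp ι) := by
    rw [isSelfAdjoint_iff', adjoint_comp, adjoint_adjoint]
  have := (IsSelfAdjoint.all E).smul h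
  rwa [← Complex.coe_smul] at this

/-- The resolvent `(T - E)⁻¹` of the operator `T` generated by the form `⟨φ, A ψ⟩`. -/
noncomputable def resolventOp (ι : H →L[ℂ] L) (A : H →L[ℂ] H) (E : ℝ) : L →L[ℂ] L :=
  ι.comp ((Ring.inverse (pencil ι A E)).comp (adjoint ι))

lemma inverse_apply_self {B : H →L[ℂ] H} (hB : IsUnit B) (ψ : H) : Ring.inverse B (B ψ) = ψ := by
  change (Ring.inverse B * B) ψ = ψ
  rw [Ring.inverse_mul_cancel _ hB]; rfl

lemma self_inverse_apply {B : H →L[ℂ] H} (hB : IsUnit B) (ψ : H) : B (Ring.inverse B ψ) = ψ := by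
  change (B * Ring.inverse B) ψ = ψ
  rw [Ring.mul_inverse_cancel _ hB]; rfl

lemma isSelfAdjoint_inverse {B : H →L[ℂ] H} (hB : IsUnit B) (hs : IsSelfAdjoint B) :
    IsSelfAdjoint (Ring.inverse B) := by
  rw [isSelfAdjoint_iff_isSymmetric]
  intro x y
  have hs' := isSelfAdjoint_iff_isSymmetric.1 hs
  have := hs' (Ring.inverse B x) (Ring.inverse B y)
  simp only [ContinuousLinearMap.coe_coe, self_inverse_apply hB] at this ⊢
  exact this.symm

lemma isSelfAdjoint_resolventOp (ι : H →L[ℂ] L) {A : H →L[ℂ] H} (hA : IsSelfAdjoint A) {E : ℝ}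
    (hu : IsUnit (pencil ι A E)) : IsSelfAdjoint (resolventOp ι A E) := by
  have := (isSelfAdjoint_inverse hu (isSelfAdjoint_pencil ι hA E)).conj_adjoint ι
  exact this

/-- If `E` is a regular value of the pencil, then `1 / (E - z)` is in the resolvent set of the
resolvent at `z`. -/
lemma notMem_spectrum_resolventOp (ι : H →L[ℂ] L) {A : H →L[ℂ] H} {z E : ℝ}
    (hz : IsUnit (pencil ι A z)) (hE : IsUnit (pencil ι A E)) (hne : E - z ≠ 0) :
    (E - z)⁻¹ ∉ spectrum ℝ (resolventOp ι A z) := by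
  rw [spectrum.notMem_iff, IsUnit.sub_iff, isUnit_iff_bijective]
  have hc : ((E - z : ℝ) : ℂ) ≠ 0 := by exact_mod_cast hne
  have hsub : ∀ f, (resolventOp ι A z - algebraMap ℝ (L →L[ℂ] L) (E - z)⁻¹) f
      = resolventOp ι A z f - ((E - z : ℝ) : ℂ)⁻¹ • f := by
    intro f
    rw [sub_apply, Algebra.algebraMap_eq_smul_one, smul_apply, one_apply_eq_self, ← Complex.coe_smul,
      Complex.ofReal_inv]
  have hd : ∀ ψ, pencil ι A z ψ = pencil ι A E ψ + ((E - z : ℝ) : ℂ) • adjoint ι (ι ψ) := by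
    intro ψ
    rw [pencil_apply, pencil_apply, Complex.ofReal_sub, sub_smul]; abel
  set c : ℂ := ((E - z : ℝ) : ℂ)
  constructor
  · rw [injective_iff_map_eq_zero]
    intro f hf
    rw [hsub, sub_eq_zero] at hf
    set ψ := Ring.inverse (pencil ι A z) (adjoint ι f) with hψ
    have h1 : ι ψ = c⁻¹ • f := hf
    have h2 : pencil ι A E ψ = 0 := by
      have := self_inverse_apply hz (adjoint ι f)
      rw [← hψ, hd, h1, map_smul, smul_smul, mul_inv_cancel₀ hc, one_smul] at this
      simpa using this
    have h3 : ψ = 0 := by rw [← inverse_apply_self hE ψ, h2, map_zero]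
    rw [h3, map_zero] at h1
    exact (smul_eq_zero.1 h1.symm).resolve_left (inv_ne_zero hc)
  · intro g
    set ψ := Ring.inverse (pencil ι A E) (adjoint ι g) with hψ
    have h1 : pencil ι A z ψ = adjoint ι (g + c • ι ψ) := by
      rw [hd, hψ, self_inverse_apply hE, map_add, map_smul]
    have h2 : resolventOp ι A z (g + c • ι ψ) = ι ψ := by
      change ι (Ring.inverse (pencil ι A z) (adjoint ι (g + c • ι ψ))) = _
      rw [← h1, inverse_apply_self hz]
    refine ⟨-(c • (g + c • ι ψ)), ?_⟩
    rw [hsub, map_neg, map_smul, h2, smul_neg, smul_smul, inv_mul_cancel₀ hc, one_smul]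
    abel

lemma coercive_pencil {ι : H →L[ℂ] L} {A : H →L[ℂ] H} {γ l : ℝ}
    (h : ∀ ψ, γ * ‖ψ‖ ^ 2 ≤ (inner ℂ ψ (A ψ)).re + l * ‖ι ψ‖ ^ 2) (ψ : H) :
    γ * ‖ψ‖ ^ 2 ≤ (inner ℂ ψ (pencil ι A (-l) ψ)).re := by
  rw [re_inner_pencil]
  linarith [h ψ]

lemma norm_resolventOp_sub_le {ι : H →L[ℂ] L} (hι : ‖ι‖ ≤ 1) {A₁ A₂ : H →L[ℂ] H} {γ l c : ℝ}
    (hγ : 0 < γ)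
    (h₁ : ∀ ψ, γ * ‖ψ‖ ^ 2 ≤ (inner ℂ ψ (A₁ ψ)).re + l * ‖ι ψ‖ ^ 2)
    (h₂ : ∀ ψ, γ * ‖ψ‖ ^ 2 ≤ (inner ℂ ψ (A₂ ψ)).re + l * ‖ι ψ‖ ^ 2)
    (hc : ‖A₁ - A₂‖ ≤ c) :
    ‖resolventOp ι A₁ (-l) - resolventOp ι A₂ (-l)‖ ≤ c / γ ^ 2 := by
  have hc0 : 0 ≤ c := (norm_nonneg _).trans hc
  refine opNorm_le_bound _ (by positivity) fun f => ?_
  have k₁ := norm_le_of_coercive hγ (coercive_pencil h₁)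
  have k₂ := norm_le_of_coercive hγ (coercive_pencil h₂)
  have u₁ := isUnit_of_coercive hγ (coercive_pencil h₁)
  have u₂ := isUnit_of_coercive hγ (coercive_pencil h₂)
  have hι' : ∀ ψ, ‖ι ψ‖ ≤ ‖ψ‖ := fun ψ => (ι.le_opNorm ψ).trans
    (by have := mul_le_mul_of_nonneg_right hι (norm_nonneg ψ); rwa [one_mul] at this)
  have hι'' : ‖adjoint ι f‖ ≤ ‖f‖ := (le_opNorm _ f).trans (by
    rw [LinearIsometryEquiv.norm_map]
    have := mul_le_mul_of_nonneg_right hι (norm_nonneg f); rwa [one_mul] at this)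
  set ψ₁ := Ring.inverse (pencil ι A₁ (-l)) (adjoint ι f) with e₁
  set ψ₂ := Ring.inverse (pencil ι A₂ (-l)) (adjoint ι f) with e₂
  have b₁ : pencil ι A₁ (-l) ψ₁ = adjoint ι f := self_inverse_apply u₁ _
  have b₂ : pencil ι A₂ (-l) ψ₂ = adjoint ι f := self_inverse_apply u₂ _
  have b : pencil ι A₂ (-l) (ψ₁ - ψ₂) = -((A₁ - A₂) ψ₁) := by
    rw [map_sub, b₂, ← b₁, pencil_apply, pencil_apply, sub_apply]; abel
  have e : (resolventOp ι A₁ (-l) - resolventOp ι A₂ (-l)) f = ι (ψ₁ - ψ₂) := by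
    rw [map_sub]; rfl
  rw [e]
  calc ‖ι (ψ₁ - ψ₂)‖ ≤ ‖ψ₁ - ψ₂‖ := hι' _
    _ ≤ γ⁻¹ * ‖(A₁ - A₂) ψ₁‖ := by have := k₂ (ψ₁ - ψ₂); rwa [b, norm_neg] at this
    _ ≤ γ⁻¹ * (c * (γ⁻¹ * ‖f‖)) := by
      gcongr
      refine ((A₁ - A₂).le_opNorm ψ₁).trans ?_
      gcongr
      refine (k₁ ψ₁).trans ?_
      rw [b₁]; gcongr
    _ = c / γ ^ 2 * ‖f‖ := by field_simp

lemma resolventOp_apply_of_pencil_eq_zero {ι : H →L[ℂ] L} {A : H →L[ℂ] H} {z E : ℝ}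
    (hz : IsUnit (pencil ι A z)) (hne : E - z ≠ 0) {ψ : H} (hψ : pencil ι A E ψ = 0) :
    resolventOp ι A z (ι ψ) = (((E - z)⁻¹ : ℝ) : ℂ) • ι ψ := by
  have hc : ((E - z : ℝ) : ℂ) ≠ 0 := by exact_mod_cast hne
  have hd : pencil ι A z ψ = ((E - z : ℝ) : ℂ) • adjoint ι (ι ψ) := by
    rw [pencil_apply, sub_eq_zero] at hψ
    rw [pencil_apply, hψ, Complex.ofReal_sub, sub_smul]
  have h1 : adjoint ι (ι ψ) = ((E - z : ℝ) : ℂ)⁻¹ • pencil ι A z ψ := by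
    rw [hd, smul_smul, inv_mul_cancel₀ hc, one_smul]
  change ι (Ring.inverse (pencil ι A z) (adjoint ι (ι ψ))) = _
  rw [h1, map_smul, inverse_apply_self hz, map_smul, Complex.ofReal_inv]

/-- Let `A₁` and `A₂` be close. Then a negative eigenvalue of the pencil of `A₁` is close to a
singular value of the pencil of `A₂`, with a bound in terms of the lower bound `-l` of the forms. The
resolvents at `-l` are close in norm, and `E` corresponds to the eigenvalue `1 / (E + l)` of the
first one. -/
lemma exists_pencil_near {ι : H →L[ℂ] L} (hι : ‖ι‖ ≤ 1) {A₁ A₂ : H →L[ℂ] H}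
    (hA₂ : IsSelfAdjoint A₂) {γ l c : ℝ} (hγ : 0 < γ)
    (h₁ : ∀ ψ, γ * ‖ψ‖ ^ 2 ≤ (inner ℂ ψ (A₁ ψ)).re + l * ‖ι ψ‖ ^ 2)
    (h₂ : ∀ ψ, γ * ‖ψ‖ ^ 2 ≤ (inner ℂ ψ (A₂ ψ)).re + l * ‖ι ψ‖ ^ 2)
    (hc : ‖A₁ - A₂‖ ≤ c) (hsmall : 2 * l * (c / γ ^ 2) ≤ 1) {E : ℝ} (hE : E < 0) {ψ : H}
    (hψ : ψ ≠ 0) (hψE : pencil ι A₁ E ψ = 0) :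
    ∃ E' : ℝ, |E' - E| ≤ 2 * (c / γ ^ 2) * l ^ 2 ∧ ¬ IsUnit (pencil ι A₂ E') := by
  have hc0 : 0 ≤ c := (norm_nonneg _).trans hc
  have u₁ := isUnit_of_coercive hγ (coercive_pencil h₁)
  have u₂ := isUnit_of_coercive hγ (coercive_pencil h₂)
  have hψ0 : 0 < ‖ψ‖ := norm_pos_iff.2 hψ
  have hpos : γ * ‖ψ‖ ^ 2 ≤ (E + l) * ‖ι ψ‖ ^ 2 := by
    have h := re_inner_pencil ι A₁ E ψ
    rw [hψE, inner_zero_right, Complex.zero_re] at h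
    have := h₁ ψ
    linarith
  have hpos' : 0 < (E + l) * ‖ι ψ‖ ^ 2 := lt_of_lt_of_le (by positivity) hpos
  have hEl : 0 < E + l := pos_of_mul_pos_left hpos' (sq_nonneg _)
  have hf : ι ψ ≠ 0 := fun h => by simp [h] at hpos'
  have hl : 0 < l := by linarith
  set μ : ℝ := (E + l)⁻¹ with hμ
  set η : ℝ := c / γ ^ 2 with hη
  have hη0 : 0 ≤ η := by positivity
  have hR : resolventOp ι A₁ (-l) (ι ψ) = (μ : ℂ) • ι ψ := by
    have := resolventOp_apply_of_pencil_eq_zero u₁ (by rw [sub_neg_eq_add]; exact hEl.ne') hψE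
    rwa [sub_neg_eq_add] at this
  have hd := norm_resolventOp_sub_le hι hγ h₁ h₂ hc
  obtain ⟨ν, hν, hνμ⟩ := exists_spectrum_near (isSelfAdjoint_resolventOp ι hA₂ u₂) hf (μ := μ)
    (η := η) (by
      rw [← hR, ← norm_neg, neg_sub]
      exact ((resolventOp ι A₁ (-l) - resolventOp ι A₂ (-l)).le_opNorm _).trans (by gcongr))
  have hμl : l⁻¹ ≤ μ := by rw [hμ]; gcongr; linarith
  have hηl : η ≤ l⁻¹ / 2 := by
    rw [inv_eq_one_div, div_div, le_div_iff₀ (by positivity)]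
    linarith
  have hν1 : l⁻¹ / 2 ≤ ν := by have := (abs_le.1 hνμ).1; linarith
  have hν0 : 0 < ν := lt_of_lt_of_le (by positivity) hν1
  refine ⟨ν⁻¹ - l, ?_, fun hu => ?_⟩
  · have hE' : E = μ⁻¹ - l := by rw [hμ, inv_inv]; ring
    have hμ0 : 0 < μ := by positivity
    have : ν⁻¹ - l - E = (μ - ν) * (ν⁻¹ * μ⁻¹) := by rw [hE']; field_simp; ring
    rw [this, abs_mul, abs_sub_comm, abs_of_pos (by positivity : 0 < ν⁻¹ * μ⁻¹)]
    have i1 : ν⁻¹ ≤ 2 * l := by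
      rw [inv_le_comm₀ hν0 (by positivity)]
      calc (2 * l)⁻¹ = l⁻¹ / 2 := by rw [mul_inv]; ring
        _ ≤ ν := hν1
    have i2 : μ⁻¹ ≤ l := by rw [hμ, inv_inv]; linarith
    calc |ν - μ| * (ν⁻¹ * μ⁻¹) ≤ η * (2 * l * l) := by gcongr
      _ = 2 * η * l ^ 2 := by ring
  · have := notMem_spectrum_resolventOp ι u₂ hu
      (by rw [sub_neg_eq_add, sub_add_cancel]; positivity)
    rw [sub_neg_eq_add, sub_add_cancel, inv_inv] at this
    exact this hν

/-- If the form of `A₂` is above that of `A₁` and close to it, then eigenvalues of `A₂` do not enter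
a gap `(a', a)` of `A₁` through its right end point. -/
lemma pencil_injective_of_gap {ι : H →L[ℂ] L} (hι : ‖ι‖ ≤ 1) (hinj : Function.Injective ι)
    {A₁ A₂ : H →L[ℂ] H} (hA₁ : IsSelfAdjoint A₁) (hA₂ : IsSelfAdjoint A₂) {γ l c : ℝ} (hγ : 0 < γ)
    (h₁ : ∀ ψ, γ * ‖ψ‖ ^ 2 ≤ (inner ℂ ψ (A₁ ψ)).re + l * ‖ι ψ‖ ^ 2)
    (h₂ : ∀ ψ, γ * ‖ψ‖ ^ 2 ≤ (inner ℂ ψ (A₂ ψ)).re + l * ‖ι ψ‖ ^ 2)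
    (hle : ∀ ψ, (inner ℂ ψ (A₁ ψ)).re ≤ (inner ℂ ψ (A₂ ψ)).re)
    (hc : ‖A₁ - A₂‖ ≤ c) {a' a E : ℝ} (ha' : 0 < a' + l)
    (hgap : ∀ x ∈ Ioo a' a, IsUnit (pencil ι A₁ x)) (hEa : E < a) (haE : a' < E)
    (hE : (E + l)⁻¹ + c / γ ^ 2 < (a' + l)⁻¹) {ψ : H} (hψE : pencil ι A₂ E ψ = 0) : ψ = 0 := by
  have u₁ := isUnit_of_coercive hγ (coercive_pencil h₁)
  have u₂ := isUnit_of_coercive hγ (coercive_pencil h₂)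
  have s₁ := isSelfAdjoint_pencil ι hA₁ (-l)
  have s₂ := isSelfAdjoint_pencil ι hA₂ (-l)
  have hpos : 0 ≤ pencil ι A₁ (-l) := by
    rw [nonneg_iff_isPositive, isPositive_def']
    refine ⟨s₁, fun x => ?_⟩
    rw [reApplyInnerSelf, ← inner_conj_symm, RCLike.conj_re]
    exact le_trans (by positivity) (coercive_pencil h₁ x)
  have hle' : pencil ι A₁ (-l) ≤ pencil ι A₂ (-l) := by
    rw [ContinuousLinearMap.le_def, isPositive_def']
    refine ⟨s₂.sub s₁, fun x => ?_⟩
    rw [reApplyInnerSelf, ← inner_conj_symm, RCLike.conj_re, sub_apply, inner_sub_right, map_sub]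
    have := hle x
    have e1 := re_inner_pencil ι A₁ (-l) x
    have e2 := re_inner_pencil ι A₂ (-l) x
    change 0 ≤ (inner ℂ x _).re - (inner ℂ x _).re
    linarith
  have hG : Ring.inverse (pencil ι A₂ (-l)) ≤ Ring.inverse (pencil ι A₁ (-l)) :=
    CStarAlgebra.ringInverse_le_ringInverse hle' (u₁.isStrictlyPositive hpos)
  have hW : (resolventOp ι A₁ (-l) - resolventOp ι A₂ (-l)).IsPositive := by
    rw [ContinuousLinearMap.le_def] at hG
    have := hG.conj_adjoint ι
    convert this using 1
    ext f
    simp [resolventOp]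
  have hf := resolventOp_apply_of_pencil_eq_zero u₂
    (by rw [sub_neg_eq_add]; linarith : E - -l ≠ 0) hψE
  rw [sub_neg_eq_add] at hf
  have := eq_zero_of_gap (isSelfAdjoint_resolventOp ι hA₁ u₁) (p := (a + l)⁻¹) (q := (a' + l)⁻¹)
    (fun ν hν hν' => by
      have hal : 0 < a + l := by linarith
      have hν0 : 0 < ν := lt_trans (by positivity) hν'.1
      have i1 : ν⁻¹ < a + l := by rw [inv_lt_comm₀ hν0 hal]; exact hν'.1
      have i2 : a' + l < ν⁻¹ := by rw [lt_inv_comm₀ ha' hν0]; exact hν'.2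
      have := notMem_spectrum_resolventOp ι u₁ (hgap (ν⁻¹ - l) ⟨by linarith, by linarith⟩)
        (by rw [sub_neg_eq_add, sub_add_cancel]; positivity)
      rw [sub_neg_eq_add, sub_add_cancel, inv_inv] at this
      exact this hν)
    hW (norm_resolventOp_sub_le hι hγ h₁ h₂ hc) (μ := (E + l)⁻¹)
    (inv_strictAnti₀ (by linarith) (by linarith)) hE hf
  exact hinj (by rw [this, map_zero])

/-- The infimum of the Rayleigh quotient is a singular value of the pencil. -/
lemma exists_ground_level {ι : H →L[ℂ] L} (hι : ‖ι‖ ≤ 1)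
    {A : H →L[ℂ] H} (hA : IsSelfAdjoint A) {γ l : ℝ} (hγ : 0 < γ)
    (h : ∀ ψ, γ * ‖ψ‖ ^ 2 ≤ (inner ℂ ψ (A ψ)).re + l * ‖ι ψ‖ ^ 2)
    {ψ₀ : H} (hψ₀ : (inner ℂ ψ₀ (A ψ₀)).re < 0) :
    ∃ E : ℝ, E < 0 ∧ ¬ IsUnit (pencil ι A E) ∧
      ∀ ψ, E * ‖ι ψ‖ ^ 2 ≤ (inner ℂ ψ (A ψ)).re := by
  have hι' : ∀ ψ, ‖ι ψ‖ ≤ ‖ψ‖ := fun ψ => (ι.le_opNorm ψ).trans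
    (by have := mul_le_mul_of_nonneg_right hι (norm_nonneg ψ); rwa [one_mul] at this)
  set S : Set ℝ := (fun ψ => (inner ℂ ψ (A ψ)).re / ‖ι ψ‖ ^ 2) '' {ψ | ι ψ ≠ 0} with hS
  have hbdd : BddBelow S := by
    refine ⟨-l, ?_⟩
    rintro _ ⟨ψ, hψ, rfl⟩
    have h0 : 0 < ‖ι ψ‖ := norm_pos_iff.2 hψ
    rw [le_div_iff₀ (by positivity)]
    have : 0 ≤ γ * ‖ψ‖ ^ 2 := by positivity
    linarith [h ψ]
  have hmem : ∀ ψ, ι ψ ≠ 0 → (inner ℂ ψ (A ψ)).re / ‖ι ψ‖ ^ 2 ∈ S := fun ψ hψ => ⟨ψ, hψ, rfl⟩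
  have hψ₀' : ι ψ₀ ≠ 0 := by
    intro h0
    have := h ψ₀
    rw [h0, norm_zero] at this
    have : 0 ≤ γ * ‖ψ₀‖ ^ 2 := by positivity
    linarith
  have hmin : ∀ ψ, sInf S * ‖ι ψ‖ ^ 2 ≤ (inner ℂ ψ (A ψ)).re := by
    intro ψ
    by_cases hψ : ι ψ = 0
    · have := h ψ
      rw [hψ, norm_zero] at this ⊢
      have : 0 ≤ γ * ‖ψ‖ ^ 2 := by positivity
      linarith
    · have h0 : 0 < ‖ι ψ‖ := norm_pos_iff.2 hψ
      rw [← le_div_iff₀ (by positivity)]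
      exact csInf_le hbdd (hmem ψ hψ)
  refine ⟨sInf S, ?_, fun hu => ?_, hmin⟩
  · refine lt_of_le_of_lt (csInf_le hbdd (hmem ψ₀ hψ₀')) (div_neg_of_neg_of_pos hψ₀ ?_)
    have h0 : 0 < ‖ι ψ₀‖ := norm_pos_iff.2 hψ₀'
    positivity
  · have hs := isSelfAdjoint_pencil ι hA (sInf S)
    have hpos : 0 ≤ pencil ι A (sInf S) := by
      rw [nonneg_iff_isPositive, isPositive_def']
      refine ⟨hs, fun x => ?_⟩
      rw [reApplyInnerSelf, ← inner_conj_symm, RCLike.conj_re]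
      have e := re_inner_pencil ι A (sInf S) x
      change 0 ≤ (inner ℂ x _).re
      linarith [hmin x]
    have hsp := hu.isStrictlyPositive hpos
    have : Nontrivial H := ⟨ψ₀, 0, fun h0 => by simp [h0] at hψ₀⟩
    obtain ⟨ε, hε, hle⟩ := (CFC.exists_pos_algebraMap_le_iff (a := pencil ι A (sInf S)) hs).2
      (fun x hx => hsp.spectrum_pos hx)
    have key : ∀ ψ, ε * ‖ψ‖ ^ 2 ≤ (inner ℂ ψ (A ψ)).re - sInf S * ‖ι ψ‖ ^ 2 := by
      intro ψ
      rw [ContinuousLinearMap.le_def] at hle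
      have := hle.re_inner_nonneg_right ψ
      rw [sub_apply, inner_sub_right, map_sub, Algebra.algebraMap_eq_smul_one, smul_apply,
        one_apply_eq_self, ← Complex.coe_smul, inner_smul_right] at this
      change 0 ≤ (inner ℂ ψ _).re - Complex.re _ at this
      rw [Complex.re_ofReal_mul, re_inner_self, re_inner_pencil] at this
      linarith
    have : sInf S + ε ≤ sInf S := by
      refine le_csInf ⟨_, hmem ψ₀ hψ₀'⟩ ?_
      rintro _ ⟨ψ, hψ, rfl⟩
      have h0 : 0 < ‖ι ψ‖ := norm_pos_iff.2 hψ
      rw [le_div_iff₀ (by positivity)]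
      have h1 : ε * ‖ι ψ‖ ^ 2 ≤ ε * ‖ψ‖ ^ 2 := by
        have := hι' ψ
        gcongr
      linarith [key ψ]
    linarith

end Pencil

end Nanotube

/-! ### The Sobolev space as a Hilbert space -/

namespace Nanotube

/-- The graph of the weak derivative in `L² × L²`, with the Hilbert space structure of the product.
It is the space `H¹(ℝ)` with its Sobolev norm. -/
noncomputable def sobolevGraph : Submodule ℂ (WithLp 2 (L2 × L2)) where
  carrier := {p | IsWeakDeriv p.fst p.snd}
  add_mem' h h' := h.add_L2 h'
  zero_mem' := by
    have : IsWeakDeriv (0 : ℝ → ℂ) 0 := fun φ _ _ => by simp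
    exact this.congr (Lp.coeFn_zero ℂ 2 volume).symm (Lp.coeFn_zero ℂ 2 volume).symm
  smul_mem' c _ h := h.smul_L2 c

/-- The space `H¹(ℝ)` as a Hilbert space. -/
def Sob : Type := sobolevGraph

noncomputable instance : NormedAddCommGroup Sob := inferInstanceAs (NormedAddCommGroup sobolevGraph)

noncomputable instance : InnerProductSpace ℂ Sob :=
  inferInstanceAs (InnerProductSpace ℂ sobolevGraph)

lemma integral_smul_eq_inner {φ : ℝ → ℝ} (hφ : Continuous φ) (hs : HasCompactSupport φ) :
    ∃ k : L2, ∀ f : L2, ∫ x, φ x • f x = inner ℂ k f := by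
  have hc : Continuous fun x => (φ x : ℂ) := Complex.continuous_ofReal.comp hφ
  have hm : MemLp (fun x => (φ x : ℂ)) 2 volume :=
    hc.memLp_of_hasCompactSupport (hs.comp_left (g := fun t : ℝ => (t : ℂ)) Complex.ofReal_zero)
  refine ⟨hm.toLp, fun f => ?_⟩
  rw [L2.inner_def]
  refine integral_congr_ae ?_
  filter_upwards [hm.coeFn_toLp] with x hx
  rw [hx, RCLike.inner_apply, Complex.conj_ofReal, Complex.real_smul, mul_comm]

lemma isClosed_sobolevGraph : IsClosed (sobolevGraph : Set (WithLp 2 (L2 × L2))) := by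
  have : (sobolevGraph : Set (WithLp 2 (L2 × L2))) = ⋂ (φ : ℝ → ℝ) (_ : ContDiff ℝ ∞ φ)
      (_ : HasCompactSupport φ), {p | ∫ x, deriv φ x • p.fst x = -∫ x, φ x • p.snd x} := by
    ext p
    simp only [mem_iInter]
    rfl
  rw [this]
  refine isClosed_iInter fun φ => isClosed_iInter fun hφ => isClosed_iInter fun hs => ?_
  obtain ⟨k, hk⟩ := integral_smul_eq_inner (hφ.continuous_deriv (by exact_mod_cast le_top)) hs.deriv
  obtain ⟨k', hk'⟩ := integral_smul_eq_inner hφ.continuous hs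
  simp only [hk, hk']
  refine isClosed_eq ?_ ?_
  · exact continuous_const.inner (WithLp.fstL 2 ℂ L2 L2).continuous
  · exact (continuous_const.inner (WithLp.sndL 2 ℂ L2 L2).continuous).neg

instance : CompleteSpace Sob := isClosed_sobolevGraph.completeSpace_coe

/-- The inclusion of the graph into the product. -/
noncomputable def Sob.toProd : Sob →L[ℂ] WithLp 2 (L2 × L2) := sobolevGraph.subtypeL

/-- The embedding of `H¹(ℝ)` into `L²(ℝ)`. -/
noncomputable def incl : Sob →L[ℂ] L2 := (WithLp.fstL 2 ℂ L2 L2).comp Sob.toProd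

/-- The derivative, from `H¹(ℝ)` to `L²(ℝ)`. -/
noncomputable def der : Sob →L[ℂ] L2 := (WithLp.sndL 2 ℂ L2 L2).comp Sob.toProd

lemma isWeakDeriv_der (u : Sob) : IsWeakDeriv (incl u) (der u) := Subtype.property u

lemma norm_sq_sob (u : Sob) : ‖u‖ ^ 2 = ‖incl u‖ ^ 2 + ‖der u‖ ^ 2 :=
  WithLp.prod_norm_sq_eq_of_L2 (Sob.toProd u)

lemma norm_incl_apply_le (u : Sob) : ‖incl u‖ ≤ ‖u‖ := by
  have := norm_sq_sob u
  exact abs_le_of_sq_le_sq' (by nlinarith [sq_nonneg ‖der u‖]) (norm_nonneg _) |>.2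

lemma norm_der_apply_le (u : Sob) : ‖der u‖ ≤ ‖u‖ := by
  have := norm_sq_sob u
  exact abs_le_of_sq_le_sq' (by nlinarith [sq_nonneg ‖incl u‖]) (norm_nonneg _) |>.2

lemma norm_incl_le : ‖incl‖ ≤ 1 :=
  incl.opNorm_le_bound zero_le_one fun u => by rw [one_mul]; exact norm_incl_apply_le u

lemma incl_injective : Function.Injective incl := by
  intro u v h
  apply Subtype.ext
  refine (WithLp.ofLp_injective 2) (Prod.ext h ?_)
  have h1 := isWeakDeriv_der u
  rw [h] at h1
  exact h1.unique_L2 (isWeakDeriv_der v)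

/-- The element of `H¹(ℝ)` with given value and weak derivative. -/
noncomputable def Sob.mk (f g : L2) (h : IsWeakDeriv f g) : Sob := ⟨WithLp.toLp 2 (f, g), h⟩

/-- An element of `H¹(ℝ)`, regarded as an element of the subspace `H1` of `L²(ℝ)`. -/
noncomputable def toH1 : Sob →ₗ[ℂ] H1 where
  toFun u := ⟨incl u, der u, isWeakDeriv_der u⟩
  map_add' u v := by apply Subtype.ext; exact map_add incl u v
  map_smul' c u := by apply Subtype.ext; exact map_smul incl c u

@[simp] lemma coe_toH1 (u : Sob) : (toH1 u : L2) = incl u := rfl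

lemma toH1_surjective : Function.Surjective toH1 := fun f =>
  ⟨Sob.mk f (weakDeriv f) (isWeakDeriv_weakDeriv f), rfl⟩

lemma weakDeriv_toH1 (u : Sob) : weakDeriv (toH1 u) = der u :=
  (isWeakDeriv_weakDeriv (toH1 u)).unique_L2 (isWeakDeriv_der u)

/-- The continuous representative of an element of `H¹(ℝ)`. -/
noncomputable def rep (u : Sob) : C(ℝ, ℂ) := contRep (toH1 u)

lemma rep_ae (u : Sob) : (incl u : ℝ → ℂ) =ᵐ[volume] rep u := contRep_ae (toH1 u)

lemma rep_add (u v : Sob) : rep (u + v) = rep u + rep v := by simp [rep]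
lemma rep_sub (u v : Sob) : rep (u - v) = rep u - rep v := by simp [rep]
lemma rep_smul (c : ℂ) (u : Sob) : rep (c • u) = c • rep u := by simp [rep]

lemma eq_of_rep_eq {u v : Sob} (h : ∀ x, rep u x = rep v x) : u = v := by
  apply incl_injective
  apply Lp.ext
  filter_upwards [rep_ae u, rep_ae v] with x h1 h2
  rw [h1, h2, h]

lemma rep_eq_of_ae {u : Sob} {f : ℝ → ℂ} (hf : Continuous f) (h : (incl u : ℝ → ℂ) =ᵐ[volume] f)
    (x : ℝ) : rep u x = f x :=
  congrFun (((rep u).continuous.ae_eq_iff_eq volume hf).1 ((rep_ae u).symm.trans h)) x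

lemma intervalIntegrable_L2 (f : L2) (x y : ℝ) : IntervalIntegrable f volume x y :=
  ((L2.locallyIntegrable f).integrableOn_isCompact isCompact_uIcc).intervalIntegrable

/-- The fundamental theorem of calculus in `H¹(ℝ)`. -/
lemma rep_sub_rep (u : Sob) (x y : ℝ) : rep u y - rep u x = ∫ t in x..y, der u t := by
  obtain ⟨c, hc⟩ := (isWeakDeriv_der u).exists_ae_eq (L2.locallyIntegrable _)
    (L2.locallyIntegrable _)
  have h := rep_eq_of_ae (u := u) (f := fun x => c + ∫ t in (0 : ℝ)..x, der u t)
    (continuous_const.add (intervalIntegral.continuous_primitive (intervalIntegrable_L2 _) 0)) hc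
  rw [h, h, add_sub_add_left_eq_sub]
  exact intervalIntegral.integral_interval_sub_left (intervalIntegrable_L2 _ _ _)
    (intervalIntegrable_L2 _ _ _)

lemma norm_setIntegral_le (f : L2) {s : Set ℝ} (hs : MeasurableSet s) (hμ : volume s ≠ ⊤) :
    ‖∫ t in s, f t‖ ≤ √(volume.real s) * ‖f‖ := by
  rw [← L2.inner_indicatorConstLp_one (𝕜 := ℂ) hs hμ f]
  refine (norm_inner_le_norm _ _).trans ?_
  rw [norm_indicatorConstLp (by norm_num) (by norm_num), norm_one, one_mul, Real.sqrt_eq_rpow]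
  norm_num

/-- Hölder continuity of `H¹` functions. -/
lemma norm_rep_sub_rep_le (u : Sob) (x y : ℝ) : ‖rep u y - rep u x‖ ≤ √|y - x| * ‖der u‖ := by
  wlog h : x ≤ y generalizing x y
  · rw [norm_sub_rev, abs_sub_comm]
    exact this y x (by linarith)
  rw [rep_sub_rep, intervalIntegral.integral_of_le h]
  refine (norm_setIntegral_le (der u) measurableSet_Ioc measure_Ioc_lt_top.ne).trans_eq ?_
  rw [Real.volume_real_Ioc_of_le h, abs_of_nonneg (by linarith)]

lemma norm_sq_L2 (f : L2) : ‖f‖ ^ 2 = ∫ x, ‖f x‖ ^ 2 := by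
  rw [← inner_self_eq_norm_sq (𝕜 := ℂ), L2.inner_def, ← integral_re (L2.integrable_inner f f)]
  congr 1; ext x
  exact inner_self_eq_norm_sq (𝕜 := ℂ) (f x)

lemma integrable_norm_sq_L2 (f : L2) : Integrable fun x => ‖f x‖ ^ 2 :=
  (memLp_two_iff_integrable_sq_norm (Lp.memLp f).1).1 (Lp.memLp f)

/-- The Sobolev bound on a window of length `l`. Small `l` trades the weight of the derivative for
that of the function. -/
lemma norm_sq_rep_le (u : Sob) (x : ℝ) {l : ℝ} (hl : 0 < l) :
    ‖rep u x‖ ^ 2 ≤ 2 / l * ‖incl u‖ ^ 2 + 2 * l * ‖der u‖ ^ 2 := by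
  have h1 : ∀ y ∈ Ioc x (x + l), ‖rep u x‖ ^ 2 ≤ 2 * ‖rep u y‖ ^ 2 + 2 * l * ‖der u‖ ^ 2 := by
    intro y hy
    have h2 : ‖rep u y - rep u x‖ ≤ √l * ‖der u‖ := by
      refine (norm_rep_sub_rep_le u x y).trans ?_
      gcongr
      rw [abs_of_nonneg (by linarith [hy.1])]; linarith [hy.2]
    have h3 : ‖rep u x‖ ≤ ‖rep u y‖ + √l * ‖der u‖ := by
      have := norm_sub_le (rep u y) (rep u y - rep u x)
      rw [sub_sub_cancel] at this
      linarith
    calc ‖rep u x‖ ^ 2 ≤ (‖rep u y‖ + √l * ‖der u‖) ^ 2 := by gcongr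
      _ ≤ 2 * ‖rep u y‖ ^ 2 + 2 * (√l * ‖der u‖) ^ 2 := by
        nlinarith [sq_nonneg (‖rep u y‖ - √l * ‖der u‖)]
      _ = _ := by rw [mul_pow, Real.sq_sqrt hl.le]; ring
  have hi : Integrable fun y => ‖rep u y‖ ^ 2 :=
    (integrable_norm_sq_L2 (incl u)).congr (by filter_upwards [rep_ae u] with y hy; rw [hy])
  have hk : ∀ {c : ℝ}, IntegrableOn (fun _ => c) (Ioc x (x + l)) volume :=
    integrableOn_const measure_Ioc_lt_top.ne
  have h4 : ∫ y in Ioc x (x + l), ‖rep u x‖ ^ 2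
      ≤ ∫ y in Ioc x (x + l), (2 * ‖rep u y‖ ^ 2 + 2 * l * ‖der u‖ ^ 2) :=
    setIntegral_mono_on hk ((hi.integrableOn.const_mul 2).add hk) measurableSet_Ioc h1
  have h5 : ∫ y in Ioc x (x + l), ‖rep u y‖ ^ 2 ≤ ‖incl u‖ ^ 2 := by
    rw [norm_sq_L2, integral_congr_ae (μ := volume) (f := fun x => ‖incl u x‖ ^ 2) (g := fun y => ‖rep u y‖ ^ 2)
      (by filter_upwards [rep_ae u] with y hy; rw [hy])]
    exact setIntegral_le_integral hi (ae_of_all _ fun y => by positivity)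
  rw [integral_add (hi.integrableOn.const_mul 2) hk, setIntegral_const, setIntegral_const,
    integral_const_mul, Real.volume_real_Ioc_of_le (by linarith), add_sub_cancel_left, smul_eq_mul,
    smul_eq_mul] at h4
  have h6 : l * ‖rep u x‖ ^ 2 ≤ l * (2 / l * ‖incl u‖ ^ 2 + 2 * l * ‖der u‖ ^ 2) := by
    have : l * (2 / l * ‖incl u‖ ^ 2 + 2 * l * ‖der u‖ ^ 2)
      = 2 * ‖incl u‖ ^ 2 + l * (2 * l * ‖der u‖ ^ 2) := by field_simp
    rw [this]; linarith
  exact le_of_mul_le_mul_left h6 hl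

lemma norm_rep_le (u : Sob) (x : ℝ) : ‖rep u x‖ ≤ 2 * ‖u‖ := by
  have := norm_sq_rep_le u x one_pos
  have h := norm_sq_sob u
  refine abs_le_of_sq_le_sq' ?_ (by positivity) |>.2
  rw [mul_pow]; nlinarith [sq_nonneg ‖u‖]

/-- Evaluation at a point. -/
noncomputable def evalAt (x : ℝ) : Sob →L[ℂ] ℂ :=
  LinearMap.mkContinuous
    { toFun := fun u => rep u x
      map_add' := fun u v => by simp [rep_add]
      map_smul' := fun c u => by simp [rep_smul] } 2 fun u => norm_rep_le u x

@[simp] lemma evalAt_apply (x : ℝ) (u : Sob) : evalAt x u = rep u x := rfl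

lemma memLp_mul_rep (K : L2) (u : Sob) : MemLp (fun x => K x * rep u x) 2 volume := by
  refine MemLp.of_le_mul (c := 2 * ‖u‖) (Lp.memLp K)
    ((Lp.memLp K).1.mul (rep u).continuous.aestronglyMeasurable) (ae_of_all _ fun x => ?_)
  rw [norm_mul, mul_comm]
  gcongr
  exact norm_rep_le u x

/-- Multiplication by a square integrable function `K`, from `H¹(ℝ)` to `L²(ℝ)`. -/
noncomputable def mulOp (K : L2) : Sob →L[ℂ] L2 :=
  LinearMap.mkContinuous
    { toFun := fun u => (memLp_mul_rep K u).toLp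
      map_add' := fun u v => by
        rw [← MemLp.toLp_add]
        exact (MemLp.toLp_eq_toLp_iff _ _).2 (ae_of_all _ fun x => by simp [rep_add, mul_add])
      map_smul' := fun c u => by
        rw [RingHom.id_apply, ← MemLp.toLp_const_smul]
        exact (MemLp.toLp_eq_toLp_iff _ _).2 (ae_of_all _ fun x => by
          simp [rep_smul, mul_left_comm]) } (2 * ‖K‖) fun u => by
    rw [mul_right_comm]
    refine Lp.norm_le_mul_norm_of_ae_le_mul ?_
    filter_upwards [(memLp_mul_rep K u).coeFn_toLp] with x hx
    change ‖(memLp_mul_rep K u).toLp _ x‖ ≤ _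
    rw [hx, norm_mul, mul_comm]
    gcongr
    exact norm_rep_le u x

lemma mulOp_ae (K : L2) (u : Sob) : (mulOp K u : ℝ → ℂ) =ᵐ[volume] fun x => K x * rep u x :=
  (memLp_mul_rep K u).coeFn_toLp

lemma norm_mulOp_le (K : L2) : ‖mulOp K‖ ≤ 2 * ‖K‖ := LinearMap.mkContinuous_norm_le _ (by positivity) _

lemma mulOp_sub (K K' : L2) : mulOp (K - K') = mulOp K - mulOp K' := by
  ext1 u
  apply Lp.ext
  filter_upwards [mulOp_ae (K - K') u, mulOp_ae K u, mulOp_ae K' u, Lp.coeFn_sub K K',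
    Lp.coeFn_sub (mulOp K u) (mulOp K' u)] with x h1 h2 h3 h4 h5
  rw [sub_apply, h5, Pi.sub_apply, h1, h2, h3, h4, Pi.sub_apply, sub_mul]

end Nanotube

/-! ### Compactness of multiplication operators -/

namespace Nanotube

open ContinuousLinearMap

/-- Bounded operators with compact adjoint form a closed set. -/
lemma isClosed_compact_adjoint :
    IsClosed {T : Sob →L[ℂ] L2 | IsCompactOperator T ∧ IsCompactOperator (adjoint T)} := by
  have h1 : IsClosed {T : Sob →L[ℂ] L2 | IsCompactOperator T} :=
    isClosed_setOfPred_isCompactOperator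
  have h2 : IsClosed {T : L2 →L[ℂ] Sob | IsCompactOperator T} :=
    isClosed_setOfPred_isCompactOperator
  exact h1.inter (h2.preimage (adjoint (𝕜 := ℂ) (E := Sob) (F := L2)).continuous)

lemma isCompact_smulRight (x : ℝ) (K : L2) : IsCompactOperator ((evalAt x).smulRight K) ∧
    IsCompactOperator (adjoint ((evalAt x).smulRight K)) := by
  have e : (evalAt x).smulRight K = (toSpanSingleton ℂ K).comp (evalAt x) := by
    ext1 u; simp
  rw [e, adjoint_comp]
  refine ⟨?_, ?_⟩
  · exact (isCompactOperator_of_locallyCompactSpace_rng (toSpanSingleton ℂ K)).comp_clm (evalAt x)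
  · exact (isCompactOperator_of_locallyCompactSpace_rng (adjoint (evalAt x))).comp_clm _

/-- Approximation of a multiplication operator by operators of finite rank: `u` is replaced by the
step function of its values on a grid of mesh `s`. -/
lemma exists_finiteRank_near (K : L2) {g : ℝ → ℂ} (hg : (K : ℝ → ℂ) =ᵐ[volume] g)
    (hgs : HasCompactSupport g) {s : ℝ} (hs : 0 < s) :
    ∃ T : Sob →L[ℂ] L2, IsCompactOperator T ∧ IsCompactOperator (adjoint T) ∧
      ‖T - mulOp K‖ ≤ √s * ‖K‖ := by
  obtain ⟨R, hR⟩ := hgs.isCompact.isBounded.subset_ball 0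
  obtain ⟨m, hm⟩ := exists_nat_gt (R / s)
  have hgm : ∀ x, g x ≠ 0 → ⌊x / s⌋ ∈ Finset.Icc (-(m : ℤ) - 1) m := by
    intro x hx
    have h1 := hR (subset_tsupport g hx)
    rw [mem_ball_zero_iff, Real.norm_eq_abs, abs_lt] at h1
    rw [div_lt_iff₀ hs] at hm
    rw [Finset.mem_Icc]
    constructor
    · rw [Int.le_floor, le_div_iff₀ hs]; push_cast; nlinarith
    · apply Int.floor_le_iff.2; rw [div_lt_iff₀ hs]; push_cast; nlinarith
  let I : ℤ → Set ℝ := fun i => {x | ⌊x / s⌋ = i}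
  have hI : ∀ i, MeasurableSet (I i) := fun i =>
    measurableSet_eq_fun (by fun_prop) measurable_const
  let k : ℤ → L2 := fun i => ((Lp.memLp K).indicator (hI i)).toLp
  have hk : ∀ i, (k i : ℝ → ℂ) =ᵐ[volume] (I i).indicator K := fun i => MemLp.coeFn_toLp _
  refine ⟨∑ i ∈ Finset.Icc (-(m : ℤ) - 1) m, (evalAt (i * s)).smulRight (k i), ?_, ?_, ?_⟩
  · exact Submodule.sum_mem (compactOperator (RingHom.id ℂ) Sob L2) fun i _ =>
      (isCompact_smulRight (i * s) (k i)).1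
  · rw [show adjoint (∑ i ∈ Finset.Icc (-(m : ℤ) - 1) m, (evalAt (i * s)).smulRight (k i))
      = ∑ i ∈ Finset.Icc (-(m : ℤ) - 1) m, adjoint ((evalAt (i * s)).smulRight (k i)) from
        map_sum (adjoint (𝕜 := ℂ) (E := Sob) (F := L2)).toLinearEquiv _ _]
    exact Submodule.sum_mem (compactOperator (RingHom.id ℂ) L2 Sob) fun i _ =>
      (isCompact_smulRight (i * s) (k i)).2
  · refine opNorm_le_bound _ (by positivity) fun u => ?_
    rw [mul_right_comm]
    refine Lp.norm_le_mul_norm_of_ae_le_mul ?_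
    have hsum : (((∑ i ∈ Finset.Icc (-(m : ℤ) - 1) m, (evalAt (i * s)).smulRight (k i)) u : L2) :
        ℝ → ℂ) =ᵐ[volume] fun x => ∑ i ∈ Finset.Icc (-(m : ℤ) - 1) m,
          rep u (i * s) * (I i).indicator K x := by
      rw [sum_apply]
      have h1 : ∀ᵐ x, ∀ i : ℤ, ((rep u (i * s) • k i : L2) : ℝ → ℂ) x
          = rep u (i * s) * (I i).indicator K x := by
        rw [ae_all_iff]
        intro i
        filter_upwards [Lp.coeFn_smul (rep u (i * s)) (k i), hk i] with x h1 h2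
        rw [h1, Pi.smul_apply, h2, smul_eq_mul]
      filter_upwards [Lp.coeFn_fun_finsetSum (Finset.Icc (-(m : ℤ) - 1) m)
        (fun i => rep u (i * s) • k i), h1] with x h2 h3
      simp only [smulRight_apply, evalAt_apply]
      rw [h2]
      exact Finset.sum_congr rfl fun i _ => h3 i
    filter_upwards [hsum, mulOp_ae K u, hg, Lp.coeFn_sub
      ((∑ i ∈ Finset.Icc (-(m : ℤ) - 1) m, (evalAt (i * s)).smulRight (k i)) u) (mulOp K u)]
      with x h1 h2 h3 h4
    rw [sub_apply, h4, Pi.sub_apply, h1, h2]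
    by_cases hx : g x = 0
    · have : ∑ i ∈ Finset.Icc (-(m : ℤ) - 1) m, rep u (i * s) * (I i).indicator K x = 0 := by
        refine Finset.sum_eq_zero fun i _ => ?_
        rw [indicator_apply, h3, hx, ite_self, mul_zero]
      rw [this, h3, hx]; simp
    · rw [Finset.sum_eq_single_of_mem ⌊x / s⌋ (hgm x hx) fun i _ hi => by
        rw [indicator_of_notMem (fun h => hi h.symm), mul_zero]]
      rw [indicator_of_mem (show x ∈ I ⌊x / s⌋ from rfl), mul_comm, ← mul_sub, norm_mul, mul_comm]
      gcongr
      refine (norm_rep_sub_rep_le u _ _).trans ?_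
      gcongr
      · rw [abs_le]
        have h5 := Int.floor_le (x / s)
        have h6 := Int.lt_floor_add_one (x / s)
        rw [le_div_iff₀ hs] at h5
        rw [div_lt_iff₀ hs] at h6
        constructor <;> nlinarith
      · exact norm_der_apply_le u

/-- Multiplication by a square integrable function is a compact operator from `H¹(ℝ)` to
`L²(ℝ)`, and so is its adjoint. -/
lemma isCompact_mulOp (K : L2) :
    IsCompactOperator (mulOp K) ∧ IsCompactOperator (adjoint (mulOp K)) := by
  have hcont : Continuous mulOp := by
    refine (LipschitzWith.of_dist_le_mul (α := L2) (β := Sob →L[ℂ] L2) (K := 2) fun K K' => ?_).continuous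
    refine (dist_eq_norm (mulOp K) (mulOp K')).le.trans ?_
    rw [← mulOp_sub, dist_eq_norm]
    exact norm_mulOp_le _
  have hcl : IsClosed {K : L2 | IsCompactOperator (mulOp K) ∧
      IsCompactOperator (adjoint (mulOp K))} := isClosed_compact_adjoint.preimage hcont
  have hd := Lp.dense_hasCompactSupport_contDiff (E := ℝ) (F := ℂ) (μ := volume) (p := 2)
    (by norm_num)
  have : ∀ K : L2, K ∈ {K : L2 | IsCompactOperator (mulOp K) ∧
      IsCompactOperator (adjoint (mulOp K))} := by
    intro K
    refine hcl.closure_subset_iff.2 ?_ (hd K)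
    rintro K ⟨g, hKg, hgs, -⟩
    have hm : mulOp K ∈ closure {T : Sob →L[ℂ] L2 | IsCompactOperator T ∧
        IsCompactOperator (adjoint T)} := by
      refine (Metric.mem_closure_iff (α := Sob →L[ℂ] L2)).2 ?_
      intro ε hε
      obtain ⟨s, hs, hsε⟩ : ∃ s : ℝ, 0 < s ∧ √s * ‖K‖ < ε := by
        refine ⟨(ε / (‖K‖ + 1)) ^ 2, by positivity, ?_⟩
        rw [Real.sqrt_sq (by positivity), div_mul_eq_mul_div, div_lt_iff₀ (by positivity)]
        nlinarith [norm_nonneg K]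
      obtain ⟨T, hT, hT', hTK⟩ := exists_finiteRank_near K hKg hgs hs
      refine ⟨T, ⟨hT, hT'⟩, ?_⟩
      rw [dist_comm]
      exact (dist_eq_norm T (mulOp K)).le.trans_lt (hTK.trans_lt hsε)
    rwa [isClosed_compact_adjoint.closure_eq] at hm
  exact this K

end Nanotube

/-! ### Forms as bounded operators on the Sobolev space -/

namespace Nanotube

open ContinuousLinearMap

/-- The bounded operator on `H¹(ℝ)` with the form
`½⟨φ', ψ'⟩ - (⟨φ', Kψ⟩ + ⟨Kφ, ψ'⟩ + ⟨φ, Vψ⟩) + α conj(φ(0)) ψ(0)`. Both operators of interest have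
such a form: the singular part of the Coulomb potential enters as minus the derivative of the square
integrable function `K`. -/
noncomputable def formOp (K V : L2) (α : ℝ) : Sob →L[ℂ] Sob :=
  (1 / 2 : ℂ) • (adjoint der).comp der
    - ((adjoint der).comp (mulOp K) + (adjoint (mulOp K)).comp der + (adjoint incl).comp (mulOp V))
    + (α : ℂ) • (adjoint (evalAt 0)).comp (evalAt 0)

lemma inner_formOp (K V : L2) (α : ℝ) (φ ψ : Sob) : inner ℂ φ (formOp K V α ψ)
    = (1 / 2 : ℂ) * inner ℂ (der φ) (der ψ)
      - (inner ℂ (der φ) (mulOp K ψ) + inner ℂ (mulOp K φ) (der ψ) + inner ℂ (incl φ) (mulOp V ψ))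
      + α * (star (rep φ 0) * rep ψ 0) := by
  simp only [formOp, add_apply, sub_apply, smul_apply, comp_apply, inner_add_right, inner_sub_right,
    inner_smul_right, adjoint_inner_right, RCLike.inner_apply, evalAt_apply]
  rw [mul_comm (rep ψ 0)]
  rfl

lemma inner_incl_mulOp (V : L2) (φ ψ : Sob) :
    inner ℂ (incl φ) (mulOp V ψ) = ∫ x, V x * (star (rep φ x) * rep ψ x) := by
  rw [L2.inner_def]
  refine integral_congr_ae ?_
  filter_upwards [rep_ae φ, mulOp_ae V ψ] with x h1 h2
  rw [h1, h2, RCLike.inner_apply, starRingEnd_apply]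
  ring

lemma inner_der_mulOp (K : L2) (φ ψ : Sob) :
    inner ℂ (der φ) (mulOp K ψ) = ∫ x, K x * (star (der φ x) * rep ψ x) := by
  rw [L2.inner_def]
  refine integral_congr_ae ?_
  filter_upwards [mulOp_ae K ψ] with x h2
  rw [h2, RCLike.inner_apply, starRingEnd_apply]
  ring

lemma inner_mulOp_der (K : L2) (hK : ∀ᵐ x, star (K x) = K x) (φ ψ : Sob) :
    inner ℂ (mulOp K φ) (der ψ) = ∫ x, K x * (star (rep φ x) * der ψ x) := by
  rw [L2.inner_def]
  refine integral_congr_ae ?_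
  filter_upwards [mulOp_ae K φ, hK] with x h2 h3
  rw [h2, RCLike.inner_apply, map_mul, starRingEnd_apply, starRingEnd_apply, h3]
  ring

lemma integrable_mul_star_der (K : L2) (φ ψ : Sob) :
    Integrable fun x => K x * (star (der φ x) * rep ψ x) := by
  refine (L2.integrable_inner (𝕜 := ℂ) (der φ) (mulOp K ψ)).congr ?_
  filter_upwards [mulOp_ae K ψ] with x h2
  rw [h2, RCLike.inner_apply, starRingEnd_apply]
  ring

lemma integrable_mul_star_rep_der (K : L2) (hK : ∀ᵐ x, star (K x) = K x) (φ ψ : Sob) :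
    Integrable fun x => K x * (star (rep φ x) * der ψ x) := by
  refine (L2.integrable_inner (𝕜 := ℂ) (mulOp K φ) (der ψ)).congr ?_
  filter_upwards [mulOp_ae K φ, hK] with x h2 h3
  rw [h2, RCLike.inner_apply, map_mul, starRingEnd_apply, starRingEnd_apply, h3]
  ring

lemma integrable_mul_star_rep (V : L2) (φ ψ : Sob) :
    Integrable fun x => V x * (star (rep φ x) * rep ψ x) := by
  refine (L2.integrable_inner (𝕜 := ℂ) (incl φ) (mulOp V ψ)).congr ?_
  filter_upwards [rep_ae φ, mulOp_ae V ψ] with x h1 h2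
  rw [h1, h2, RCLike.inner_apply, starRingEnd_apply]
  ring

/-- The derivative of the product of the conjugate of `φ` with `ψ`. -/
noncomputable def dprod (φ ψ : Sob) (x : ℝ) : ℂ :=
  star (der φ x) * rep ψ x + star (rep φ x) * der ψ x

lemma derivProd_toH1 (φ ψ : Sob) : derivProd (toH1 φ) (toH1 ψ) = dprod φ ψ := by
  ext x
  rw [derivProd, weakDeriv_toH1, weakDeriv_toH1]
  rfl

lemma integrable_mul_dprod (K : L2) (hK : ∀ᵐ x, star (K x) = K x) (φ ψ : Sob) :
    Integrable fun x => K x * dprod φ ψ x :=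
  ((integrable_mul_star_der K φ ψ).add (integrable_mul_star_rep_der K hK φ ψ)).congr
    (ae_of_all _ fun x => by simp only [dprod, Pi.add_apply]; ring)

lemma inner_mulOp_eq_dprod (K : L2) (hK : ∀ᵐ x, star (K x) = K x) (φ ψ : Sob) :
    inner ℂ (der φ) (mulOp K ψ) + inner ℂ (mulOp K φ) (der ψ) = ∫ x, K x * dprod φ ψ x := by
  rw [inner_der_mulOp, inner_mulOp_der K hK, ← integral_add (integrable_mul_star_der K φ ψ)
    (integrable_mul_star_rep_der K hK φ ψ)]
  congr 1; ext x
  simp only [dprod]; ring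

lemma isSelfAdjoint_formOp (K : L2) {V : L2} (hV : ∀ᵐ x, star (V x) = V x)
    (α : ℝ) : IsSelfAdjoint (formOp K V α) := by
  rw [isSelfAdjoint_iff_isSymmetric]
  intro φ ψ
  have hVs : inner ℂ (mulOp V φ) (incl ψ) = inner ℂ (incl φ) (mulOp V ψ) := by
    rw [L2.inner_def, L2.inner_def]
    refine integral_congr_ae ?_
    filter_upwards [rep_ae φ, mulOp_ae V ψ, rep_ae ψ, mulOp_ae V φ, hV] with x h1 h2 h3 h4 h5
    rw [h1, h2, h3, h4, RCLike.inner_apply, RCLike.inner_apply, map_mul, starRingEnd_apply,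
      starRingEnd_apply, h5]
    ring
  change inner ℂ (formOp K V α φ) ψ = inner ℂ φ (formOp K V α ψ)
  rw [← inner_conj_symm, inner_formOp, inner_formOp, ← hVs]
  simp only [map_add, map_sub, map_mul, inner_conj_symm, Complex.conj_ofReal, map_div₀, map_one,
    map_ofNat]
  simp only [starRingEnd_apply, star_star]
  ring

lemma norm_mulOp_apply_le (K : L2) (u : Sob) {s : ℝ} (hs : ∀ x, ‖rep u x‖ ≤ s) :
    ‖mulOp K u‖ ≤ s * ‖K‖ := by
  refine Lp.norm_le_mul_norm_of_ae_le_mul ?_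
  filter_upwards [mulOp_ae K u] with x hx
  rw [hx, norm_mul, mul_comm]
  gcongr
  exact hs x

/-- The forms are bounded below, with a constant that depends explicitly on the strength `α` of the
point interaction. The kinetic energy dominates by the Sobolev bound on a window of length
`1 / (16 m)`. -/
lemma coercive_formOp (K V : L2) {α m : ℝ} (hm : 1 + 8 * ‖K‖ ^ 2 + ‖V‖ ^ 2 + |α| ≤ m) (ψ : Sob) :
    1 / 4 * ‖ψ‖ ^ 2 ≤ (inner ℂ ψ (formOp K V α ψ)).re + (2 + 32 * m ^ 2) * ‖incl ψ‖ ^ 2 := by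
  have hm1 : 1 ≤ m := by
    have : 0 ≤ 8 * ‖K‖ ^ 2 + ‖V‖ ^ 2 + |α| := by positivity
    linarith
  have hm0 : 0 < m := by linarith
  set a := ‖incl ψ‖
  set d := ‖der ψ‖
  set S : ℝ := 32 * m * a ^ 2 + 1 / (8 * m) * d ^ 2 with hS
  have hS0 : 0 ≤ S := by positivity
  have hrep : ∀ x, ‖rep ψ x‖ ^ 2 ≤ S := fun x => by
    refine (norm_sq_rep_le ψ x (l := 1 / (16 * m)) (by positivity)).trans_eq ?_
    rw [hS]; field_simp; ring
  have hrep' : ∀ x, ‖rep ψ x‖ ≤ √S := fun x => Real.le_sqrt_of_sq_le (hrep x)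
  have hK : ‖mulOp K ψ‖ ≤ √S * ‖K‖ := norm_mulOp_apply_le K ψ hrep'
  have hV : ‖mulOp V ψ‖ ≤ √S * ‖V‖ := norm_mulOp_apply_le V ψ hrep'
  have hSs := Real.sq_sqrt hS0
  have i1 : |(inner ℂ (der ψ) (mulOp K ψ)).re| ≤ d * (√S * ‖K‖) :=
    (Complex.abs_re_le_norm _).trans ((norm_inner_le_norm _ _).trans (by gcongr))
  have i2 : |(inner ℂ (mulOp K ψ) (der ψ)).re| ≤ d * (√S * ‖K‖) :=
    (Complex.abs_re_le_norm _).trans ((norm_inner_le_norm _ _).trans (by rw [mul_comm]; gcongr))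
  have i3 : |(inner ℂ (incl ψ) (mulOp V ψ)).re| ≤ a * (√S * ‖V‖) :=
    (Complex.abs_re_le_norm _).trans ((norm_inner_le_norm _ _).trans (by gcongr))
  have e : (inner ℂ ψ (formOp K V α ψ)).re = 1 / 2 * d ^ 2 -
      ((inner ℂ (der ψ) (mulOp K ψ)).re + (inner ℂ (mulOp K ψ) (der ψ)).re
        + (inner ℂ (incl ψ) (mulOp V ψ)).re) + α * ‖rep ψ 0‖ ^ 2 := by
    have h1 : star (rep ψ 0) * rep ψ 0 = ((‖rep ψ 0‖ ^ 2 : ℝ) : ℂ) := by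
      push_cast; exact Complex.conj_mul' _
    have h2 : (1 / 2 : ℂ) = ((1 / 2 : ℝ) : ℂ) := by norm_num
    rw [inner_formOp, h1, h2]
    simp only [Complex.add_re, Complex.sub_re, Complex.re_ofReal_mul, Complex.ofReal_re,
      re_inner_self]
    rfl
  have i4 : -(|α| * S) ≤ α * ‖rep ψ 0‖ ^ 2 := by
    have h1 : |α * ‖rep ψ 0‖ ^ 2| ≤ |α| * S := by
      rw [abs_mul, abs_of_nonneg (sq_nonneg ‖rep ψ 0‖)]
      have := hrep 0
      gcongr
    exact (abs_le.1 h1).1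
  have j1 : 2 * (d * (√S * ‖K‖)) ≤ 1 / 8 * d ^ 2 + 8 * ‖K‖ ^ 2 * S := by
    have : 8 * ‖K‖ ^ 2 * S = 8 * (√S * ‖K‖) ^ 2 := by rw [mul_pow, hSs]; ring
    rw [this]
    nlinarith [sq_nonneg (d - 8 * (√S * ‖K‖))]
  have j2 : a * (√S * ‖V‖) ≤ a ^ 2 + ‖V‖ ^ 2 * S := by
    have : ‖V‖ ^ 2 * S = (√S * ‖V‖) ^ 2 := by rw [mul_pow, hSs]; ring
    rw [this]
    nlinarith [sq_nonneg (a - (√S * ‖V‖)), sq_nonneg a, sq_nonneg (√S * ‖V‖)]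
  have j3 : (8 * ‖K‖ ^ 2 + ‖V‖ ^ 2 + |α|) * S ≤ m * S := by gcongr; linarith
  have j4 : m * S = 32 * m ^ 2 * a ^ 2 + 1 / 8 * d ^ 2 := by rw [hS]; field_simp
  have hn := norm_sq_sob ψ
  rw [e, hn]
  change 1 / 4 * (a ^ 2 + d ^ 2) ≤ _
  have k1 := abs_le.1 i1
  have k2 := abs_le.1 i2
  have k3 := abs_le.1 i3
  have : (8 * ‖K‖ ^ 2 + ‖V‖ ^ 2 + |α|) * S = 8 * ‖K‖ ^ 2 * S + ‖V‖ ^ 2 * S + |α| * S := by ring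
  nlinarith [sq_nonneg a, k1.2, k2.2, k3.2]

/-- The free part of the pencil at energy `E`. -/
noncomputable def freeOp (E : ℝ) : Sob →L[ℂ] Sob :=
  (1 / 2 : ℂ) • (adjoint der).comp der - (E : ℂ) • (adjoint incl).comp incl

/-- The interaction, which is compact relative to the kinetic energy. -/
noncomputable def potOp (K V : L2) (α : ℝ) : Sob →L[ℂ] Sob :=
  (adjoint der).comp (mulOp K) + (adjoint (mulOp K)).comp der + (adjoint incl).comp (mulOp V)
    - (α : ℂ) • (adjoint (evalAt 0)).comp (evalAt 0)

lemma pencil_formOp (K V : L2) (α E : ℝ) :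
    pencil incl (formOp K V α) E = freeOp E - potOp K V α := by
  rw [pencil, formOp, freeOp, potOp]; abel

lemma coercive_freeOp {E : ℝ} (ψ : Sob) :
    min (1 / 2) (-E) * ‖ψ‖ ^ 2 ≤ (inner ℂ ψ (freeOp E ψ)).re := by
  have e : (inner ℂ ψ (freeOp E ψ)).re = 1 / 2 * ‖der ψ‖ ^ 2 - E * ‖incl ψ‖ ^ 2 := by
    have h2 : (1 / 2 : ℂ) = ((1 / 2 : ℝ) : ℂ) := by norm_num
    rw [freeOp, h2]
    simp only [sub_apply, smul_apply, comp_apply, inner_sub_right, inner_smul_right,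
      adjoint_inner_right, Complex.sub_re, Complex.re_ofReal_mul, re_inner_self]
  rw [e, norm_sq_sob]
  have h1 := min_le_left (1 / 2) (-E)
  have h2 := min_le_right (1 / 2) (-E)
  nlinarith [sq_nonneg ‖der ψ‖, sq_nonneg ‖incl ψ‖]

lemma isCompact_potOp (K V : L2) (α : ℝ) : IsCompactOperator (potOp K V α) := by
  have h1 : IsCompactOperator ((adjoint der).comp (mulOp K)) := (isCompact_mulOp K).1.clm_comp (adjoint der)
  have h2 : IsCompactOperator ((adjoint (mulOp K)).comp der) := (isCompact_mulOp K).2.comp_clm _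
  have h3 : IsCompactOperator ((adjoint incl).comp (mulOp V)) := (isCompact_mulOp V).1.clm_comp (adjoint incl)
  have h4 : IsCompactOperator ((adjoint (evalAt 0)).comp (evalAt 0)) :=
    (isCompactOperator_of_locallyCompactSpace_rng (adjoint (evalAt 0))).comp_clm _
  exact ((h1.add h2).add h3).sub (h4.smul (α : ℂ))

section Compression

variable {H : Type*} [NormedAddCommGroup H] [InnerProductSpace ℂ H] [CompleteSpace H]

/-- The compression of `A` to a space embedded by `j`. -/
noncomputable def compress (j : H →L[ℂ] Sob) (A : Sob →L[ℂ] Sob) : H →L[ℂ] H :=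
  (adjoint j).comp (A.comp j)

lemma inner_compress (j : H →L[ℂ] Sob) (A : Sob →L[ℂ] Sob) (φ ψ : H) :
    inner ℂ φ (compress j A ψ) = inner ℂ (j φ) (A (j ψ)) :=
  adjoint_inner_right j φ (A (j ψ))

lemma pencil_compress (j : H →L[ℂ] Sob) (A : Sob →L[ℂ] Sob) (E : ℝ) :
    pencil (incl.comp j) (compress j A) E = compress j (pencil incl A E) := by
  ext1 ψ
  refine ext_inner_left ℂ fun φ => ?_
  rw [inner_compress, inner_pencil, inner_pencil, inner_compress]
  rfl

lemma isSelfAdjoint_compress (j : H →L[ℂ] Sob) {A : Sob →L[ℂ] Sob} (hA : IsSelfAdjoint A) :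
    IsSelfAdjoint (compress j A) := hA.adjoint_conj j

/-- At negative energies the pencils of the compressed forms are invertible unless they have a
kernel. -/
lemma isUnit_pencil_compress (j : H →L[ℂ] Sob) (hj : ∀ ψ, ‖j ψ‖ = ‖ψ‖) (K V : L2) (α : ℝ) {E : ℝ}
    (hE : E < 0) (hinj : ∀ ψ : H, (∀ φ : H, inner ℂ (j φ) (pencil incl (formOp K V α) E (j ψ)) = 0)
      → ψ = 0) :
    IsUnit (pencil (incl.comp j) (compress j (formOp K V α)) E) := by
  have e : pencil (incl.comp j) (compress j (formOp K V α)) E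
      = compress j (freeOp E) - compress j (potOp K V α) := by
    rw [pencil_compress, pencil_formOp]
    simp only [compress, sub_comp, comp_sub]
  rw [e]
  refine isUnit_sub_of_injective (isUnit_of_coercive (γ := min (1 / 2) (-E)) (by
    rw [lt_min_iff]; constructor <;> linarith) fun ψ => ?_) ?_ fun ψ hψ => hinj ψ fun φ => ?_
  · rw [inner_compress, ← hj]
    exact coercive_freeOp (j ψ)
  · exact ((isCompact_potOp K V α).comp_clm j).clm_comp (adjoint j)
  · rw [← inner_compress, ← pencil_compress, e, hψ, inner_zero_right]

lemma isUnit_pencil_formOp (K V : L2) (α : ℝ) {E : ℝ}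
    (hE : E < 0) (hinj : ∀ ψ, pencil incl (formOp K V α) E ψ = 0 → ψ = 0) :
    IsUnit (pencil incl (formOp K V α) E) := by
  have := isUnit_pencil_compress (ContinuousLinearMap.id ℂ Sob) (fun _ => rfl) K V α hE
    fun ψ hψ => hinj ψ (ext_inner_left ℂ fun φ => (hψ φ).trans (inner_zero_right _).symm)
  rw [pencil_compress] at this
  convert this using 1
  ext1 ψ
  refine ext_inner_left ℂ fun φ => ?_
  rw [inner_compress]; rfl

end Compression

end Nanotube

/-! ### Spectrum, eigenfunctions and parity -/

namespace Nanotube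

open ContinuousLinearMap

lemma mem_formOperator_graph {t : H1 → H1 →ₗ[ℂ] ℂ} {A : Sob →L[ℂ] Sob}
    (hA : ∀ φ ψ, t (toH1 φ) (toH1 ψ) = inner ℂ φ (A ψ)) (u : Sob) (f : L2) :
    (∃ h : incl u ∈ (formOperator t).domain, formOperator t ⟨incl u, h⟩ = f) ↔
      A u = adjoint incl f := by
  have h1 : (∃ h : incl u ∈ (formOperator t).domain, formOperator t ⟨incl u, h⟩ = f) ↔
      (incl u, f) ∈ (formOperator t).graph := by
    rw [LinearPMap.mem_graph_iff]
    constructor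
    · rintro ⟨h, h'⟩; exact ⟨⟨incl u, h⟩, rfl, h'⟩
    · rintro ⟨⟨y, hy⟩, h, h'⟩
      simp only at h
      subst h
      exact ⟨hy, h'⟩
  rw [h1, formOperator_graph, mem_formGraph_iff]
  constructor
  · rintro ⟨h, h'⟩
    refine ext_inner_left ℂ fun φ => ?_
    rw [← hA, adjoint_inner_right]
    exact h' (toH1 φ)
  · intro h
    refine ⟨(toH1 u).2, fun φ => ?_⟩
    obtain ⟨φ, rfl⟩ := toH1_surjective φ
    change t (toH1 φ) (toH1 u) = _
    rw [hA, h, adjoint_inner_right, coe_toH1]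

lemma exists_incl_of_mem_domain {t : H1 → H1 →ₗ[ℂ] ℂ} {ψ : L2}
    (h : ψ ∈ (formOperator t).domain) : ∃ u, incl u = ψ := by
  have h1 : (ψ, formOperator t ⟨ψ, h⟩) ∈ (formOperator t).graph :=
    LinearPMap.mem_graph _ ⟨ψ, h⟩
  rw [formOperator_graph, mem_formGraph_iff] at h1
  obtain ⟨h2, -⟩ := h1
  obtain ⟨u, hu⟩ := toH1_surjective ⟨ψ, h2⟩
  exact ⟨u, by rw [← coe_toH1, hu]⟩

lemma mem_eigenspace_iff {t : H1 → H1 →ₗ[ℂ] ℂ} {A : Sob →L[ℂ] Sob}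
    (hA : ∀ φ ψ, t (toH1 φ) (toH1 ψ) = inner ℂ φ (A ψ)) (E : ℝ) (f : L2) :
    f ∈ eigenspace (formOperator t) E ↔ ∃ u, incl u = f ∧ pencil incl A E u = 0 := by
  constructor
  · rintro ⟨h, h'⟩
    obtain ⟨u, rfl⟩ := exists_incl_of_mem_domain h
    refine ⟨u, rfl, ?_⟩
    rw [pencil_apply, (mem_formOperator_graph hA u _).1 ⟨h, h'⟩, map_smul, sub_self]
  · rintro ⟨u, rfl, hu⟩
    refine (mem_formOperator_graph hA u _).2 ?_
    rw [pencil_apply, sub_eq_zero] at hu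
    rw [hu, map_smul]

lemma notMem_realSpectrum {t : H1 → H1 →ₗ[ℂ] ℂ} {A : Sob →L[ℂ] Sob}
    (hA : ∀ φ ψ, t (toH1 φ) (toH1 ψ) = inner ℂ φ (A ψ)) {E : ℝ}
    (hu : IsUnit (pencil incl A E)) : E ∉ realSpectrum (formOperator t) := by
  intro hE
  apply hE
  refine ⟨resolventOp incl A E, fun f => ?_, fun ψ => ?_⟩
  · set u := Ring.inverse (pencil incl A E) (adjoint incl f)
    have h1 : pencil incl A E u = adjoint incl f := self_inverse_apply hu _
    obtain ⟨h, h'⟩ := (mem_formOperator_graph hA u (f + (E : ℂ) • incl u)).2 (by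
      rw [pencil_apply, sub_eq_iff_eq_add] at h1
      rw [h1, map_add, map_smul])
    exact ⟨h, by
      change formOperator t ⟨incl u, h⟩ - (E : ℂ) • incl u = f
      rw [h', add_sub_cancel_right]⟩
  · obtain ⟨ψ, hψ⟩ := ψ
    obtain ⟨u, rfl⟩ := exists_incl_of_mem_domain hψ
    have h1 := (mem_formOperator_graph hA u _).1 ⟨hψ, rfl⟩
    have h2 : adjoint incl (formOperator t ⟨incl u, hψ⟩ - (E : ℂ) • incl u)
        = pencil incl A E u := by
      rw [map_sub, map_smul, ← h1, pencil_apply]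
    change incl (Ring.inverse (pencil incl A E) (adjoint incl _)) = incl u
    rw [h2, inverse_apply_self hu]

lemma mem_realSpectrum {t : H1 → H1 →ₗ[ℂ] ℂ} {A : Sob →L[ℂ] Sob}
    (hA : ∀ φ ψ, t (toH1 φ) (toH1 ψ) = inner ℂ φ (A ψ)) {E : ℝ} {u : Sob} (hu : u ≠ 0)
    (h : pencil incl A E u = 0) : E ∈ realSpectrum (formOperator t) := by
  rintro ⟨R, -, hR⟩
  obtain ⟨hd, h'⟩ := (mem_eigenspace_iff hA E (incl u)).2 ⟨u, rfl, h⟩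
  have := hR ⟨incl u, hd⟩
  simp only [h', sub_self, map_zero] at this
  exact hu (incl_injective (by rw [← this, map_zero]))

/-- The reflection `ψ(x) ↦ ψ(-x)` in `L²(ℝ)`. -/
noncomputable def reflL2 : L2 →L[ℂ] L2 :=
  (Lp.compMeasurePreservingₗᵢ ℂ (fun x : ℝ => -x)
    (Measure.measurePreserving_neg volume)).toContinuousLinearMap

lemma reflL2_ae (f : L2) : (reflL2 f : ℝ → ℂ) =ᵐ[volume] fun x => f (-x) :=
  Lp.coeFn_compMeasurePreserving f (Measure.measurePreserving_neg volume)

lemma ae_neg {p : ℝ → Prop} (h : ∀ᵐ x, p x) : ∀ᵐ x, p (-x) :=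
  (Measure.measurePreserving_neg (volume : Measure ℝ)).quasiMeasurePreserving.ae h

lemma mem_paritySector_iff (s : ℤˣ) (f : L2) :
    f ∈ paritySector s ↔ reflL2 f = ((s : ℤ) : ℂ) • f := by
  change (∀ᵐ x : ℝ, f (-x) = ((s : ℤ) : ℂ) * f x) ↔ _
  rw [Lp.ext_iff]
  constructor
  · intro h
    filter_upwards [h, reflL2_ae f, Lp.coeFn_smul ((s : ℤ) : ℂ) f] with x h1 h2 h3
    rw [h2, h3, h1]; rfl
  · intro h
    filter_upwards [h, reflL2_ae f, Lp.coeFn_smul ((s : ℤ) : ℂ) f] with x h1 h2 h3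
    rw [← h2, h1, h3]; rfl

lemma isWeakDeriv_refl {f g : L2} (h : IsWeakDeriv f g) :
    IsWeakDeriv (reflL2 f) (-reflL2 g : L2) := by
  have h0 : IsWeakDeriv (fun x => f (-x)) (fun x => -g (-x)) := by
    intro φ hφ hs
    have h1 := h (fun x => φ (-x)) (hφ.comp contDiff_neg)
      (hs.comp_homeomorph (Homeomorph.neg ℝ))
    have h2 : deriv (fun x => φ (-x)) = fun x => -deriv φ (-x) := by
      ext x; exact deriv_comp_neg φ x
    rw [h2] at h1
    rw [← integral_neg_eq_self (fun x => deriv φ x • f (-x)),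
      ← integral_neg_eq_self (fun x => φ x • -g (-x))]
    simp only [neg_neg, neg_smul, smul_neg, integral_neg] at h1 ⊢
    exact neg_injective h1
  refine h0.congr (reflL2_ae f).symm ?_
  filter_upwards [reflL2_ae g, Lp.coeFn_neg (reflL2 g)] with x h1 h2
  rw [h2, Pi.neg_apply, h1]

/-- The reflection in `H¹(ℝ)`. -/
noncomputable def refl (u : Sob) : Sob :=
  Sob.mk (reflL2 (incl u)) (-reflL2 (der u)) (isWeakDeriv_refl (isWeakDeriv_der u))

@[simp] lemma incl_refl (u : Sob) : incl (refl u) = reflL2 (incl u) := rfl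
@[simp] lemma der_refl (u : Sob) : der (refl u) = -reflL2 (der u) := rfl

lemma rep_refl (u : Sob) (x : ℝ) : rep (refl u) x = rep u (-x) := by
  refine rep_eq_of_ae (f := fun x => rep u (-x)) (by fun_prop) ?_ x
  rw [incl_refl]
  filter_upwards [reflL2_ae (incl u), ae_neg (rep_ae u)] with x h1 h2
  rw [h1, h2]

lemma refl_refl (u : Sob) : refl (refl u) = u :=
  eq_of_rep_eq fun x => by rw [rep_refl, rep_refl, neg_neg]

lemma inner_reflL2 (f g : L2) : inner ℂ (reflL2 f) (reflL2 g) = inner ℂ f g :=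
  (Lp.compMeasurePreservingₗᵢ ℂ (fun x : ℝ => -x)
    (Measure.measurePreserving_neg volume)).inner_map_map f g

lemma inner_sob (u v : Sob) : inner ℂ u v = inner ℂ (incl u) (incl v) + inner ℂ (der u) (der v) :=
  WithLp.prod_inner_apply (Sob.toProd u) (Sob.toProd v)

lemma inner_refl_refl (u v : Sob) : inner ℂ (refl u) (refl v) = inner ℂ u v := by
  rw [inner_sob, inner_sob, incl_refl, incl_refl, der_refl, der_refl, inner_neg_neg, inner_reflL2,
    inner_reflL2]

lemma inner_refl_left (u v : Sob) : inner ℂ (refl u) v = inner ℂ u (refl v) := by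
  rw [← inner_refl_refl u (refl v), refl_refl]

/-- The functions of parity `s` in `H¹(ℝ)`. -/
noncomputable def paritySob (s : ℤˣ) : Submodule ℂ Sob := (paritySector s).comap (incl : Sob →ₗ[ℂ] L2)

lemma mem_paritySob_iff_incl {s : ℤˣ} {u : Sob} : u ∈ paritySob s ↔ incl u ∈ paritySector s := Iff.rfl

lemma refl_smul (c : ℂ) (u : Sob) : refl (c • u) = c • refl u :=
  eq_of_rep_eq fun x => by simp [rep_refl, rep_smul]

lemma refl_add (u v : Sob) : refl (u + v) = refl u + refl v :=
  eq_of_rep_eq fun x => by simp [rep_refl, rep_add]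

lemma mem_paritySob_iff {s : ℤˣ} {u : Sob} : u ∈ paritySob s ↔ refl u = ((s : ℤ) : ℂ) • u := by
  rw [mem_paritySob_iff_incl, mem_paritySector_iff]
  constructor
  · intro h
    exact incl_injective (by rw [incl_refl, h, map_smul])
  · intro h
    rw [← incl_refl, h, map_smul]

lemma mem_paritySob_iff_rep {s : ℤˣ} {u : Sob} :
    u ∈ paritySob s ↔ ∀ x, rep u (-x) = ((s : ℤ) : ℂ) * rep u x := by
  rw [mem_paritySob_iff]
  constructor
  · intro h x
    rw [← rep_refl, h, rep_smul]; rfl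
  · intro h
    refine eq_of_rep_eq fun x => ?_
    rw [rep_refl, h, rep_smul]; rfl

lemma isClosed_paritySob (s : ℤˣ) : IsClosed (paritySob s : Set Sob) := by
  have : (paritySob s : Set Sob) = {u | reflL2 (incl u) = ((s : ℤ) : ℂ) • incl u} := by
    ext u
    exact mem_paritySector_iff s (incl u)
  rw [this]
  exact isClosed_eq (reflL2.continuous.comp incl.continuous) (by fun_prop)

noncomputable instance (s : ℤˣ) : CompleteSpace (paritySob s) :=
  (isClosed_paritySob s).completeSpace_coe

lemma units_mul_self (s : ℤˣ) : ((s : ℤ) : ℂ) * ((s : ℤ) : ℂ) = 1 := by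
  rcases Int.units_eq_one_or s with rfl | rfl <;> simp

/-- `A` commutes with the reflection. -/
def CommRefl (A : Sob →L[ℂ] Sob) : Prop := ∀ u, A (refl u) = refl (A u)

lemma commRefl_of_inner {A : Sob →L[ℂ] Sob}
    (h : ∀ u v, inner ℂ (refl u) (A (refl v)) = inner ℂ u (A v)) : CommRefl A := by
  intro v
  refine ext_inner_left ℂ fun u => ?_
  have := h (refl u) v
  rw [refl_refl] at this
  rw [this, inner_refl_left]

lemma commRefl_pencil {A : Sob →L[ℂ] Sob} (hA : CommRefl A) (E : ℝ) :
    CommRefl (pencil incl A E) := by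
  refine commRefl_of_inner fun u v => ?_
  rw [inner_pencil, inner_pencil, hA, inner_refl_refl, incl_refl, incl_refl, inner_reflL2]

/-- In a parity sector it suffices to test the eigenvalue equation on the sector. -/
lemma pencil_eq_zero_of_sector {P : Sob →L[ℂ] Sob} (hP : CommRefl P) {s : ℤˣ} {u : Sob}
    (hu : u ∈ paritySob s) (h : ∀ φ ∈ paritySob s, inner ℂ φ (P u) = 0) : P u = 0 := by
  have h1 : P u ∈ paritySob s := by
    rw [mem_paritySob_iff, ← hP, mem_paritySob_iff.1 hu, map_smul]
  exact inner_self_eq_zero.1 (h _ h1)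

lemma isParityEigenvalue_iff {t : H1 → H1 →ₗ[ℂ] ℂ} {A : Sob →L[ℂ] Sob}
    (hA : ∀ φ ψ, t (toH1 φ) (toH1 ψ) = inner ℂ φ (A ψ)) (s : ℤˣ) (E : ℝ) :
    IsParityEigenvalue (formOperator t) s E ↔
      ∃ u ∈ paritySob s, u ≠ 0 ∧ pencil incl A E u = 0 := by
  rw [IsParityEigenvalue, Submodule.ne_bot_iff]
  constructor
  · rintro ⟨f, ⟨hf, hs⟩, h0⟩
    obtain ⟨u, rfl, hu⟩ := (mem_eigenspace_iff hA E f).1 hf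
    exact ⟨u, hs, fun h => h0 (by rw [h, map_zero]), hu⟩
  · rintro ⟨u, hs, h0, hu⟩
    exact ⟨incl u, ⟨(mem_eigenspace_iff hA E _).2 ⟨u, rfl, hu⟩, hs⟩,
      fun h => h0 (incl_injective (by rw [h, map_zero]))⟩

/-- The even part (`s = 1`) or the odd part (`s = -1`) of a function. -/
noncomputable def parityPart (s : ℤˣ) (u : Sob) : Sob := u + ((s : ℤ) : ℂ) • refl u

lemma parityPart_mem (s : ℤˣ) (u : Sob) : parityPart s u ∈ paritySob s := by
  rw [mem_paritySob_iff, parityPart, refl_add, refl_smul, refl_refl, smul_add, smul_smul,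
    units_mul_self, one_smul, add_comm]

/-- Below zero the spectrum consists of eigenvalues, and each has an eigenfunction of definite
parity. -/
lemma exists_parity_of_mem_realSpectrum {t : H1 → H1 →ₗ[ℂ] ℂ} {K V : L2} {α : ℝ}
    (hA : ∀ φ ψ, t (toH1 φ) (toH1 ψ) = inner ℂ φ (formOp K V α ψ))
    (hR : CommRefl (formOp K V α)) {E : ℝ} (hE : E < 0)
    (h : E ∈ realSpectrum (formOperator t)) :
    ∃ s : ℤˣ, IsParityEigenvalue (formOperator t) s E := by
  obtain ⟨u, hu, h0⟩ : ∃ u, pencil incl (formOp K V α) E u = 0 ∧ u ≠ 0 := by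
    by_contra! hc
    exact notMem_realSpectrum hA (isUnit_pencil_formOp K V α hE fun ψ hψ => hc ψ hψ) h
  have hR' := commRefl_pencil hR E
  have hz : ∀ s, pencil incl (formOp K V α) E (parityPart s u) = 0 := by
    intro s
    have : refl 0 = 0 := by
      have := refl_smul 0 0
      simpa using this
    rw [parityPart, map_add, map_smul, hR', hu, this, smul_zero, add_zero]
  by_cases h1 : parityPart 1 u = 0
  · refine ⟨-1, (isParityEigenvalue_iff hA _ _).2 ⟨_, parityPart_mem _ _, fun h2 => h0 ?_, hz _⟩⟩
    have h3 : (2 : ℂ) • u = parityPart 1 u + parityPart (-1) u := by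
      simp only [parityPart, Units.val_one, Units.val_neg]; push_cast; rw [two_smul, neg_smul]; abel
    rw [h1, h2, add_zero] at h3
    exact (smul_eq_zero.1 h3).resolve_left two_ne_zero
  · exact ⟨1, (isParityEigenvalue_iff hA _ _).2 ⟨_, parityPart_mem _ _, h1, hz _⟩⟩

lemma mem_realSpectrum_of_parity {t : H1 → H1 →ₗ[ℂ] ℂ} {A : Sob →L[ℂ] Sob}
    (hA : ∀ φ ψ, t (toH1 φ) (toH1 ψ) = inner ℂ φ (A ψ)) {s : ℤˣ} {E : ℝ}
    (h : IsParityEigenvalue (formOperator t) s E) : E ∈ realSpectrum (formOperator t) := by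
  obtain ⟨u, -, h0, hu⟩ := (isParityEigenvalue_iff hA s E).1 h
  exact mem_realSpectrum hA h0 hu

/-- In a sector the pencil is invertible at negative energies which are not eigenvalues. -/
lemma isUnit_pencil_sector {K V : L2} {α : ℝ} (hR : CommRefl (formOp K V α)) (s : ℤˣ) {E : ℝ}
    (hE : E < 0) (h : ∀ u ∈ paritySob s, pencil incl (formOp K V α) E u = 0 → u = 0) :
    IsUnit (pencil (incl.comp (paritySob s).subtypeL)
      (compress (paritySob s).subtypeL (formOp K V α)) E) := by
  refine isUnit_pencil_compress (paritySob s).subtypeL (fun _ => rfl) K V α hE fun ψ hψ => ?_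
  have := h ψ ψ.2 (pencil_eq_zero_of_sector (commRefl_pencil hR E) ψ.2 fun φ hφ => hψ ⟨φ, hφ⟩)
  exact Subtype.ext this

lemma commRefl_formOp {K V : L2} {α : ℝ} (hK : ∀ᵐ x, K (-x) = -K x) (hV : ∀ᵐ x, V (-x) = V x) :
    CommRefl (formOp K V α) := by
  have h1 : ∀ u, mulOp K (refl u) = -reflL2 (mulOp K u) := by
    intro u
    apply Lp.ext
    filter_upwards [mulOp_ae K (refl u), Lp.coeFn_neg (reflL2 (mulOp K u)), reflL2_ae (mulOp K u),
      ae_neg (mulOp_ae K u), hK] with x h1 h2 h3 h4 h5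
    rw [h1, h2, Pi.neg_apply, h3, h4, h5, rep_refl]; ring
  have h2 : ∀ u, mulOp V (refl u) = reflL2 (mulOp V u) := by
    intro u
    apply Lp.ext
    filter_upwards [mulOp_ae V (refl u), reflL2_ae (mulOp V u),
      ae_neg (mulOp_ae V u), hV] with x h1 h3 h4 h5
    rw [h1, h3, h4, h5, rep_refl]
  refine commRefl_of_inner fun u v => ?_
  rw [inner_formOp, inner_formOp, h1, h1, h2, der_refl, der_refl, incl_refl, inner_neg_neg,
    inner_neg_neg, inner_neg_neg, inner_reflL2, inner_reflL2, inner_reflL2, inner_reflL2, rep_refl,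
    rep_refl, neg_zero]

end Nanotube

/-! ### Estimates on the effective potential -/

namespace Nanotube

lemma sin_ge_half {θ : ℝ} (h : θ ∈ Ioc 0 (Real.pi / 2)) : θ / 2 ≤ Real.sin θ := by
  have h1 := Real.mul_le_sin h.1.le h.2
  refine le_trans ?_ h1
  have := Real.pi_le_four
  rw [div_eq_inv_mul]
  gcongr
  · exact h.1.le
  · rw [inv_eq_one_div, div_le_div_iff₀ (by norm_num) Real.pi_pos]; linarith

/-- The potential in terms of the angle `θ` on the circle; `2 r sin θ` is the length of the chord. -/
lemma Veff_eq_angle {r : ℝ} (hr : 0 < r) (x : ℝ) : Veff r x =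
    2 / Real.pi * ∫ θ in (0 : ℝ)..Real.pi / 2, 1 / √(x ^ 2 + (2 * r * Real.sin θ) ^ 2) := by
  have hp := Real.pi_pos
  set f : ℝ → ℝ := fun θ => 1 / √(x ^ 2 + (2 * r * Real.sin θ) ^ 2) with hf
  have hfe : ∀ θ, f (-θ) = f θ := fun θ => by simp [hf]
  have h1 : ∫ y in (-(Real.pi * r))..(Real.pi * r),
      1 / √(x ^ 2 + 4 * r ^ 2 * Real.sin (y / (2 * r)) ^ 2)
      = 2 * r * ∫ θ in (-(Real.pi / 2))..Real.pi / 2, f θ := by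
    have := intervalIntegral.integral_comp_div (a := -(Real.pi * r)) (b := Real.pi * r) f
      (c := 2 * r) (by positivity)
    have e1 : -(Real.pi * r) / (2 * r) = -(Real.pi / 2) := by field_simp
    have e2 : Real.pi * r / (2 * r) = Real.pi / 2 := by field_simp
    rw [e1, e2, smul_eq_mul] at this
    rw [← this]
    congr 1; ext y
    simp only [hf]
    rw [mul_pow, mul_pow]; norm_num
  by_cases hx : x = 0
  · -- if the integrand is not integrable at `x = 0`, both integrals have the junk value zero
    by_cases hi : IntervalIntegrable f volume 0 (Real.pi / 2)
    · have h2 : ∫ θ in (-(Real.pi / 2))..Real.pi / 2, f θ = 2 * ∫ θ in (0 : ℝ)..Real.pi / 2, f θ := by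
        have hi' : IntervalIntegrable f volume (-(Real.pi / 2)) 0 := by
          rw [IntervalIntegrable.iff_comp_neg]
          simpa [hfe] using hi.symm
        rw [← intervalIntegral.integral_add_adjacent_intervals hi' hi, two_mul]
        congr 1
        have := intervalIntegral.integral_comp_neg (a := 0) (b := Real.pi / 2) f
        simp only [hfe, neg_zero] at this
        exact this.symm
      rw [Veff, h1, h2]; field_simp
    · have hi' : ¬ IntervalIntegrable f volume (-(Real.pi / 2)) (Real.pi / 2) := fun h =>
        hi (h.mono_set (by
          rw [uIcc_of_le (by linarith), uIcc_of_le (by linarith)]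
          exact Icc_subset_Icc_left (by linarith)))
      rw [Veff, h1, intervalIntegral.integral_undef hi, intervalIntegral.integral_undef hi']
      simp
  · have hc : Continuous f := by
      refine continuous_const.div (by fun_prop) fun y => ?_
      have : 0 < x ^ 2 := by positivity
      positivity
    have h2 : ∫ θ in (-(Real.pi / 2))..Real.pi / 2, f θ = 2 * ∫ θ in (0 : ℝ)..Real.pi / 2, f θ := by
      rw [← intervalIntegral.integral_add_adjacent_intervals (hc.intervalIntegrable _ 0)
        (hc.intervalIntegrable _ _), two_mul]
      congr 1
      have := intervalIntegral.integral_comp_neg (a := 0) (b := Real.pi / 2) f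
      simp only [hfe, neg_zero] at this
      exact this.symm
    rw [Veff, h1, h2]; field_simp

lemma kernel_le {r x θ : ℝ} (hr : 0 < r) (hx : x ≠ 0) (hθ : θ ∈ Ioc 0 (Real.pi / 2)) :
    1 / √(x ^ 2 + (2 * r * Real.sin θ) ^ 2)
      ≤ |x| ^ (-(1 / 4) : ℝ) * (r * θ) ^ (-(3 / 4) : ℝ) := by
  have hx' : 0 < |x| := abs_pos.2 hx
  have hrθ : 0 < r * θ := mul_pos hr hθ.1
  have h1 : r * θ ≤ 2 * r * Real.sin θ := by nlinarith [sin_ge_half hθ]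
  set q := √(x ^ 2 + (2 * r * Real.sin θ) ^ 2) with hq
  have h2 : |x| ≤ q := Real.le_sqrt_of_sq_le (by rw [sq_abs]; nlinarith [sq_nonneg (2 * r * Real.sin θ)])
  have h3 : r * θ ≤ q := h1.trans (Real.le_sqrt_of_sq_le (by nlinarith [sq_nonneg x]))
  have h4 : |x| ^ (1 / 4 : ℝ) * (r * θ) ^ (3 / 4 : ℝ) ≤ q := by
    calc |x| ^ (1 / 4 : ℝ) * (r * θ) ^ (3 / 4 : ℝ) ≤ q ^ (1 / 4 : ℝ) * q ^ (3 / 4 : ℝ) := by gcongr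
      _ = q := by
        rw [← Real.rpow_add (lt_of_lt_of_le hx' h2)]; norm_num
  rw [Real.rpow_neg hx'.le, Real.rpow_neg hrθ.le, ← mul_inv, ← one_div]
  gcongr

lemma integrable_angle_rpow {r : ℝ} (hr : 0 < r) :
    IntegrableOn (fun θ : ℝ => (r * θ) ^ (-(3 / 4) : ℝ)) (Ioc 0 (Real.pi / 2)) := by
  have h := (intervalIntegral.intervalIntegrable_rpow' (a := 0) (b := Real.pi / 2)
    (r := -(3 / 4)) (by norm_num)).const_mul (r ^ (-(3 / 4) : ℝ))
  rw [intervalIntegrable_iff_integrableOn_Ioc_of_le (by positivity)] at h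
  refine h.congr_fun (fun θ hθ => ?_) measurableSet_Ioc
  exact (Real.mul_rpow hr.le hθ.1.le).symm

lemma Veff_le_rpow_quarter {r : ℝ} (hr : 0 < r) : ∃ C : ℝ, 0 ≤ C ∧ ∀ x : ℝ, x ≠ 0 →
    Veff r x ≤ C * |x| ^ (-(1 / 4) : ℝ) := by
  have hp := Real.pi_pos
  refine ⟨2 / Real.pi * ∫ θ in Ioc 0 (Real.pi / 2), (r * θ) ^ (-(3 / 4) : ℝ), ?_, fun x hx => ?_⟩
  · refine mul_nonneg (by positivity) (setIntegral_nonneg measurableSet_Ioc fun θ hθ => ?_)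
    have := hθ.1
    positivity
  · rw [Veff_eq_angle hr, intervalIntegral.integral_of_le (by positivity), mul_assoc,
      ← integral_mul_const]
    refine mul_le_mul_of_nonneg_left (setIntegral_mono_on ?_ ((integrable_angle_rpow hr).mul_const _)
      measurableSet_Ioc fun θ hθ => ?_) (by positivity)
    · have hc : Continuous fun θ : ℝ => 1 / √(x ^ 2 + (2 * r * Real.sin θ) ^ 2) := by
        refine continuous_const.div (by fun_prop) fun y => ?_
        have : 0 < x ^ 2 := by positivity
        positivity
      exact (hc.integrableOn_Icc (a := 0) (b := Real.pi / 2)).mono_set Ioc_subset_Icc_self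
    · exact (kernel_le hr hx hθ).trans_eq (mul_comm _ _)

lemma Veff_neg (r x : ℝ) : Veff r (-x) = Veff r x := by simp [Veff]

lemma ae_ne_zero : ∀ᵐ x : ℝ, x ≠ 0 := measure_eq_zero_iff_ae_notMem.1 (measure_singleton (0 : ℝ))

lemma memLp_Veff {r : ℝ} (hr : 0 < r) : MemLp (fun x => (Veff r x : ℂ)) 2 volume := by
  have hm : AEStronglyMeasurable (fun x => (Veff r x : ℂ)) volume :=
    (Complex.measurable_ofReal.comp (measurable_Veff hr)).aestronglyMeasurable
  rw [memLp_two_iff_integrable_sq_norm hm]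
  obtain ⟨C, hC, hCb⟩ := Veff_le_rpow_quarter hr
  have hi : IntegrableOn (fun x : ℝ => |x| ^ (-(1 / 2) : ℝ)) (Ioc (-1) 1) := by
    have := intervalIntegrable_abs_rpow (-1) 1
    rwa [intervalIntegrable_iff_integrableOn_Ioc_of_le (by norm_num)] at this
  have hg : Integrable fun x : ℝ => C ^ 2 * (Ioc (-1 : ℝ) 1).indicator
      (fun x => |x| ^ (-(1 / 2) : ℝ)) x + 2 * (1 + x ^ 2)⁻¹ :=
    ((hi.integrable_indicator measurableSet_Ioc).const_mul _).add
      (integrable_inv_one_add_sq.const_mul 2)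
  refine Integrable.mono' hg (hm.norm.pow 2) ?_
  filter_upwards [ae_ne_zero] with x hx
  rw [norm_pow, norm_norm, Complex.norm_real, Real.norm_eq_abs, abs_of_nonneg (Veff_nonneg hr x)]
  have hx' : 0 < |x| := abs_pos.2 hx
  have hV := Veff_nonneg hr x
  by_cases h : x ∈ Ioc (-1 : ℝ) 1
  · rw [indicator_of_mem h]
    have : Veff r x ^ 2 ≤ C ^ 2 * |x| ^ (-(1 / 2) : ℝ) := by
      calc Veff r x ^ 2 ≤ (C * |x| ^ (-(1 / 4) : ℝ)) ^ 2 := by gcongr; exact hCb x hx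
        _ = C ^ 2 * |x| ^ (-(1 / 2) : ℝ) := by
          rw [mul_pow, ← Real.rpow_natCast (|x| ^ _), ← Real.rpow_mul hx'.le]; norm_num
    have : 0 ≤ 2 * (1 + x ^ 2)⁻¹ := by positivity
    linarith
  · rw [indicator_of_notMem h, mul_zero, zero_add]
    have h1 : 1 ≤ |x| := by
      by_contra hc
      rw [not_le, abs_lt] at hc
      exact h ⟨hc.1, hc.2.le⟩
    have h2 : 1 ≤ x ^ 2 := by rw [← sq_abs]; nlinarith
    calc Veff r x ^ 2 ≤ (1 / |x|) ^ 2 := by gcongr; exact Veff_le_inv hr hx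
      _ = (x ^ 2)⁻¹ := by rw [div_pow, sq_abs, one_pow, one_div]
      _ ≤ 2 * (1 + x ^ 2)⁻¹ := by
        rw [← div_eq_mul_inv, inv_eq_one_div, div_le_div_iff₀ (by positivity) (by positivity)]
        linarith

/-- Lower bound of the potential by that of the diametrically opposite charge. -/
lemma le_Veff {r x : ℝ} (hr : 0 < r) (hx : x ≠ 0) : 1 / √(x ^ 2 + 4 * r ^ 2) ≤ Veff r x := by
  have hp := Real.pi_pos
  have hx2 : 0 < x ^ 2 := by positivity
  have h1 : ∫ θ in (0 : ℝ)..Real.pi / 2, 1 / √(x ^ 2 + 4 * r ^ 2)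
      ≤ ∫ θ in (0 : ℝ)..Real.pi / 2, 1 / √(x ^ 2 + (2 * r * Real.sin θ) ^ 2) := by
    refine intervalIntegral.integral_mono_on (by positivity) (by simp) ?_ fun θ _ => ?_
    · refine Continuous.intervalIntegrable ?_ _ _
      refine continuous_const.div (by fun_prop) fun y => ?_
      positivity
    · gcongr
      have : Real.sin θ ^ 2 ≤ 1 := Real.sin_sq_le_one θ
      have h4 : 0 ≤ 4 * r ^ 2 := by positivity
      nlinarith
  rw [intervalIntegral.integral_const, smul_eq_mul, sub_zero] at h1
  rw [Veff_eq_angle hr]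
  calc 1 / √(x ^ 2 + 4 * r ^ 2) = 2 / Real.pi * (Real.pi / 2 * (1 / √(x ^ 2 + 4 * r ^ 2))) := by
        field_simp
    _ ≤ _ := by gcongr

lemma inv_sub_Veff_le {r x : ℝ} (hr : 0 < r) (hx : 1 / 2 < |x|) :
    1 / |x| - Veff r x ≤ 16 * r ^ 2 := by
  have hx0 : x ≠ 0 := by rintro rfl; norm_num at hx
  have hxp : 0 < |x| := by linarith
  have h1 := le_Veff hr hx0
  have h2 : √(x ^ 2 + 4 * r ^ 2) ≤ |x| + 2 * r ^ 2 / |x| := by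
    refine Real.sqrt_le_iff.2 ⟨by positivity, ?_⟩
    rw [← sq_abs]
    have : (|x| + 2 * r ^ 2 / |x|) ^ 2 = |x| ^ 2 + 4 * r ^ 2 + (2 * r ^ 2 / |x|) ^ 2 := by
      field_simp; ring
    rw [this]
    nlinarith [sq_nonneg (2 * r ^ 2 / |x|)]
  have h3 : 1 / (|x| + 2 * r ^ 2 / |x|) ≤ 1 / √(x ^ 2 + 4 * r ^ 2) := by
    gcongr
  have h4 : 1 / |x| - 1 / (|x| + 2 * r ^ 2 / |x|) ≤ 2 * r ^ 2 / |x| ^ 3 := by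
    have : 1 / |x| - 1 / (|x| + 2 * r ^ 2 / |x|)
        = 2 * r ^ 2 / (|x| * (|x| ^ 2 + 2 * r ^ 2)) := by field_simp; ring
    rw [this]
    gcongr
    nlinarith [sq_nonneg r]
  have h5 : 2 * r ^ 2 / |x| ^ 3 ≤ 2 * r ^ 2 / (1 / 2) ^ 3 := by gcongr
  have h6 : 2 * r ^ 2 / (1 / 2 : ℝ) ^ 3 = 16 * r ^ 2 := by ring
  linarith

lemma integral_inv_sqrt {ρ x : ℝ} (hρ : 0 < ρ) :
    ∫ t in (0 : ℝ)..x, 1 / √(t ^ 2 + ρ ^ 2) = Real.arsinh (x / ρ) := by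
  have hd : ∀ t, HasDerivAt (fun t => Real.arsinh (t / ρ)) (1 / √(t ^ 2 + ρ ^ 2)) t := by
    intro t
    have := (Real.hasDerivAt_arsinh (t / ρ)).comp t ((hasDerivAt_id t).div_const ρ)
    refine this.congr_deriv ?_
    have h1 : t ^ 2 + ρ ^ 2 = ρ ^ 2 * (1 + (t / ρ) ^ 2) := by field_simp; ring
    rw [h1, Real.sqrt_mul (by positivity), Real.sqrt_sq hρ.le]
    field_simp
  rw [intervalIntegral.integral_eq_sub_of_hasDerivAt (fun t _ => hd t)]
  · simp
  · refine Continuous.intervalIntegrable ?_ _ _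
    refine continuous_const.div (by fun_prop) fun y => ?_
    positivity

lemma log_one_add_le {t : ℝ} (ht : 0 ≤ t) : Real.log (1 + t) ≤ 4 * t ^ (1 / 4 : ℝ) := by
  set s := t ^ (1 / 4 : ℝ) with hs
  have hs0 : 0 ≤ s := by positivity
  have h4 : s ^ 4 = t := by rw [hs, ← Real.rpow_natCast, ← Real.rpow_mul ht]; norm_num
  have h1 : 1 + t ≤ (1 + s) ^ 4 := by rw [← h4]; nlinarith [pow_nonneg hs0 3, pow_nonneg hs0 2]
  calc Real.log (1 + t) ≤ Real.log ((1 + s) ^ 4) := Real.log_le_log (by linarith) h1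
    _ = 4 * Real.log (1 + s) := by rw [Real.log_pow]; norm_num
    _ ≤ 4 * s := by have := Real.log_le_sub_one_of_pos (by linarith : 0 < 1 + s); linarith

lemma arsinh_sub_log {z : ℝ} (hz : 0 < z) : 0 ≤ Real.arsinh z - Real.log (2 * z) ∧
    Real.arsinh z - Real.log (2 * z) ≤ 4 * (1 / (2 * z)) ^ (1 / 4 : ℝ) := by
  have h1 : z ≤ √(1 + z ^ 2) := Real.le_sqrt_of_sq_le (by linarith)
  have h2 : √(1 + z ^ 2) ≤ 1 + z := Real.sqrt_le_iff.2 ⟨by linarith, by nlinarith⟩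
  rw [Real.arsinh]
  constructor
  · rw [sub_nonneg]
    exact Real.log_le_log (by linarith) (by linarith)
  · rw [← Real.log_div (by positivity) (by positivity)]
    refine le_trans (Real.log_le_log (by positivity) ?_) (log_one_add_le (by positivity))
    rw [div_le_iff₀ (by positivity)]
    field_simp
    linarith

/-- The difference between the primitive of the potential, shifted by `log r`, and the primitive
`log (2 x)` of the Coulomb potential. -/
noncomputable def gap (r x : ℝ) : ℝ :=
  (∫ t in (0 : ℝ)..x, Veff r t) + Real.log r - Real.log (2 * x)

lemma intervalIntegrable_Veff {r : ℝ} (hr : 0 < r) (a b : ℝ) :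
    IntervalIntegrable (Veff r) volume a b := by
  have h := (memLp_Veff hr).locallyIntegrable one_le_two
  have := ((h.integrableOn_isCompact (isCompact_uIcc (a := a) (b := b))).intervalIntegrable).norm
  refine this.congr fun x _ => ?_
  simp only [Complex.norm_real, Real.norm_eq_abs]
  exact abs_of_nonneg (Veff_nonneg hr x)

lemma integral_Veff_eq {r x : ℝ} (hr : 0 < r) (hx : 0 < x) : ∫ t in (0 : ℝ)..x, Veff r t =
    2 / Real.pi * ∫ θ in Ioc 0 (Real.pi / 2), Real.arsinh (x / (2 * r * Real.sin θ)) := by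
  have hp := Real.pi_pos
  have hi : Integrable (Function.uncurry fun t θ : ℝ => 1 / √(t ^ 2 + (2 * r * Real.sin θ) ^ 2))
      ((volume.restrict (Ioc 0 x)).prod (volume.restrict (Ioc 0 (Real.pi / 2)))) := by
    have h1 : IntegrableOn (fun t : ℝ => t ^ (-(1 / 4) : ℝ)) (Ioc 0 x) := by
      have := intervalIntegral.intervalIntegrable_rpow' (a := 0) (b := x) (r := -(1 / 4))
        (by norm_num)
      rwa [intervalIntegrable_iff_integrableOn_Ioc_of_le hx.le] at this
    refine Integrable.mono' (h1.mul_prod (integrable_angle_rpow hr)) ?_ ?_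
    · apply Measurable.aestronglyMeasurable
      unfold Function.uncurry
      fun_prop
    · rw [Measure.prod_restrict]
      filter_upwards [ae_restrict_mem (measurableSet_Ioc.prod measurableSet_Ioc)] with p hp
      rw [Real.norm_eq_abs, abs_of_nonneg (by simp only [Function.uncurry]; positivity)]
      have := kernel_le hr hp.1.1.ne' hp.2
      rwa [abs_of_pos hp.1.1] at this
  rw [intervalIntegral.integral_of_le hx.le]
  simp only [Veff_eq_angle hr, intervalIntegral.integral_of_le (by positivity : 0 ≤ Real.pi / 2)]
  rw [integral_const_mul, integral_integral_swap hi]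
  congr 1
  refine setIntegral_congr_fun measurableSet_Ioc fun θ hθ => ?_
  have hs : 0 < Real.sin θ := lt_of_lt_of_le (by have := hθ.1; positivity) (sin_ge_half hθ)
  rw [← intervalIntegral.integral_of_le hx.le, integral_inv_sqrt (by positivity)]

/-- The primitive of the potential is close to that of the regularised Coulomb potential. This rests
on the mean value `∫ log (sin θ) = -log 2` of the logarithmic potential of the circle. -/
lemma gap_bounds {r x : ℝ} (hr : 0 < r) (hx : 0 < x) :
    0 ≤ gap r x ∧ gap r x ≤ 4 * (r / x) ^ (1 / 4 : ℝ) := by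
  have hp := Real.pi_pos
  have hls : IntegrableOn (fun θ => Real.log (Real.sin θ)) (Ioc 0 (Real.pi / 2)) := by
    have := intervalIntegrable_log_sin (a := 0) (b := Real.pi / 2)
    rwa [intervalIntegrable_iff_integrableOn_Ioc_of_le (by positivity)] at this
  have hlsi : ∫ θ in Ioc 0 (Real.pi / 2), Real.log (Real.sin θ) = -Real.log 2 * Real.pi / 2 := by
    rw [← intervalIntegral.integral_of_le (by positivity)]
    exact integral_log_sin_zero_pi_div_two
  set d : ℝ → ℝ := fun θ => Real.arsinh (x / (2 * r * Real.sin θ))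
    - Real.log (2 * (x / (2 * r * Real.sin θ))) with hd
  have hsin : ∀ θ ∈ Ioc 0 (Real.pi / 2), 0 < Real.sin θ := fun θ hθ =>
    lt_of_lt_of_le (by have := hθ.1; positivity) (sin_ge_half hθ)
  have hdb : ∀ θ ∈ Ioc 0 (Real.pi / 2), 0 ≤ d θ ∧ d θ ≤ 4 * (r / x) ^ (1 / 4 : ℝ) := by
    intro θ hθ
    have hs := hsin θ hθ
    obtain ⟨h1, h2⟩ := arsinh_sub_log (z := x / (2 * r * Real.sin θ)) (by positivity)
    refine ⟨h1, h2.trans ?_⟩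
    have : 1 / (2 * (x / (2 * r * Real.sin θ))) ≤ r / x := by
      have e : 1 / (2 * (x / (2 * r * Real.sin θ))) = r * Real.sin θ / x := by field_simp
      rw [e]
      have := Real.sin_le_one θ
      gcongr
      nlinarith
    gcongr
  have hfin : volume (Ioc 0 (Real.pi / 2)) ≠ ⊤ := measure_Ioc_lt_top.ne
  have hdi : IntegrableOn d (Ioc 0 (Real.pi / 2)) := by
    refine Measure.integrableOn_of_bounded (M := 4 * (r / x) ^ (1 / 4 : ℝ)) hfin ?_ ?_
    · apply Measurable.aestronglyMeasurable
      have : Measurable Real.arsinh := Real.continuous_arsinh.measurable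
      fun_prop
    · filter_upwards [ae_restrict_mem measurableSet_Ioc] with θ hθ
      rw [Real.norm_eq_abs, abs_of_nonneg (hdb θ hθ).1]
      exact (hdb θ hθ).2
  have hci : IntegrableOn (fun _ : ℝ => Real.log (x / r)) (Ioc 0 (Real.pi / 2)) :=
    integrableOn_const hfin
  have hcl : IntegrableOn (fun θ => Real.log (x / r) - Real.log (Real.sin θ))
      (Ioc 0 (Real.pi / 2)) := hci.sub hls
  have hgap : gap r x = 2 / Real.pi * ∫ θ in Ioc 0 (Real.pi / 2), d θ := by
    have h1 : ∫ θ in Ioc 0 (Real.pi / 2), Real.arsinh (x / (2 * r * Real.sin θ))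
        = ∫ θ in Ioc 0 (Real.pi / 2), (d θ + (Real.log (x / r) - Real.log (Real.sin θ))) := by
      refine setIntegral_congr_fun measurableSet_Ioc fun θ hθ => ?_
      have hs := hsin θ hθ
      have e : 2 * (x / (2 * r * Real.sin θ)) = x / r / Real.sin θ := by field_simp
      simp only [hd]
      rw [e, Real.log_div (by positivity) hs.ne']
      ring
    rw [gap, integral_Veff_eq hr hx, h1, integral_add hdi hcl, integral_sub hci hls, hlsi,
      setIntegral_const, Real.volume_real_Ioc_of_le (by positivity), Real.log_div hx.ne' hr.ne',
      Real.log_mul two_ne_zero hx.ne', smul_eq_mul]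
    field_simp
    ring
  rw [hgap]
  constructor
  · exact mul_nonneg (by positivity) (setIntegral_nonneg measurableSet_Ioc fun θ hθ => (hdb θ hθ).1)
  · have : ∫ θ in Ioc 0 (Real.pi / 2), d θ ≤ ∫ θ in Ioc 0 (Real.pi / 2), 4 * (r / x) ^ (1 / 4 : ℝ) :=
      setIntegral_mono_on hdi (integrableOn_const hfin) measurableSet_Ioc fun θ hθ => (hdb θ hθ).2
    rw [setIntegral_const, Real.volume_real_Ioc_of_le (by positivity), sub_zero, smul_eq_mul] at this
    calc 2 / Real.pi * ∫ θ in Ioc 0 (Real.pi / 2), d θ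
        ≤ 2 / Real.pi * (Real.pi / 2 * (4 * (r / x) ^ (1 / 4 : ℝ))) := by gcongr
      _ = _ := by field_simp

end Nanotube

/-! ### The two forms -/

namespace Nanotube

open ContinuousLinearMap

lemma absolutelyContinuous_primitive {f : ℝ → ℂ} (hf : LocallyIntegrable f volume) (b : ℝ) :
    AbsolutelyContinuousOnInterval (fun x => ∫ t in (0 : ℝ)..x, f t) 0 b := by
  have hi : ∀ x y : ℝ, IntervalIntegrable f volume x y := fun x y =>
    (hf.integrableOn_isCompact isCompact_uIcc).intervalIntegrable
  have hre : ∀ x y : ℝ, IntervalIntegrable (fun t => (f t).re) volume x y := fun x y =>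
    ⟨(hi x y).1.re, (hi x y).2.re⟩
  have him : ∀ x y : ℝ, IntervalIntegrable (fun t => (f t).im) volume x y := fun x y =>
    ⟨(hi x y).1.im, (hi x y).2.im⟩
  have ofRe : ∀ {g : ℝ → ℝ} {x y : ℝ}, IntervalIntegrable g volume x y →
      IntervalIntegrable (fun t => (g t : ℂ)) volume x y := fun h => ⟨h.1.ofReal, h.2.ofReal⟩
  have e : (fun x => ∫ t in (0 : ℝ)..x, f t) = fun x => (∫ t in (0 : ℝ)..x, (f t).re) • (1 : ℂ)
      + (∫ t in (0 : ℝ)..x, (f t).im) • Complex.I := by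
    ext x
    rw [Complex.real_smul, Complex.real_smul, mul_one, ← intervalIntegral.integral_ofReal,
      ← intervalIntegral.integral_ofReal, ← intervalIntegral.integral_mul_const,
      ← intervalIntegral.integral_add (ofRe (hre 0 x)) ((ofRe (him 0 x)).mul_const _)]
    simp only [Complex.re_add_im]
  have hc : ∀ c : ℂ, AbsolutelyContinuousOnInterval (fun _ : ℝ => c) 0 b := fun c =>
    (LipschitzWith.const c).lipschitzOnWith.absolutelyContinuousOnInterval
  rw [e]
  exact (((hre 0 b).absolutelyContinuousOnInterval_intervalIntegral (by simp)).smul (hc 1)).add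
    (((him 0 b).absolutelyContinuousOnInterval_intervalIntegral (by simp)).smul (hc _))

lemma locallyIntegrable_mul {f V : ℝ → ℂ} (hf : LocallyIntegrable f volume)
    (hV : Continuous V) : LocallyIntegrable (fun x => f x * V x) volume := by
  rw [locallyIntegrable_iff]
  exact fun k hk => (hf.integrableOn_isCompact hk).mul_continuousOn hV.continuousOn hk

lemma continuous_of_primitive {f U : ℝ → ℂ} (hf : LocallyIntegrable f volume)
    (hU : ∀ x, U x - U 0 = ∫ t in (0 : ℝ)..x, f t) : Continuous U := by
  have : U = fun x => U 0 + ∫ t in (0 : ℝ)..x, f t := funext fun x => by rw [← hU]; ring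
  rw [this]
  exact continuous_const.add (intervalIntegral.continuous_primitive
    (fun x y => (hf.integrableOn_isCompact isCompact_uIcc).intervalIntegrable) 0)

/-- Integration by parts for primitives of locally integrable functions. -/
lemma integral_primitive_mul {f g U V : ℝ → ℂ} (hf : LocallyIntegrable f volume)
    (hg : LocallyIntegrable g volume) (hU : ∀ x, U x - U 0 = ∫ t in (0 : ℝ)..x, f t)
    (hV : ∀ x, V x - V 0 = ∫ t in (0 : ℝ)..x, g t) (b : ℝ) :
    ∫ t in (0 : ℝ)..b, (f t * V t + U t * g t) = U b * V b - U 0 * V 0 := by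
  have hUc := continuous_of_primitive hf hU
  have hVc := continuous_of_primitive hg hV
  have hUe : U = fun x => U 0 + ∫ t in (0 : ℝ)..x, f t := funext fun x => by rw [← hU]; ring
  have hVe : V = fun x => V 0 + ∫ t in (0 : ℝ)..x, g t := funext fun x => by rw [← hV]; ring
  have hw : LocallyIntegrable (fun t => f t * V t + U t * g t) volume := by
    refine (locallyIntegrable_mul hf hVc).add ((locallyIntegrable_mul hg hUc).congr ?_)
    exact ae_of_all _ fun x => mul_comm _ _
  have hc : ∀ c : ℂ, AbsolutelyContinuousOnInterval (fun _ : ℝ => c) 0 b := fun c =>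
    (LipschitzWith.const c).lipschitzOnWith.absolutelyContinuousOnInterval
  have hUa : AbsolutelyContinuousOnInterval U 0 b := by
    rw [hUe]; exact (hc _).add (absolutelyContinuous_primitive hf b)
  have hVa : AbsolutelyContinuousOnInterval V 0 b := by
    rw [hVe]; exact (hc _).add (absolutelyContinuous_primitive hg b)
  have hF := (hUa.smul hVa).sub (absolutelyContinuous_primitive hw b)
  obtain ⟨C, hC⟩ := hF.const_of_ae_hasDerivAt_zero (by
    filter_upwards [_root_.LocallyIntegrable.ae_hasDerivAt_integral hf,
      _root_.LocallyIntegrable.ae_hasDerivAt_integral hg,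
      _root_.LocallyIntegrable.ae_hasDerivAt_integral hw] with x h1 h2 h3 _
    have k1 : HasDerivAt U (f x) x := by
      rw [hUe]; simpa using (h1 0).const_add (U 0)
    have k2 : HasDerivAt V (g x) x := by
      rw [hVe]; simpa using (h2 0).const_add (V 0)
    refine ((k1.mul k2).sub (h3 0)).congr_deriv ?_
    ring)
  have h0 := hC 0 (by simp)
  have hb := hC b (by simp)
  simp only [Pi.sub_apply, smul_eq_mul, Pi.mul_apply, intervalIntegral.integral_same, sub_zero]
    at h0 hb
  rw [h0, ← hb]; ring

/-- The product of the conjugate of `φ` with `ψ`. -/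
noncomputable def hprod (φ ψ : Sob) (x : ℝ) : ℂ := star (rep φ x) * rep ψ x

lemma continuous_hprod (φ ψ : Sob) : Continuous (hprod φ ψ) :=
  (rep φ).continuous.star.mul (rep ψ).continuous

lemma norm_hprod_le (φ ψ : Sob) (x : ℝ) : ‖hprod φ ψ x‖ ≤ 4 * (‖φ‖ * ‖ψ‖) := by
  rw [hprod, norm_mul, norm_star]
  calc ‖rep φ x‖ * ‖rep ψ x‖ ≤ (2 * ‖φ‖) * (2 * ‖ψ‖) := by
        gcongr <;> exact norm_rep_le _ _
    _ = _ := by ring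

lemma locallyIntegrable_star_der (φ : Sob) :
    LocallyIntegrable (fun x => star (der φ x)) volume := by
  have : LocallyIntegrable (star (der φ) : L2) volume := L2.locallyIntegrable _
  exact this.congr (Lp.coeFn_star (der φ))

lemma locallyIntegrable_dprod (φ ψ : Sob) : LocallyIntegrable (dprod φ ψ) volume := by
  refine (locallyIntegrable_mul (locallyIntegrable_star_der φ) (rep ψ).continuous).add
    ((locallyIntegrable_mul (L2.locallyIntegrable (der ψ)) (rep φ).continuous.star).congr ?_)
  exact ae_of_all _ fun x => mul_comm _ _

lemma star_rep_sub (φ : Sob) (x : ℝ) :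
    star (rep φ x) - star (rep φ 0) = ∫ t in (0 : ℝ)..x, star (der φ t) := by
  rw [← star_sub, rep_sub_rep]
  have := (starL' ℝ (A := ℂ)).toContinuousLinearMap.intervalIntegral_comp_comm
    (intervalIntegrable_L2 (der φ) 0 x)
  exact this.symm

lemma hprod_sub (φ ψ : Sob) (b : ℝ) :
    hprod φ ψ b - hprod φ ψ 0 = ∫ t in (0 : ℝ)..b, dprod φ ψ t :=
  (integral_primitive_mul (locallyIntegrable_star_der φ) (L2.locallyIntegrable (der ψ))
    (star_rep_sub φ) (fun x => rep_sub_rep ψ 0 x) b).symm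

lemma integrableOn_log_dprod (φ ψ : Sob) :
    IntegrableOn (fun x : ℝ => (Real.log (2 * x) : ℂ) * dprod φ ψ x) (Ioo (-(1 / 2)) (1 / 2)) := by
  have := integrableOn_log_derivProd (toH1 φ) (toH1 ψ)
  rwa [derivProd_toH1] at this

lemma locallyIntegrable_Veff {r : ℝ} (hr : 0 < r) :
    LocallyIntegrable (fun x => (Veff r x : ℂ)) volume :=
  (memLp_Veff hr).locallyIntegrable one_le_two

lemma continuous_integral_Veff {r : ℝ} (hr : 0 < r) :
    Continuous fun x => ∫ t in (0 : ℝ)..x, Veff r t :=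
  intervalIntegral.continuous_primitive (fun x y => intervalIntegrable_Veff hr x y) 0

lemma measurable_gap {r : ℝ} (hr : 0 < r) : Measurable (gap r) := by
  unfold gap
  have := (continuous_integral_Veff hr).measurable
  fun_prop

/-- Integration by parts on the half line trades the potential for its primitive. -/
lemma integral_half {r : ℝ} (hr : 0 < r) (φ ψ : Sob) :
    ∫ t in (0 : ℝ)..1 / 2, (-(Real.log (2 * t) : ℂ) * dprod φ ψ t - Veff r t * hprod φ ψ t)
      = Real.log r * hprod φ ψ 0 - gap r (1 / 2) * hprod φ ψ (1 / 2)
        + ∫ t in (0 : ℝ)..1 / 2, (gap r t : ℂ) * dprod φ ψ t := by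
  set P : ℝ → ℂ := fun x => ((∫ t in (0 : ℝ)..x, Veff r t : ℝ) : ℂ) with hP
  have hPc : Continuous P := Complex.continuous_ofReal.comp (continuous_integral_Veff hr)
  have h1 := integral_primitive_mul (locallyIntegrable_Veff hr) (locallyIntegrable_dprod φ ψ)
    (U := P) (V := hprod φ ψ) (fun x => by
      simp only [hP, intervalIntegral.integral_same, Complex.ofReal_zero, sub_zero]
      exact (intervalIntegral.integral_ofReal).symm) (hprod_sub φ ψ) (1 / 2)
  have h2 := hprod_sub φ ψ (1 / 2)
  have ii : ∀ f : ℝ → ℂ, LocallyIntegrable f volume → IntervalIntegrable f volume 0 (1 / 2) :=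
    fun f hf => (hf.integrableOn_isCompact isCompact_uIcc).intervalIntegrable
  have i1 : IntervalIntegrable (fun t => (Veff r t : ℂ) * hprod φ ψ t) volume 0 (1 / 2) :=
    ii _ (locallyIntegrable_mul (locallyIntegrable_Veff hr) (continuous_hprod φ ψ))
  have i2 : IntervalIntegrable (fun t => P t * dprod φ ψ t) volume 0 (1 / 2) :=
    ii _ ((locallyIntegrable_mul (locallyIntegrable_dprod φ ψ) hPc).congr
      (ae_of_all _ fun x => mul_comm _ _))
  have i3 : IntervalIntegrable (fun t => (Real.log (2 * t) : ℂ) * dprod φ ψ t) volume 0 (1 / 2) := by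
    rw [intervalIntegrable_iff_integrableOn_Ioo_of_le (by norm_num)]
    exact (integrableOn_log_dprod φ ψ).mono_set (Ioo_subset_Ioo_left (by norm_num))
  have i4 : IntervalIntegrable (fun t => (Real.log r : ℂ) * dprod φ ψ t) volume 0 (1 / 2) :=
    (ii _ (locallyIntegrable_dprod φ ψ)).const_mul _
  have e1 : ∫ t in (0 : ℝ)..1 / 2, (gap r t : ℂ) * dprod φ ψ t
      = (∫ t in (0 : ℝ)..1 / 2, P t * dprod φ ψ t)
        + Real.log r * (∫ t in (0 : ℝ)..1 / 2, dprod φ ψ t)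
        - ∫ t in (0 : ℝ)..1 / 2, (Real.log (2 * t) : ℂ) * dprod φ ψ t := by
    rw [← intervalIntegral.integral_const_mul, ← intervalIntegral.integral_add i2 i4,
      ← intervalIntegral.integral_sub (i2.add i4) i3]
    congr 1; ext t
    simp only [gap, hP]; push_cast; ring
  have e2 : ∫ t in (0 : ℝ)..1 / 2, (-(Real.log (2 * t) : ℂ) * dprod φ ψ t - Veff r t * hprod φ ψ t)
      = -(∫ t in (0 : ℝ)..1 / 2, (Real.log (2 * t) : ℂ) * dprod φ ψ t)
        - ∫ t in (0 : ℝ)..1 / 2, (Veff r t : ℂ) * hprod φ ψ t := by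
    simp only [neg_mul]
    have i3n : IntervalIntegrable (fun t => -((Real.log (2 * t) : ℂ) * dprod φ ψ t)) volume 0
      (1 / 2) := i3.neg
    rw [intervalIntegral.integral_sub i3n i1, intervalIntegral.integral_neg]
  rw [intervalIntegral.integral_add i1 i2] at h1
  have h3 : P 0 = 0 := by simp [hP]
  have h4 : (gap r (1 / 2) : ℂ) = P (1 / 2) + Real.log r := by
    simp only [gap, hP]
    norm_num
  rw [h3] at h1
  rw [e1, e2, h4, ← h2]
  linear_combination -h1

/-- The square integrable function such that minus its derivative is the singular part of the
regularised Coulomb potential. -/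
noncomputable def kC (x : ℝ) : ℝ :=
  (Ioo (-(1 / 2)) (1 / 2)).indicator
    (fun x => if 0 < x then -Real.log (2 * x) else Real.log (2 * x)) x

/-- The Coulomb potential away from its singularity. -/
noncomputable def vC (x : ℝ) : ℝ := {x : ℝ | 1 / 2 < |x|}.indicator (fun x => 1 / |x|) x

lemma measurableSet_tail : MeasurableSet {x : ℝ | 1 / 2 < |x|} :=
  measurableSet_lt measurable_const (by fun_prop)

lemma memLp_kC : MemLp (fun x => (kC x : ℂ)) 2 volume := by
  have h : MemLp (fun x : ℝ => (((if 0 < x then -Real.log (2 * x) else Real.log (2 * x) : ℝ)) : ℂ)) 2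
      (volume.restrict (Ioo (-(1 / 2)) (1 / 2))) := by
    refine memLp_log.mono ?_ (ae_of_all _ fun x => ?_)
    · apply Measurable.aestronglyMeasurable
      refine Complex.measurable_ofReal.comp (Measurable.ite measurableSet_Ioi ?_ ?_) <;> fun_prop
    · split_ifs <;> simp
  rw [← memLp_indicator_iff_restrict measurableSet_Ioo] at h
  refine h.ae_eq (ae_of_all _ fun x => ?_)
  by_cases hx : x ∈ Ioo (-(1 / 2) : ℝ) (1 / 2)
  · simp only [kC]
    rw [indicator_of_mem hx, indicator_of_mem hx]
  · simp only [kC]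
    rw [indicator_of_notMem hx, indicator_of_notMem hx]; rfl

lemma memLp_vC : MemLp (fun x => (vC x : ℂ)) 2 volume := by
  have hm : Measurable vC := Measurable.indicator (by fun_prop) measurableSet_tail
  have hm' : AEStronglyMeasurable (fun x => (vC x : ℂ)) volume :=
    (Complex.measurable_ofReal.comp hm).aestronglyMeasurable
  rw [memLp_two_iff_integrable_sq_norm hm']
  refine Integrable.mono' (integrable_inv_one_add_sq.const_mul 5) (hm'.norm.pow 2)
    (ae_of_all _ fun x => ?_)
  rw [norm_pow, norm_norm, Complex.norm_real, Real.norm_eq_abs, sq_abs]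
  by_cases hx : x ∈ {x : ℝ | 1 / 2 < |x|}
  · rw [vC, indicator_of_mem hx]
    have hx : 1 / 2 < |x| := hx
    have h2 : 1 / 4 < x ^ 2 := by rw [← sq_abs]; nlinarith
    rw [div_pow, sq_abs, one_pow, ← div_eq_mul_inv, div_le_div_iff₀ (by linarith) (by positivity)]
    linarith
  · rw [vC, indicator_of_notMem hx, zero_pow two_ne_zero]
    positivity

/-- `kC` as an element of `L²(ℝ)`. -/
noncomputable def KC : L2 := memLp_kC.toLp
/-- `vC` as an element of `L²(ℝ)`. -/
noncomputable def VC : L2 := memLp_vC.toLp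

open Classical in
/-- The effective potential as an element of `L²(ℝ)`, with the value zero for `r ≤ 0`. -/
noncomputable def VE (r : ℝ) : L2 := if hr : 0 < r then (memLp_Veff hr).toLp else 0

lemma KC_ae : (KC : ℝ → ℂ) =ᵐ[volume] fun x => (kC x : ℂ) := memLp_kC.coeFn_toLp
lemma VC_ae : (VC : ℝ → ℂ) =ᵐ[volume] fun x => (vC x : ℂ) := memLp_vC.coeFn_toLp
lemma VE_ae {r : ℝ} (hr : 0 < r) : (VE r : ℝ → ℂ) =ᵐ[volume] fun x => (Veff r x : ℂ) := by
  rw [VE, dif_pos hr]; exact (memLp_Veff hr).coeFn_toLp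

lemma star_of_ae {K : L2} {k : ℝ → ℝ} (h : (K : ℝ → ℂ) =ᵐ[volume] fun x => (k x : ℂ)) :
    ∀ᵐ x, star (K x) = K x := by
  filter_upwards [h] with x hx
  rw [hx]; exact Complex.conj_ofReal _

lemma star_KC : ∀ᵐ x, star (KC x) = KC x := star_of_ae KC_ae
lemma star_VC : ∀ᵐ x, star (VC x) = VC x := star_of_ae VC_ae
lemma star_VE {r : ℝ} (hr : 0 < r) : ∀ᵐ x, star (VE r x) = VE r x := star_of_ae (VE_ae hr)
lemma star_zero_L2 : ∀ᵐ x, star ((0 : L2) x) = (0 : L2) x :=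
  star_of_ae (k := 0) (by
    filter_upwards [Lp.coeFn_zero ℂ 2 (volume : Measure ℝ)] with x hx
    rw [hx]; simp)

lemma kC_neg {x : ℝ} (hx : x ≠ 0) : kC (-x) = -kC x := by
  have hm : -x ∈ Ioo (-(1 / 2) : ℝ) (1 / 2) ↔ x ∈ Ioo (-(1 / 2) : ℝ) (1 / 2) := by
    simp only [mem_Ioo]
    constructor <;> rintro ⟨h1, h2⟩ <;> constructor <;> linarith
  have hl : Real.log (2 * -x) = Real.log (2 * x) := by rw [mul_neg, Real.log_neg_eq_log]
  by_cases h : x ∈ Ioo (-(1 / 2) : ℝ) (1 / 2)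
  · rw [kC, kC, indicator_of_mem h, indicator_of_mem (hm.2 h), hl]
    rcases lt_or_gt_of_ne hx with h0 | h0
    · rw [if_pos (by linarith), if_neg (by linarith)]
    · rw [if_neg (by linarith), if_pos h0, neg_neg]
  · rw [kC, kC, indicator_of_notMem h, indicator_of_notMem (fun h' => h (hm.1 h')), neg_zero]

lemma vC_neg (x : ℝ) : vC (-x) = vC x := by
  simp only [vC, indicator, mem_ofPred_eq, abs_neg]

lemma KC_odd : ∀ᵐ x, KC (-x) = -KC x := by
  filter_upwards [KC_ae, ae_neg KC_ae, ae_ne_zero] with x h1 h2 h3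
  rw [h1, h2, kC_neg h3, Complex.ofReal_neg]

lemma VC_even : ∀ᵐ x, VC (-x) = VC x := by
  filter_upwards [VC_ae, ae_neg VC_ae] with x h1 h2
  rw [h1, h2, vC_neg]

lemma VE_even {r : ℝ} (hr : 0 < r) : ∀ᵐ x, VE r (-x) = VE r x := by
  filter_upwards [VE_ae hr, ae_neg (VE_ae hr)] with x h1 h2
  rw [h1, h2, Veff_neg]

lemma zero_odd : ∀ᵐ x, (0 : L2) (-x) = -(0 : L2) x := by
  have h := Lp.coeFn_zero ℂ 2 (volume : Measure ℝ)
  filter_upwards [h, ae_neg h] with x h1 h2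
  rw [h1, h2]; simp

/-- The regularised Coulomb form: a part near the origin, where the potential is integrated by parts,
and the Coulomb potential on the tail. -/
lemma C0_toH1 (φ ψ : Sob) :
    C0 (toH1 φ) (toH1 ψ) = (∫ x, KC x * dprod φ ψ x) + ∫ x, VC x * hprod φ ψ x := by
  have hL := integrableOn_log_dprod φ ψ
  have e1 : ∫ x, KC x * dprod φ ψ x = (∫ x in Ioo (-(1 / 2) : ℝ) 0, (Real.log (-2 * x) : ℂ) * dprod φ ψ x)
      - ∫ x in Ioo (0 : ℝ) (1 / 2), (Real.log (2 * x) : ℂ) * dprod φ ψ x := by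
    have i1 : IntegrableOn (fun x => (kC x : ℂ) * dprod φ ψ x) univ := by
      rw [integrableOn_univ]
      refine (integrable_mul_dprod KC star_KC φ ψ).congr ?_
      filter_upwards [KC_ae] with x hx
      rw [hx]
    have a1 : ∫ x, KC x * dprod φ ψ x
        = ∫ x in Ioo (-(1 / 2) : ℝ) (1 / 2), (kC x : ℂ) * dprod φ ψ x := by
      rw [setIntegral_eq_integral_of_forall_compl_eq_zero (s := Ioo (-(1 / 2) : ℝ) (1 / 2))]
      · refine integral_congr_ae ?_
        filter_upwards [KC_ae] with x hx
        rw [hx]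
      · intro x hx
        rw [kC, indicator_of_notMem hx]; simp
    have a2 : ∫ x in Ioo (-(1 / 2) : ℝ) (1 / 2), (kC x : ℂ) * dprod φ ψ x
        = (∫ x in Ioo (-(1 / 2) : ℝ) 0, (kC x : ℂ) * dprod φ ψ x)
          + ∫ x in Ioo (0 : ℝ) (1 / 2), (kC x : ℂ) * dprod φ ψ x := by
      rw [← integral_Ioc_eq_integral_Ioo, ← integral_Ioc_eq_integral_Ioo,
        ← integral_Ioc_eq_integral_Ioo, ← setIntegral_union _ measurableSet_Ioc
          (i1.mono_set (subset_univ _)) (i1.mono_set (subset_univ _)),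
        Ioc_union_Ioc_eq_Ioc (by norm_num) (by norm_num)]
      exact Ioc_disjoint_Ioc_of_le le_rfl
    rw [a1, a2, sub_eq_add_neg, ← integral_neg]
    congr 1
    · refine setIntegral_congr_fun measurableSet_Ioo fun x hx => ?_
      have : x ∈ Ioo (-(1 / 2) : ℝ) (1 / 2) := ⟨hx.1, hx.2.trans (by norm_num)⟩
      simp only [kC]
      rw [indicator_of_mem this, if_neg (not_lt.2 hx.2.le), neg_mul, Real.log_neg_eq_log]
    · refine setIntegral_congr_fun measurableSet_Ioo fun x hx => ?_
      have : x ∈ Ioo (-(1 / 2) : ℝ) (1 / 2) := ⟨lt_trans (by norm_num) hx.1, hx.2⟩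
      simp only [kC]
      rw [indicator_of_mem this, if_pos hx.1]
      push_cast; ring
  have e2 : ∫ x, VC x * hprod φ ψ x
      = ∫ x in {x : ℝ | 1 / 2 < |x|}, ((1 / |x| : ℝ) : ℂ) * hprod φ ψ x := by
    rw [← integral_indicator measurableSet_tail]
    refine integral_congr_ae ?_
    filter_upwards [VC_ae] with x hx
    rw [hx, vC]
    by_cases h : x ∈ {x : ℝ | 1 / 2 < |x|}
    · rw [indicator_of_mem h, indicator_of_mem h]
    · rw [indicator_of_notMem h, indicator_of_notMem h]; simp
  rw [C0, derivProd_toH1, e1, e2]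
  rfl

/-- The form of `H_C` is the form of a bounded operator on `H¹(ℝ)`. -/
lemma formC_toH1 (r : ℝ) (φ ψ : Sob) :
    formC r (toH1 φ) (toH1 ψ) = inner ℂ φ (formOp KC VC (2 * Real.log r) ψ) := by
  rw [inner_formOp, inner_mulOp_eq_dprod KC star_KC, inner_incl_mulOp]
  change (1 / 2 : ℂ) * inner ℂ (weakDeriv (toH1 φ)) (weakDeriv (toH1 ψ))
    + 2 * (Real.log r : ℂ) * (star (rep φ 0) * rep ψ 0) - C0 (toH1 φ) (toH1 ψ) = _
  rw [weakDeriv_toH1, weakDeriv_toH1, C0_toH1]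
  simp only [hprod]
  push_cast
  ring

/-- The form of the effective operator is the form of a bounded operator on `H¹(ℝ)`. -/
lemma formEff_toH1 {r : ℝ} (hr : 0 < r) (φ ψ : Sob) :
    formEff r (toH1 φ) (toH1 ψ) = inner ℂ φ (formOp 0 (VE r) 0 ψ) := by
  have h0 : ∫ x, (0 : L2) x * dprod φ ψ x = 0 := by
    refine integral_eq_zero_of_ae ?_
    filter_upwards [Lp.coeFn_zero ℂ 2 (volume : Measure ℝ)] with x hx
    rw [hx]; simp
  rw [inner_formOp, inner_mulOp_eq_dprod 0 star_zero_L2, inner_incl_mulOp, h0]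
  change (1 / 2 : ℂ) * inner ℂ (weakDeriv (toH1 φ)) (weakDeriv (toH1 ψ))
    - ∫ x, (Veff r x : ℂ) * (star (rep φ x) * rep ψ x) = _
  rw [weakDeriv_toH1, weakDeriv_toH1]
  have : ∫ x, VE r x * (star (rep φ x) * rep ψ x)
      = ∫ x, (Veff r x : ℂ) * (star (rep φ x) * rep ψ x) := by
    refine integral_congr_ae ?_
    filter_upwards [VE_ae hr] with x hx
    rw [hx]
  rw [this]
  simp

end Nanotube

/-! ### Convergence of the forms -/

namespace Nanotube

open ContinuousLinearMap

lemma memLp_quarter :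
    MemLp (fun x : ℝ => (((Ioc 0 (1 / 2)).indicator (fun x => x ^ (-(1 / 4) : ℝ)) x : ℝ) : ℂ)) 2
      volume := by
  have hm : AEStronglyMeasurable (fun x : ℝ =>
      (((Ioc 0 (1 / 2)).indicator (fun x => x ^ (-(1 / 4) : ℝ)) x : ℝ) : ℂ)) volume :=
    (Complex.measurable_ofReal.comp (Measurable.indicator (by fun_prop)
      measurableSet_Ioc)).aestronglyMeasurable
  rw [memLp_two_iff_integrable_sq_norm hm]
  have h1 : IntegrableOn (fun t : ℝ => t ^ (-(1 / 2) : ℝ)) (Ioc 0 (1 / 2)) := by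
    have := intervalIntegral.intervalIntegrable_rpow' (a := 0) (b := 1 / 2) (r := -(1 / 2))
      (by norm_num)
    rwa [intervalIntegrable_iff_integrableOn_Ioc_of_le (by norm_num)] at this
  refine (h1.integrable_indicator measurableSet_Ioc).congr (ae_of_all _ fun x => ?_)
  dsimp only
  rw [Complex.norm_real, Real.norm_eq_abs, sq_abs]
  by_cases hx : x ∈ Ioc (0 : ℝ) (1 / 2)
  · rw [indicator_of_mem hx, indicator_of_mem hx, ← Real.rpow_natCast, ← Real.rpow_mul hx.1.le]
    norm_num
  · rw [indicator_of_notMem hx, indicator_of_notMem hx]; norm_num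

/-- The form on the half interval `(0, 1/2)` differs from its limit by `O(r^{1/4})`. -/
lemma exists_norm_half_le : ∃ C : ℝ, 0 ≤ C ∧ ∀ r : ℝ, 0 < r → ∀ φ ψ : Sob,
    ‖(∫ t in (0 : ℝ)..1 / 2, ((kC t : ℂ) * dprod φ ψ t - Veff r t * hprod φ ψ t))
      - Real.log r * hprod φ ψ 0‖ ≤ C * r ^ (1 / 4 : ℝ) * (‖φ‖ * ‖ψ‖) := by
  set Q : L2 := memLp_quarter.toLp with hQ
  refine ⟨32 + 16 * ‖Q‖, by positivity, fun r hr φ ψ => ?_⟩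
  have hrp : 0 < r ^ (1 / 4 : ℝ) := by positivity
  set G : ℝ → ℂ := fun x => (((Ioc 0 (1 / 2)).indicator (gap r) x : ℝ) : ℂ) with hG
  have hGm : AEStronglyMeasurable G volume :=
    (Complex.measurable_ofReal.comp ((measurable_gap hr).indicator
      measurableSet_Ioc)).aestronglyMeasurable
  have hGb : ∀ x, ‖G x‖ ≤ 4 * r ^ (1 / 4 : ℝ) *
      ‖(((Ioc 0 (1 / 2)).indicator (fun x => x ^ (-(1 / 4) : ℝ)) x : ℝ) : ℂ)‖ := by
    intro x
    simp only [hG, Complex.norm_real, Real.norm_eq_abs]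
    by_cases hx : x ∈ Ioc (0 : ℝ) (1 / 2)
    · rw [indicator_of_mem hx, indicator_of_mem hx]
      obtain ⟨g1, g2⟩ := gap_bounds hr hx.1
      rw [abs_of_nonneg g1, abs_of_nonneg (Real.rpow_nonneg hx.1.le _)]
      refine g2.trans_eq ?_
      rw [Real.div_rpow hr.le hx.1.le, Real.rpow_neg hx.1.le]
      ring
    · rw [indicator_of_notMem hx, indicator_of_notMem hx]; simp
  have hGL : MemLp G 2 volume :=
    memLp_quarter.of_le_mul hGm (ae_of_all _ hGb)
  set Gr : L2 := hGL.toLp with hGLd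
  have hGLn : ‖Gr‖ ≤ 4 * r ^ (1 / 4 : ℝ) * ‖Q‖ := by
    refine Lp.norm_le_mul_norm_of_ae_le_mul ?_
    filter_upwards [hGL.coeFn_toLp, memLp_quarter.coeFn_toLp] with x h1 h2
    rw [h1, h2]
    exact hGb x
  have hGae : (Gr : ℝ → ℂ) =ᵐ[volume] fun x => (((Ioc 0 (1 / 2)).indicator (gap r) x : ℝ) : ℂ) :=
    hGL.coeFn_toLp
  have e1 : ∫ t in (0 : ℝ)..1 / 2, ((kC t : ℂ) * dprod φ ψ t - Veff r t * hprod φ ψ t)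
      = ∫ t in (0 : ℝ)..1 / 2, (-(Real.log (2 * t) : ℂ) * dprod φ ψ t - Veff r t * hprod φ ψ t) := by
    rw [intervalIntegral.integral_of_le (by norm_num), intervalIntegral.integral_of_le (by norm_num),
      integral_Ioc_eq_integral_Ioo, integral_Ioc_eq_integral_Ioo]
    refine setIntegral_congr_fun measurableSet_Ioo fun x hx => ?_
    have : x ∈ Ioo (-(1 / 2) : ℝ) (1 / 2) := ⟨lt_trans (by norm_num) hx.1, hx.2⟩
    simp only [kC]
    rw [indicator_of_mem this, if_pos hx.1]
    push_cast; ring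
  have e2 : ∫ t in (0 : ℝ)..1 / 2, (gap r t : ℂ) * dprod φ ψ t
      = inner ℂ (der φ) (mulOp Gr ψ) + inner ℂ (mulOp Gr φ) (der ψ) := by
    rw [inner_mulOp_eq_dprod Gr (star_of_ae hGae), intervalIntegral.integral_of_le (by norm_num),
      ← integral_indicator measurableSet_Ioc]
    refine integral_congr_ae ?_
    filter_upwards [hGae] with x hx
    rw [hx]
    by_cases h : x ∈ Ioc (0 : ℝ) (1 / 2)
    · rw [indicator_of_mem h, indicator_of_mem h]
    · rw [indicator_of_notMem h, indicator_of_notMem h]; simp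
  rw [e1, integral_half hr, e2]
  have n1 : ‖inner ℂ (der φ) (mulOp Gr ψ)‖ ≤ 8 * ‖Q‖ * r ^ (1 / 4 : ℝ) * (‖φ‖ * ‖ψ‖) := by
    calc ‖inner ℂ (der φ) (mulOp Gr ψ)‖ ≤ ‖der φ‖ * ‖mulOp Gr ψ‖ := norm_inner_le_norm _ _
      _ ≤ ‖φ‖ * ((2 * (4 * r ^ (1 / 4 : ℝ) * ‖Q‖)) * ‖ψ‖) := by
        gcongr
        · exact norm_der_apply_le φ
        · exact (mulOp Gr).le_of_opNorm_le ((norm_mulOp_le Gr).trans (by gcongr)) ψ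
      _ = _ := by ring
  have n2 : ‖inner ℂ (mulOp Gr φ) (der ψ)‖ ≤ 8 * ‖Q‖ * r ^ (1 / 4 : ℝ) * (‖φ‖ * ‖ψ‖) := by
    calc ‖inner ℂ (mulOp Gr φ) (der ψ)‖ ≤ ‖mulOp Gr φ‖ * ‖der ψ‖ := norm_inner_le_norm _ _
      _ ≤ ((2 * (4 * r ^ (1 / 4 : ℝ) * ‖Q‖)) * ‖φ‖) * ‖ψ‖ := by
        gcongr
        · exact (mulOp Gr).le_of_opNorm_le ((norm_mulOp_le Gr).trans (by gcongr)) φ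
        · exact norm_der_apply_le ψ
      _ = _ := by ring
  have n3 : ‖(gap r (1 / 2) : ℂ) * hprod φ ψ (1 / 2)‖ ≤ 32 * r ^ (1 / 4 : ℝ) * (‖φ‖ * ‖ψ‖) := by
    obtain ⟨g1, g2⟩ := gap_bounds (x := 1 / 2) hr (by norm_num)
    have g3 : (r / (1 / 2)) ^ (1 / 4 : ℝ) ≤ 2 * r ^ (1 / 4 : ℝ) := by
      have : r / (1 / 2) = 2 * r := by ring
      rw [this, Real.mul_rpow (by norm_num) hr.le]
      gcongr
      calc (2 : ℝ) ^ (1 / 4 : ℝ) ≤ 2 ^ (1 : ℝ) :=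
            Real.rpow_le_rpow_of_exponent_le (by norm_num) (by norm_num)
        _ = 2 := Real.rpow_one 2
    rw [norm_mul, Complex.norm_real, Real.norm_eq_abs, abs_of_nonneg g1]
    calc gap r (1 / 2) * ‖hprod φ ψ (1 / 2)‖
        ≤ (4 * (2 * r ^ (1 / 4 : ℝ))) * (4 * (‖φ‖ * ‖ψ‖)) := by
          gcongr
          · exact g2.trans (by gcongr)
          · exact norm_hprod_le φ ψ _
      _ = _ := by ring
  have e3 : Real.log r * hprod φ ψ 0 - gap r (1 / 2) * hprod φ ψ (1 / 2)
      + (inner ℂ (der φ) (mulOp Gr ψ) + inner ℂ (mulOp Gr φ) (der ψ)) - Real.log r * hprod φ ψ 0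
      = inner ℂ (der φ) (mulOp Gr ψ) + inner ℂ (mulOp Gr φ) (der ψ)
        - gap r (1 / 2) * hprod φ ψ (1 / 2) := by ring
  rw [e3]
  refine (norm_sub_le _ _).trans ((add_le_add (norm_add_le _ _) le_rfl).trans ?_)
  linarith

lemma dprod_refl_ae (φ ψ : Sob) :
    ∀ᵐ x, dprod (refl φ) (refl ψ) x = -dprod φ ψ (-x) := by
  have h : ∀ u : Sob, ∀ᵐ x, der (refl u) x = -der u (-x) := fun u => by
    rw [der_refl]
    filter_upwards [Lp.coeFn_neg (reflL2 (der u)), reflL2_ae (der u)] with x h1 h2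
    rw [h1, Pi.neg_apply, h2]
  filter_upwards [h φ, h ψ] with x h1 h2
  simp only [dprod, h1, h2, rep_refl, star_neg]
  ring

lemma inner_effective_sub {r : ℝ} (hr : 0 < r) (φ ψ : Sob) :
    inner ℂ φ ((formOp 0 (VE r) 0 - formOp KC VC (2 * Real.log r)) ψ)
      = (∫ x, KC x * dprod φ ψ x) + (∫ x, VC x * hprod φ ψ x)
        - (∫ x, (Veff r x : ℂ) * hprod φ ψ x) - 2 * Real.log r * hprod φ ψ 0 := by
  rw [sub_apply, inner_sub_right, ← formEff_toH1 hr, ← formC_toH1]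
  change ((1 / 2 : ℂ) * inner ℂ (weakDeriv (toH1 φ)) (weakDeriv (toH1 ψ))
    - ∫ x, (Veff r x : ℂ) * (star (rep φ x) * rep ψ x))
    - ((1 / 2 : ℂ) * inner ℂ (weakDeriv (toH1 φ)) (weakDeriv (toH1 ψ))
    + 2 * (Real.log r : ℂ) * (star (rep φ 0) * rep ψ 0) - C0 (toH1 φ) (toH1 ψ)) = _
  rw [C0_toH1]
  simp only [hprod]
  ring

/-- The effective operator converges to `H_C` in the form sense, at a rate that beats the
logarithmic divergence of `H_C`. -/
lemma exists_norm_sub_le : ∃ C : ℝ, 0 ≤ C ∧ ∀ r : ℝ, 0 < r → r ≤ 1 →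
    ‖formOp 0 (VE r) 0 - formOp KC VC (2 * Real.log r)‖ ≤ C * r ^ (1 / 4 : ℝ) := by
  obtain ⟨C, hC, hCb⟩ := exists_norm_half_le
  refine ⟨2 * C + 16, by positivity, fun r hr hr1 => ?_⟩
  have hrp : 0 < r ^ (1 / 4 : ℝ) := by positivity
  refine opNorm_le_bound _ (by positivity) fun ψ => ?_
  set W := formOp 0 (VE r) 0 - formOp KC VC (2 * Real.log r) with hW
  have key : ∀ φ : Sob, ‖inner ℂ φ (W ψ)‖ ≤ (2 * C + 16) * r ^ (1 / 4 : ℝ) * (‖φ‖ * ‖ψ‖) := by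
    intro φ
    have hKi := integrable_mul_dprod KC star_KC φ ψ
    have hVi : Integrable fun x => VC x * hprod φ ψ x := integrable_mul_star_rep VC φ ψ
    have hEi : Integrable fun x => (Veff r x : ℂ) * hprod φ ψ x :=
      integrable_Veff r (toH1 φ) (toH1 ψ)
    set F : ℝ → ℂ := fun x => KC x * dprod φ ψ x + VC x * hprod φ ψ x - Veff r x * hprod φ ψ x
      with hF
    have hKV : Integrable fun x => KC x * dprod φ ψ x + VC x * hprod φ ψ x := hKi.add hVi
    have hFi : Integrable F := (hKi.add hVi).sub hEi
    set S : Set ℝ := Ioc (-(1 / 2)) (1 / 2) with hS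
    have e0 : inner ℂ φ (W ψ) = (∫ x in S, F x) + (∫ x in Sᶜ, F x)
        - 2 * Real.log r * hprod φ ψ 0 := by
      rw [integral_add_compl measurableSet_Ioc hFi, hW, inner_effective_sub hr,
        ← integral_add hKi hVi, ← integral_sub hKV hEi]
    set f : Sob → Sob → ℝ → ℂ := fun φ ψ t => (kC t : ℂ) * dprod φ ψ t - Veff r t * hprod φ ψ t
      with hf
    have hFf : ∀ᵐ x, x ∈ S → F x = f φ ψ x := by
      filter_upwards [KC_ae, VC_ae] with x h1 h2 hx
      have : vC x = 0 := by
        rw [vC, indicator_of_notMem]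
        exact not_lt.2 (abs_le.2 ⟨hx.1.le, hx.2⟩)
      simp only [hF, hf]
      rw [h1, h2, this]; simp
    have e1 : ∫ x in S, F x = (∫ t in (0 : ℝ)..1 / 2, f φ ψ t)
        + ∫ t in (0 : ℝ)..1 / 2, f (refl φ) (refl ψ) t := by
      have hfi : IntegrableOn (f φ ψ) S := by
        refine (hFi.integrableOn (s := S)).congr ?_
        filter_upwards [ae_restrict_of_ae hFf, ae_restrict_mem measurableSet_Ioc] with x h1 h2
        exact h1 h2
      have i1 : IntervalIntegrable (f φ ψ) volume (-(1 / 2)) (1 / 2) := by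
        rwa [intervalIntegrable_iff_integrableOn_Ioc_of_le (by norm_num)]
      have a1 : ∫ x in S, F x = ∫ x in (-(1 / 2) : ℝ)..1 / 2, f φ ψ x := by
        rw [intervalIntegral.integral_of_le (by norm_num)]
        exact setIntegral_congr_ae measurableSet_Ioc hFf
      have a2 : ∫ t in (0 : ℝ)..1 / 2, f (refl φ) (refl ψ) t
          = ∫ x in (-(1 / 2) : ℝ)..0, f φ ψ x := by
        have := intervalIntegral.integral_comp_neg (a := 0) (b := 1 / 2) (f φ ψ)
        rw [neg_zero] at this
        rw [← this]
        refine intervalIntegral.integral_congr_ae ?_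
        filter_upwards [dprod_refl_ae φ ψ, ae_ne_zero] with x h1 h2 _
        simp only [hf]
        rw [h1, kC_neg h2, Veff_neg, hprod, hprod, rep_refl, rep_refl]
        push_cast; ring
      rw [a1, a2, add_comm, intervalIntegral.integral_add_adjacent_intervals]
      · exact i1.mono_set (by
          rw [uIcc_of_le (by norm_num), uIcc_of_le (by norm_num)]
          exact Icc_subset_Icc_right (by norm_num))
      · exact i1.mono_set (by
          rw [uIcc_of_le (by norm_num), uIcc_of_le (by norm_num)]
          exact Icc_subset_Icc_left (by norm_num))
    have hT : MemLp (Sᶜ.indicator fun x => (vC x : ℂ) - Veff r x) 2 volume :=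
      (memLp_vC.sub (memLp_Veff hr)).indicator measurableSet_Ioc.compl
    have e2 : ∫ x in Sᶜ, F x = inner ℂ (incl φ) (mulOp hT.toLp ψ) := by
      rw [inner_incl_mulOp, ← integral_indicator measurableSet_Ioc.compl]
      refine integral_congr_ae ?_
      filter_upwards [KC_ae, VC_ae, hT.coeFn_toLp] with x h1 h2 h3
      rw [h3]
      by_cases hx : x ∈ Sᶜ
      · have : kC x = 0 := by
          rw [kC, indicator_of_notMem]
          exact fun h => hx (Ioo_subset_Ioc_self h)
        rw [indicator_of_mem hx, indicator_of_mem hx]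
        simp only [hF, hprod]
        rw [h1, h2, this]; simp; ring
      · rw [indicator_of_notMem hx, indicator_of_notMem hx, zero_mul]
    have n0 : ‖inner ℂ (incl φ) (mulOp hT.toLp ψ)‖ ≤ 16 * r ^ (1 / 4 : ℝ) * (‖φ‖ * ‖ψ‖) := by
      have b1 : ‖mulOp hT.toLp ψ‖ ≤ 16 * r ^ 2 * ‖incl ψ‖ := by
        refine Lp.norm_le_mul_norm_of_ae_le_mul ?_
        filter_upwards [mulOp_ae hT.toLp ψ, hT.coeFn_toLp, rep_ae ψ,
          (measure_eq_zero_iff_ae_notMem.1 (measure_singleton (-(1 / 2) : ℝ)))] with x h1 h2 h3 h4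
        rw [h1, h2, h3, norm_mul]
        gcongr
        by_cases hx : x ∈ Sᶜ
        · have hx2 : 1 / 2 < |x| := by
            by_contra hc
            have := abs_le.1 (not_lt.1 hc)
            exact hx ⟨lt_of_le_of_ne this.1 (fun h => h4 h.symm), this.2⟩
          have hx0 : x ≠ 0 := by rintro rfl; norm_num at hx2
          rw [indicator_of_mem hx, vC, indicator_of_mem (show x ∈ {x : ℝ | 1 / 2 < |x|} from hx2),
            ← Complex.ofReal_sub, Complex.norm_real, Real.norm_eq_abs,
            abs_of_nonneg (sub_nonneg.2 (Veff_le_inv hr hx0))]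
          exact inv_sub_Veff_le hr hx2
        · rw [indicator_of_notMem hx, norm_zero]; positivity
      have b2 : r ^ 2 ≤ r ^ (1 / 4 : ℝ) := by
        rw [← Real.rpow_natCast]
        exact Real.rpow_le_rpow_of_exponent_ge hr hr1 (by norm_num)
      calc ‖inner ℂ (incl φ) (mulOp hT.toLp ψ)‖ ≤ ‖incl φ‖ * ‖mulOp hT.toLp ψ‖ :=
            norm_inner_le_norm _ _
        _ ≤ ‖φ‖ * (16 * r ^ (1 / 4 : ℝ) * ‖ψ‖) := by
          gcongr
          · exact norm_incl_apply_le φ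
          · exact b1.trans (by gcongr; exact norm_incl_apply_le ψ)
        _ = _ := by ring
    have n1 := hCb r hr φ ψ
    have n2 := hCb r hr (refl φ) (refl ψ)
    have hnr : ∀ u : Sob, ‖refl u‖ = ‖u‖ := fun u => by
      rw [@norm_eq_sqrt_re_inner ℂ, @norm_eq_sqrt_re_inner ℂ, inner_refl_refl]
    have h00 : hprod (refl φ) (refl ψ) 0 = hprod φ ψ 0 := by simp [hprod, rep_refl]
    rw [hnr, hnr, h00] at n2
    have e3 : inner ℂ φ (W ψ) = ((∫ t in (0 : ℝ)..1 / 2, f φ ψ t) - Real.log r * hprod φ ψ 0)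
        + ((∫ t in (0 : ℝ)..1 / 2, f (refl φ) (refl ψ) t) - Real.log r * hprod φ ψ 0)
        + inner ℂ (incl φ) (mulOp hT.toLp ψ) := by
      rw [e0, e1, e2]; ring
    rw [e3]
    refine (norm_add_le _ _).trans ((add_le_add (norm_add_le _ _) le_rfl).trans ?_)
    linarith
  have h := key (W ψ)
  rw [inner_self_eq_norm_sq_to_K, ← RCLike.ofReal_pow, RCLike.norm_ofReal, abs_of_nonneg (by positivity)] at h
  rcases (norm_nonneg (W ψ)).eq_or_lt with h0 | h0
  · rw [← h0]; positivity
  · refine le_of_mul_le_mul_left ?_ h0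
    calc ‖W ψ‖ * ‖W ψ‖ = ‖W ψ‖ ^ 2 := by ring
      _ ≤ _ := h
      _ = _ := by ring

end Nanotube

/-! ### Functions vanishing at the origin -/

namespace Nanotube

open ContinuousLinearMap

lemma rep_zero : rep 0 = 0 := by
  have := rep_sub 0 0
  rwa [sub_self, sub_self] at this

lemma norm_rep_le_sqrt {ψ : Sob} (h0 : rep ψ 0 = 0) (x : ℝ) : ‖rep ψ x‖ ≤ √|x| * ‖ψ‖ := by
  have := norm_rep_sub_rep_le ψ 0 x
  rw [h0, sub_zero, sub_zero] at this
  exact this.trans (by gcongr; exact norm_der_apply_le ψ)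

lemma integrable_hprod (φ ψ : Sob) : Integrable (hprod φ ψ) := integrable_star_mul (toH1 φ) (toH1 ψ)

/-- A Coulomb singularity is integrable against functions vanishing at the origin. -/
lemma integrable_potential_mul {V : ℝ → ℝ} (hVm : Measurable V)
    (hV : ∀ x, x ≠ 0 → 0 ≤ V x ∧ V x ≤ 1 / |x|) (φ : Sob) {ψ : Sob} (h0 : rep ψ 0 = 0) :
    Integrable fun x => (V x : ℂ) * hprod φ ψ x := by
  have hi : IntegrableOn (fun x : ℝ => |x| ^ (-(1 / 2) : ℝ)) (Ioc (-1) 1) := by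
    have := intervalIntegrable_abs_rpow (-1) 1
    rwa [intervalIntegrable_iff_integrableOn_Ioc_of_le (by norm_num)] at this
  have hg := ((hi.integrable_indicator measurableSet_Ioc).const_mul (2 * ‖φ‖ * ‖ψ‖)).add
    (integrable_hprod φ ψ).norm
  refine Integrable.mono' hg ((Complex.measurable_ofReal.comp hVm).aestronglyMeasurable.mul
    (continuous_hprod φ ψ).aestronglyMeasurable) ?_
  filter_upwards [ae_ne_zero] with x hx
  have hx' : 0 < |x| := abs_pos.2 hx
  simp only [Pi.add_apply]
  rw [norm_mul, Complex.norm_real, Real.norm_eq_abs, abs_of_nonneg (hV x hx).1]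
  by_cases h : x ∈ Ioc (-1 : ℝ) 1
  · rw [indicator_of_mem h]
    have h1 : ‖hprod φ ψ x‖ ≤ 2 * ‖φ‖ * (√|x| * ‖ψ‖) := by
      rw [hprod, norm_mul, norm_star]
      gcongr
      · exact norm_rep_le φ x
      · exact norm_rep_le_sqrt h0 x
    have h2 : 1 / |x| * √|x| = |x| ^ (-(1 / 2) : ℝ) := by
      rw [Real.sqrt_eq_rpow, one_div, ← Real.rpow_neg_one, ← Real.rpow_add hx']
      norm_num
    calc V x * ‖hprod φ ψ x‖ ≤ 1 / |x| * (2 * ‖φ‖ * (√|x| * ‖ψ‖)) := by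
          gcongr
          exact (hV x hx).2
      _ = 2 * ‖φ‖ * ‖ψ‖ * |x| ^ (-(1 / 2) : ℝ) := by rw [← h2]; ring
      _ ≤ _ := le_add_of_nonneg_right (norm_nonneg _)
  · rw [indicator_of_notMem h, mul_zero, zero_add]
    refine mul_le_of_le_one_left (norm_nonneg _) ((hV x hx).2.trans ?_)
    rw [div_le_one hx']
    by_contra hc
    rw [not_le, abs_lt] at hc
    exact h ⟨hc.1, hc.2.le⟩

lemma measurable_coulomb : Measurable fun x : ℝ => 1 / |x| := by fun_prop

lemma integrable_coulomb_mul (φ : Sob) {ψ : Sob} (h0 : rep ψ 0 = 0) :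
    Integrable fun x => ((1 / |x| : ℝ) : ℂ) * hprod φ ψ x :=
  integrable_potential_mul measurable_coulomb (fun x _ => ⟨by positivity, le_rfl⟩) φ h0

lemma tendsto_Veff {x : ℝ} (hx : x ≠ 0) :
    Tendsto (fun r => Veff r x) (𝓝[>] 0) (𝓝 (1 / |x|)) := by
  have h1 : Tendsto (fun r : ℝ => 1 / √(x ^ 2 + 4 * r ^ 2)) (𝓝[>] 0) (𝓝 (1 / |x|)) := by
    have hc : ContinuousAt (fun r : ℝ => 1 / √(x ^ 2 + 4 * r ^ 2)) 0 := by
      refine ContinuousAt.div continuousAt_const (by fun_prop) ?_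
      have : 0 < x ^ 2 := by positivity
      positivity
    have := hc.tendsto.mono_left (nhdsWithin_le_nhds (s := Ioi (0 : ℝ)))
    simpa [Real.sqrt_sq_eq_abs] using this
  refine tendsto_of_tendsto_of_tendsto_of_le_of_le' h1 tendsto_const_nhds ?_ ?_
  · filter_upwards [self_mem_nhdsWithin] with r hr using le_Veff hr hx
  · filter_upwards [self_mem_nhdsWithin] with r hr using Veff_le_inv hr hx

lemma tendsto_rpow_quarter : Tendsto (fun r : ℝ => r ^ (1 / 4 : ℝ)) (𝓝[>] 0) (𝓝 0) := by
  have := (Real.continuousAt_rpow_const 0 (1 / 4 : ℝ) (Or.inr (by norm_num))).tendsto.mono_left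
    (nhdsWithin_le_nhds (s := Ioi (0 : ℝ)))
  rwa [Real.zero_rpow (by norm_num)] at this

/-- On functions vanishing at the origin the regularised Coulomb form is the form of the Coulomb
potential. -/
lemma coulomb_of_rep_zero (φ : Sob) {ψ : Sob} (h0 : rep ψ 0 = 0) :
    (∫ x, KC x * dprod φ ψ x) + (∫ x, VC x * hprod φ ψ x)
      = ∫ x, ((1 / |x| : ℝ) : ℂ) * hprod φ ψ x := by
  set c := (∫ x, KC x * dprod φ ψ x) + (∫ x, VC x * hprod φ ψ x) with hc
  have t1 : Tendsto (fun r => ∫ x, (Veff r x : ℂ) * hprod φ ψ x) (𝓝[>] 0)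
      (𝓝 (∫ x, ((1 / |x| : ℝ) : ℂ) * hprod φ ψ x)) := by
    refine tendsto_integral_filter_of_dominated_convergence
      (fun x => ‖((1 / |x| : ℝ) : ℂ) * hprod φ ψ x‖) ?_ ?_ (integrable_coulomb_mul φ h0).norm ?_
    · filter_upwards [self_mem_nhdsWithin] with r hr
      exact (integrable_Veff r (toH1 φ) (toH1 ψ)).aestronglyMeasurable
    · filter_upwards [self_mem_nhdsWithin] with r hr
      filter_upwards [ae_ne_zero] with x hx
      rw [norm_mul, norm_mul, Complex.norm_real, Complex.norm_real, Real.norm_eq_abs,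
        Real.norm_eq_abs, abs_of_nonneg (Veff_nonneg hr x), abs_of_nonneg (by positivity)]
      gcongr
      exact Veff_le_inv hr hx
    · filter_upwards [ae_ne_zero] with x hx
      exact ((Complex.continuous_ofReal.tendsto _).comp (tendsto_Veff hx)).mul_const _
  have t2 : Tendsto (fun r => ∫ x, (Veff r x : ℂ) * hprod φ ψ x) (𝓝[>] 0) (𝓝 c) := by
    obtain ⟨C, hC, hCb⟩ := exists_norm_sub_le
    rw [tendsto_iff_norm_sub_tendsto_zero]
    have tb : Tendsto (fun r : ℝ => ‖φ‖ * (C * r ^ (1 / 4 : ℝ) * ‖ψ‖)) (𝓝[>] 0) (𝓝 0) := by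
      simpa using ((tendsto_rpow_quarter.const_mul C).mul_const ‖ψ‖).const_mul ‖φ‖
    refine squeeze_zero' (Eventually.of_forall fun r => norm_nonneg _) ?_ tb
    filter_upwards [self_mem_nhdsWithin, nhdsWithin_le_nhds (Iic_mem_nhds (zero_lt_one' ℝ))]
      with r hr hr1
    have := inner_effective_sub hr φ ψ
    have h00 : hprod φ ψ 0 = 0 := by rw [hprod, h0, mul_zero]
    rw [h00, mul_zero, sub_zero, ← hc] at this
    rw [norm_sub_rev, ← this]
    exact (norm_inner_le_norm _ _).trans
      (mul_le_mul_of_nonneg_left (le_of_opNorm_le _ (hCb r hr hr1) ψ) (norm_nonneg _))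
  exact tendsto_nhds_unique t2 t1

lemma inner_formOp_of_rep_zero (α : ℝ) (φ : Sob) {ψ : Sob} (h0 : rep ψ 0 = 0) :
    inner ℂ φ (formOp KC VC α ψ) = (1 / 2 : ℂ) * inner ℂ (der φ) (der ψ)
      - ∫ x, ((1 / |x| : ℝ) : ℂ) * hprod φ ψ x := by
  rw [← coulomb_of_rep_zero φ h0, inner_formOp, inner_mulOp_eq_dprod KC star_KC, inner_incl_mulOp,
    h0]
  simp only [hprod]; ring

lemma inner_formOp_effective {r : ℝ} (hr : 0 < r) (φ ψ : Sob) :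
    inner ℂ φ (formOp 0 (VE r) 0 ψ) = (1 / 2 : ℂ) * inner ℂ (der φ) (der ψ)
      - ∫ x, (Veff r x : ℂ) * hprod φ ψ x := by
  rw [← formEff_toH1 hr]
  change (1 / 2 : ℂ) * inner ℂ (weakDeriv (toH1 φ)) (weakDeriv (toH1 ψ))
    - ∫ x, (Veff r x : ℂ) * (star (rep φ x) * rep ψ x) = _
  rw [weakDeriv_toH1, weakDeriv_toH1]
  rfl

lemma hprod_self (ψ : Sob) (x : ℝ) : hprod ψ ψ x = ((‖rep ψ x‖ ^ 2 : ℝ) : ℂ) := by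
  rw [hprod]; push_cast; exact Complex.conj_mul' _

lemma integral_mul_hprod_self (V : ℝ → ℝ) (ψ : Sob) :
    ∫ x, (V x : ℂ) * hprod ψ ψ x = ((∫ x, V x * ‖rep ψ x‖ ^ 2 : ℝ) : ℂ) := by
  refine Eq.trans ?_ integral_ofReal
  congr 1; ext x
  rw [hprod_self]; push_cast; rfl

lemma integrable_mul_sq_rep {V : ℝ → ℝ} {ψ : Sob}
    (h : Integrable fun x => (V x : ℂ) * hprod ψ ψ x) :
    Integrable fun x => V x * ‖rep ψ x‖ ^ 2 := by
  refine h.re.congr (ae_of_all _ fun x => ?_)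
  simp only [hprod_self]
  rw [← Complex.ofReal_mul]
  exact Complex.ofReal_re _

/-- On functions vanishing at the origin the Coulomb potential is more attractive than the
effective potential. -/
lemma re_inner_formOp_le {r : ℝ} (hr : 0 < r) (α : ℝ) {ψ : Sob} (h0 : rep ψ 0 = 0) :
    (inner ℂ ψ (formOp KC VC α ψ)).re ≤ (inner ℂ ψ (formOp 0 (VE r) 0 ψ)).re := by
  rw [inner_formOp_of_rep_zero α ψ h0, inner_formOp_effective hr, Complex.sub_re, Complex.sub_re]
  refine sub_le_sub_left ?_ _
  rw [integral_mul_hprod_self (Veff r), integral_mul_hprod_self fun x => 1 / |x|,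
    Complex.ofReal_re, Complex.ofReal_re]
  refine integral_mono_ae (integrable_mul_sq_rep (integrable_Veff r (toH1 ψ) (toH1 ψ)))
    (integrable_mul_sq_rep (integrable_coulomb_mul ψ h0)) ?_
  filter_upwards [ae_ne_zero] with x hx
  have := Veff_le_inv hr hx
  gcongr

/-- Uniqueness for the Volterra equation of an ordinary differential equation `u'' = g` whose
coefficients have a Coulomb singularity at the origin, by Picard iteration. -/
lemma eq_zero_of_volterra {u p g : ℝ → ℂ} {K : ℝ} (hK : 0 ≤ K) (hp : Continuous p)
    (hu : ∀ x, 0 ≤ x → u x = ∫ t in (0 : ℝ)..x, p t)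
    (hpg : ∀ x, 0 ≤ x → p x = ∫ t in (0 : ℝ)..x, g t)
    (hg : ∀ x, 0 < x → ‖g x‖ ≤ (2 / x + K) * ‖u x‖) {x : ℝ} (hx : 0 ≤ x) : u x = 0 := by
  obtain ⟨M, hM⟩ := (isCompact_Icc (a := (0 : ℝ)) (b := x)).exists_bound_of_continuousOn
    hp.continuousOn
  have hM0 : 0 ≤ M := (norm_nonneg _).trans (hM 0 ⟨le_rfl, hx⟩)
  set L := 2 + K * x with hL
  have hL0 : 0 ≤ L := by positivity
  have hpow : ∀ (c : ℝ) (n : ℕ) (y : ℝ), ∫ t in (0 : ℝ)..y, c * t ^ n = c * y ^ (n + 1) / (n + 1) := by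
    intro c n y
    rw [intervalIntegral.integral_const_mul, integral_pow, zero_pow (Nat.succ_ne_zero n), sub_zero,
      mul_div_assoc]
  have key : ∀ n : ℕ, ∀ y ∈ Icc 0 x, ‖p y‖ ≤ M * L ^ n / (n.factorial : ℝ) * y ^ n := by
    intro n
    induction n with
    | zero => intro y hy; simpa using hM y hy
    | succ n ih =>
      intro y hy
      set c := M * L ^ n / (n.factorial : ℝ) with hc
      have hc0 : 0 ≤ c := by positivity
      have hgt : ∀ t ∈ Ioc 0 y, ‖g t‖ ≤ c * L * t ^ n := by
        intro t ht
        have h1 : ‖u t‖ ≤ c * t ^ (n + 1) / (n + 1) := by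
          rw [hu t ht.1.le, ← hpow]
          refine intervalIntegral.norm_integral_le_of_norm_le ht.1.le (ae_of_all _ fun s hs => ?_)
            ((by fun_prop : Continuous fun s : ℝ => c * s ^ n).intervalIntegrable _ _)
          exact ih s ⟨hs.1.le, hs.2.trans (ht.2.trans hy.2)⟩
        have h2 : c * t ^ (n + 1) / (n + 1) ≤ c * t ^ (n + 1) := by
          have := ht.1
          refine div_le_self (by positivity) ?_
          have : (0 : ℝ) ≤ n := n.cast_nonneg
          linarith
        have ht0 := ht.1
        calc ‖g t‖ ≤ (2 / t + K) * (c * t ^ (n + 1)) :=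
              (hg t ht.1).trans (by gcongr; exact h1.trans h2)
          _ = c * (2 + K * t) * t ^ n := by rw [pow_succ]; field_simp
          _ ≤ c * L * t ^ n := by
            rw [hL]
            gcongr
            exact ht.2.trans hy.2
      rw [hpg y hy.1]
      refine (intervalIntegral.norm_integral_le_of_norm_le hy.1 (ae_of_all _ hgt)
        ((by fun_prop : Continuous fun s : ℝ => c * L * s ^ n).intervalIntegrable _ _)).trans_eq ?_
      rw [hpow, hc, Nat.factorial_succ]
      push_cast
      rw [pow_succ L]
      field_simp
  have hp0 : ∀ y ∈ Icc 0 x, p y = 0 := by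
    intro y hy
    have h1 : Tendsto (fun n : ℕ => M * ((L * y) ^ n / (n.factorial : ℝ))) atTop (𝓝 0) := by
      simpa using (FloorSemiring.tendsto_pow_div_factorial_atTop (L * y)).const_mul M
    refine norm_le_zero_iff.1 (ge_of_tendsto' h1 fun n => (key n y hy).trans_eq ?_)
    rw [mul_pow]; ring
  rw [hu x hx]
  refine (intervalIntegral.integral_congr fun t ht => ?_).trans intervalIntegral.integral_zero
  rw [uIcc_of_le hx] at ht
  exact hp0 t ht

/-- A continuously differentiable function with compact support, as an element of `H¹(ℝ)`. -/
noncomputable def smoothSob (g : ℝ → ℂ) (hg : ContDiff ℝ 1 g) (hs : HasCompactSupport g) : Sob :=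
  Sob.mk (hg.continuous.memLp_of_hasCompactSupport hs).toLp
    ((hg.continuous_deriv le_rfl).memLp_of_hasCompactSupport hs.deriv).toLp
    ((isWeakDeriv_deriv hg).congr (MemLp.coeFn_toLp _).symm (MemLp.coeFn_toLp _).symm)

lemma rep_smoothSob (g : ℝ → ℂ) (hg : ContDiff ℝ 1 g) (hs : HasCompactSupport g) (x : ℝ) :
    rep (smoothSob g hg hs) x = g x :=
  rep_eq_of_ae hg.continuous
    (hg.continuous.memLp_of_hasCompactSupport hs).coeFn_toLp x

lemma der_smoothSob_ae (g : ℝ → ℂ) (hg : ContDiff ℝ 1 g) (hs : HasCompactSupport g) :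
    (der (smoothSob g hg hs) : ℝ → ℂ) =ᵐ[volume] deriv g :=
  ((hg.continuous_deriv le_rfl).memLp_of_hasCompactSupport hs.deriv).coeFn_toLp

lemma inner_incl_eq (φ ψ : Sob) : inner ℂ (incl φ) (incl ψ) = ∫ x, hprod φ ψ x := by
  rw [L2.inner_def]
  refine integral_congr_ae ?_
  filter_upwards [rep_ae φ, rep_ae ψ] with x h1 h2
  rw [h1, h2, RCLike.inner_apply, hprod, starRingEnd_apply]
  ring

lemma locallyIntegrable_potential_mul {V : ℝ → ℝ} (hVm : Measurable V)
    (hV : ∀ x, x ≠ 0 → 0 ≤ V x ∧ V x ≤ 1 / |x|) {ψ : Sob} (h0 : rep ψ 0 = 0) :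
    LocallyIntegrable (fun x => (V x : ℂ) * rep ψ x) volume := by
  rw [locallyIntegrable_iff]
  intro k hk
  obtain ⟨R, hR⟩ := hk.isBounded.subset_closedBall 0
  have h1 : IntegrableOn (fun x : ℝ => ‖ψ‖ * |x| ^ (-(1 / 2) : ℝ)) (uIcc (-R) R) := by
    have := (intervalIntegrable_abs_rpow (-R) R).const_mul ‖ψ‖
    rwa [intervalIntegrable_iff'] at this
  have h2 : k ⊆ uIcc (-R) R := by
    intro x hx
    have := abs_le.1 (by simpa using hR hx : |x| ≤ R)
    rw [uIcc_of_le (this.1.trans this.2)]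
    exact this
  refine Integrable.mono' (h1.mono_set h2) ((Complex.measurable_ofReal.comp
    hVm).aestronglyMeasurable.mul (rep ψ).continuous.aestronglyMeasurable) ?_
  filter_upwards [ae_restrict_of_ae ae_ne_zero] with x hx
  have hx' : 0 < |x| := abs_pos.2 hx
  rw [norm_mul, Complex.norm_real, Real.norm_eq_abs, abs_of_nonneg (hV x hx).1]
  have e : 1 / |x| * √|x| = |x| ^ (-(1 / 2) : ℝ) := by
    rw [Real.sqrt_eq_rpow, one_div, ← Real.rpow_neg_one, ← Real.rpow_add hx']
    norm_num
  calc V x * ‖rep ψ x‖ ≤ 1 / |x| * (√|x| * ‖ψ‖) := by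
        gcongr
        · exact (hV x hx).2
        · exact norm_rep_le_sqrt h0 x
    _ = _ := by rw [← e]; ring

/-- Unique continuation from the origin: a weak solution `ψ` of `-½ψ'' - Vψ = Eψ` that vanishes at
the origin has a derivative there, and is zero if this derivative is zero. -/
lemma exists_deriv_zero {V : ℝ → ℝ} (hVm : Measurable V)
    (hV : ∀ x, x ≠ 0 → 0 ≤ V x ∧ V x ≤ 1 / |x|) {ψ : Sob} (h0 : rep ψ 0 = 0) {E : ℝ}
    (heq : ∀ φ : Sob, (1 / 2 : ℂ) * inner ℂ (der φ) (der ψ) - ∫ x, (V x : ℂ) * hprod φ ψ x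
      = E * inner ℂ (incl φ) (incl ψ)) :
    ∃ c : ℂ, HasDerivAt (rep ψ) c 0 ∧ (c = 0 → ψ = 0) := by
  set g : ℝ → ℂ := fun x => -2 * ((V x : ℂ) * rep ψ x) + -2 * E * rep ψ x with hgd
  have hgl : LocallyIntegrable g volume :=
    ((locallyIntegrable_potential_mul hVm hV h0).smul (-2 : ℂ)).add
      (((rep ψ).continuous.locallyIntegrable (μ := volume)).smul (-2 * E : ℂ))
  have hw : IsWeakDeriv (der ψ) g := by
    intro φ hφ hφs
    have hφc : ContDiff ℝ 1 fun x => (φ x : ℂ) :=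
      Complex.ofRealCLM.contDiff.comp (hφ.of_le (by exact_mod_cast le_top))
    have hφcs : HasCompactSupport fun x => (φ x : ℂ) := hφs.comp_left (g := Complex.ofReal) rfl
    set Φ := smoothSob _ hφc hφcs with hΦ
    have hd : ∀ x, deriv (fun x => (φ x : ℂ)) x = ((deriv φ x : ℝ) : ℂ) := fun x =>
      ((hφ.differentiable (by simp) x).hasDerivAt.ofReal_comp).deriv
    have e1 : inner ℂ (der Φ) (der ψ) = ∫ x, deriv φ x • der ψ x := by
      rw [L2.inner_def]
      refine integral_congr_ae ?_
      filter_upwards [der_smoothSob_ae _ hφc hφcs] with x hx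
      rw [hx, hd, RCLike.inner_apply, starRingEnd_apply, Complex.real_smul, mul_comm]
      congr 1
      exact Complex.conj_ofReal _
    have e2 : ∀ x, hprod Φ ψ x = φ x * rep ψ x := fun x => by
      rw [hprod, hΦ, rep_smoothSob]
      congr 1
      exact Complex.conj_ofReal _
    have e3 : ∫ x, φ x • g x = -2 * (∫ x, (V x : ℂ) * hprod Φ ψ x)
        + -2 * E * ∫ x, hprod Φ ψ x := by
      rw [← integral_const_mul, ← integral_const_mul, ← integral_add
        ((integrable_potential_mul hVm hV Φ h0).const_mul _) ((integrable_hprod Φ ψ).const_mul _)]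
      congr 1; ext x
      simp only [e2, hgd, Complex.real_smul]
      ring
    have := heq Φ
    rw [inner_incl_eq, e1] at this
    rw [e3]
    linear_combination 2 * this
  obtain ⟨c, hc⟩ := hw.exists_ae_eq (L2.locallyIntegrable _) hgl
  set p : ℝ → ℂ := fun x => c + ∫ t in (0 : ℝ)..x, g t with hp
  have hpc : Continuous p := continuous_const.add (intervalIntegral.continuous_primitive
    (fun x y => (hgl.integrableOn_isCompact isCompact_uIcc).intervalIntegrable) 0)
  have hrep : ∀ x, rep ψ x = ∫ t in (0 : ℝ)..x, p t := fun x => by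
    rw [← sub_zero (rep ψ x), ← h0, rep_sub_rep]
    refine intervalIntegral.integral_congr_ae ?_
    filter_upwards [hc] with x hx _ using hx
  have hd : HasDerivAt (rep ψ) c 0 := by
    have h1 := intervalIntegral.integral_hasDerivAt_right (hpc.intervalIntegrable 0 0)
      (hpc.stronglyMeasurableAtFilter _ _) hpc.continuousAt
    have h2 : p 0 = c := by simp [hp]
    rw [h2] at h1
    exact h1.congr_of_eventuallyEq (Eventually.of_forall hrep)
  refine ⟨c, hd, fun hc0 => eq_of_rep_eq fun x => ?_⟩
  have hp0 : ∀ x, p x = ∫ t in (0 : ℝ)..x, g t := fun x => by simp [hp, hc0]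
  have hgb : ∀ x, x ≠ 0 → ‖g x‖ ≤ (2 / |x| + 2 * |E|) * ‖rep ψ x‖ := by
    intro x hx
    have hVx := hV x hx
    calc ‖g x‖ ≤ ‖-2 * ((V x : ℂ) * rep ψ x)‖ + ‖-2 * E * rep ψ x‖ := norm_add_le _ _
      _ = (2 * V x + 2 * |E|) * ‖rep ψ x‖ := by
        simp only [norm_mul, norm_neg, Complex.norm_real, Real.norm_eq_abs, abs_of_nonneg hVx.1,
          Complex.norm_ofNat]
        ring
      _ ≤ (2 * (1 / |x|) + 2 * |E|) * ‖rep ψ x‖ := by gcongr; exact hVx.2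
      _ = _ := by ring
  rw [rep_zero, ContinuousMap.zero_apply]
  rcases le_total 0 x with hx | hx
  · refine eq_zero_of_volterra (K := 2 * |E|) (by positivity) hpc (fun y _ => hrep y)
      (fun y _ => hp0 y) (fun y hy => ?_) hx
    have := hgb y hy.ne'
    rwa [abs_of_pos hy] at this
  · -- the left half line is mapped to the right one by reflection
    have := eq_zero_of_volterra (u := fun y => rep ψ (-y)) (p := fun y => -p (-y))
      (g := fun y => g (-y)) (K := 2 * |E|) (by positivity) (by fun_prop) (fun y _ => ?_)
      (fun y _ => ?_) (fun y hy => ?_) (neg_nonneg.2 hx)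
    · simpa using this
    · rw [hrep, intervalIntegral.integral_neg, intervalIntegral.integral_comp_neg (fun t => p t),
        neg_zero, ← intervalIntegral.integral_symm]
    · rw [hp0, intervalIntegral.integral_comp_neg (fun t => g t), neg_zero,
        ← intervalIntegral.integral_symm]
    · have := hgb (-y) (neg_ne_zero.2 hy.ne')
      rwa [abs_neg, abs_of_pos hy] at this

/-- The sign function. -/
noncomputable def sgn (x : ℝ) : ℂ := if 0 < x then 1 else -1

lemma norm_sgn (x : ℝ) : ‖sgn x‖ = 1 := by unfold sgn; split_ifs <;> simp

lemma measurable_sgn : Measurable sgn :=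
  Measurable.ite measurableSet_Ioi measurable_const measurable_const

lemma memLp_sgn_mul (f : L2) : MemLp (fun x => sgn x * f x) 2 volume := by
  refine (Lp.memLp f).of_le (measurable_sgn.aestronglyMeasurable.mul (Lp.aestronglyMeasurable f))
    (ae_of_all _ fun x => ?_)
  rw [norm_mul, norm_sgn, one_mul]

/-- Functions in `H¹(ℝ)` vanishing at the origin may be multiplied by the sign function. -/
lemma exists_sgn_mul {ψ : Sob} (h0 : rep ψ 0 = 0) :
    ∃ χ : Sob, (∀ x, rep χ x = sgn x * rep ψ x) ∧ ∀ᵐ x, der χ x = sgn x * der ψ x := by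
  have hl : LocallyIntegrable (fun x => sgn x * der ψ x) volume :=
    (memLp_sgn_mul (der ψ)).locallyIntegrable one_le_two
  have hG : ∀ x, ∫ t in (0 : ℝ)..x, sgn t * der ψ t = sgn x * rep ψ x := by
    intro x
    have h1 : rep ψ x = ∫ t in (0 : ℝ)..x, der ψ t := by rw [← rep_sub_rep, h0, sub_zero]
    rw [h1, ← intervalIntegral.integral_const_mul]
    refine intervalIntegral.integral_congr_ae (ae_of_all _ fun t ht => ?_)
    congr 1
    rcases le_or_gt x 0 with hx | hx
    · rw [uIoc_of_ge hx] at ht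
      rw [sgn, sgn, if_neg (not_lt.2 ht.2), if_neg (not_lt.2 hx)]
    · rw [uIoc_of_le hx.le] at ht
      rw [sgn, sgn, if_pos ht.1, if_pos hx]
  have hw := isWeakDeriv_primitive hl
  simp only [hG] at hw
  have hm : (fun x => sgn x * rep ψ x) =ᵐ[volume] (memLp_sgn_mul (incl ψ)).toLp := by
    filter_upwards [(memLp_sgn_mul (incl ψ)).coeFn_toLp, rep_ae ψ] with x h1 h2
    rw [h1, h2]
  refine ⟨Sob.mk _ _ (hw.congr hm (memLp_sgn_mul (der ψ)).coeFn_toLp.symm), ?_,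
    (memLp_sgn_mul (der ψ)).coeFn_toLp⟩
  refine rep_eq_of_ae ?_ hm.symm
  have : (fun x => sgn x * rep ψ x) = fun x => ∫ t in (0 : ℝ)..x, sgn t * der ψ t :=
    funext fun x => (hG x).symm
  rw [this]
  exact intervalIntegral.continuous_primitive
    (fun x y => (hl.integrableOn_isCompact isCompact_uIcc).intervalIntegrable) 0

end Nanotube

/-! ### Limits of eigenfunctions -/

namespace Nanotube

open ContinuousLinearMap

/-- The vector representing the evaluation at the origin. -/
noncomputable def dirac : Sob := adjoint (evalAt 0) 1

lemma inner_dirac (φ : Sob) : inner ℂ φ dirac = star (rep φ 0) := by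
  rw [dirac, adjoint_inner_right]
  simp

lemma rep_dirac_zero : rep dirac 0 ≠ 0 := by
  intro h
  have h1 : dirac = 0 := by
    rw [← inner_self_eq_zero (𝕜 := ℂ), inner_dirac, h, star_zero]
  obtain ⟨f, -, hf, hf', -, hf1⟩ := exists_contDiff_tsupport_subset (E := ℝ) (n := 1)
    (isOpen_univ.mem_nhds (mem_univ (0 : ℝ)))
  have hc : ContDiff ℝ 1 fun x => (f x : ℂ) := Complex.ofRealCLM.contDiff.comp hf'
  have h2 := inner_dirac (smoothSob (fun x => (f x : ℂ)) hc (hf.comp_left (g := Complex.ofReal) rfl))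
  rw [h1, inner_zero_right, rep_smoothSob, hf1] at h2
  simp at h2

lemma formOp_eq_add (K V : L2) (α : ℝ) (ψ : Sob) :
    formOp K V α ψ = formOp K V 0 ψ + (α * rep ψ 0 : ℂ) • dirac := by
  refine ext_inner_left ℂ fun φ => ?_
  rw [inner_add_right, inner_smul_right, inner_dirac, inner_formOp, inner_formOp]
  push_cast; ring

lemma pencil_formOp_eq_add (K V : L2) (α E : ℝ) (ψ : Sob) :
    pencil incl (formOp K V α) E ψ
      = pencil incl (formOp K V 0) E ψ + (α * rep ψ 0 : ℂ) • dirac := by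
  rw [pencil_apply, pencil_apply, formOp_eq_add]; abel

/-- The form of the Coulomb operator without the point interaction. -/
noncomputable def coulombOp : Sob →L[ℂ] Sob := formOp KC VC 0

lemma isSelfAdjoint_coulombOp : IsSelfAdjoint coulombOp := isSelfAdjoint_formOp KC star_VC 0

lemma pencil_coulombOp_of_eigen {t e : ℝ} {w : Sob →L[ℂ] Sob} {ψ : Sob}
    (h : pencil incl (formOp KC VC t + w) e ψ = 0) (E : ℝ) :
    pencil incl coulombOp E ψ = -(t * rep ψ 0 : ℂ) • dirac - w ψ
      + ((e - E : ℝ) : ℂ) • (adjoint incl).comp incl ψ := by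
  rw [pencil_apply, add_apply, formOp_eq_add] at h
  have h2 : pencil incl coulombOp E ψ
      = (formOp KC VC 0 ψ + (t * rep ψ 0 : ℂ) • dirac + w ψ - (e : ℂ) • adjoint incl (incl ψ))
        + (-(t * rep ψ 0 : ℂ) • dirac - w ψ + ((e - E : ℝ) : ℂ) • (adjoint incl).comp incl ψ) := by
    rw [pencil_apply, coulombOp, comp_apply, Complex.ofReal_sub, sub_smul, neg_smul]
    abel
  rw [h2, h, zero_add]

/-- Let `ψₙ` be normalised eigenfunctions, with energies converging to a negative limit `E`, of
perturbations of the Coulomb operator with point interactions of strength `tₙ → -∞`. A subsequence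
converges in `H¹(ℝ)` to a function that vanishes at the origin and solves the eigenvalue equation up
to a multiple `β` of the Dirac distribution, where `β` is the limit of `tₙ ψₙ(0)`. -/
lemma exists_limit_eigenfunction {t e : ℕ → ℝ} {w : ℕ → Sob →L[ℂ] Sob} {ψ : ℕ → Sob} {E : ℝ}
    (ht : Tendsto t atTop atBot) (he : Tendsto e atTop (𝓝 E)) (hE : E < 0)
    (hw : Tendsto (fun n => ‖w n‖) atTop (𝓝 0)) (hψ : ∀ n, ‖ψ n‖ = 1)
    (h : ∀ n, pencil incl (formOp KC VC (t n) + w n) (e n) (ψ n) = 0) :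
    ∃ (φ : ℕ → ℕ) (χ : Sob) (β : ℂ), StrictMono φ ∧ Tendsto (ψ ∘ φ) atTop (𝓝 χ) ∧ ‖χ‖ = 1 ∧
      rep χ 0 = 0 ∧ Tendsto (fun n => (t (φ n) : ℂ) * rep (ψ (φ n)) 0) atTop (𝓝 β) ∧
      pencil incl coulombOp E χ = -β • dirac := by
  set b : ℕ → ℂ := fun n => (t n : ℂ) * rep (ψ n) 0 with hb
  set J : Sob →L[ℂ] Sob := (adjoint incl).comp incl with hJ
  have eq1 : ∀ n, pencil incl coulombOp E (ψ n)
      = -b n • dirac - w n (ψ n) + ((e n - E : ℝ) : ℂ) • J (ψ n) := fun n =>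
    pencil_coulombOp_of_eigen (h n) E
  have hwψ : Tendsto (fun n => w n (ψ n)) atTop (𝓝 0) := by
    refine squeeze_zero_norm (fun n => ?_) hw
    have := (w n).le_opNorm (ψ n)
    rwa [hψ, mul_one] at this
  have heJ : Tendsto (fun n => ((e n - E : ℝ) : ℂ) • J (ψ n)) atTop (𝓝 0) := by
    have h1 : Tendsto (fun n => |e n - E| * ‖J‖) atTop (𝓝 0) := by
      have h3 : Tendsto (fun n => e n - E) atTop (𝓝 0) := by simpa using he.sub_const E
      simpa using h3.abs.mul_const ‖J‖
    refine squeeze_zero_norm (fun n => ?_) h1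
    rw [norm_smul, Complex.norm_real, Real.norm_eq_abs]
    have := J.le_opNorm (ψ n)
    rw [hψ, mul_one] at this
    gcongr
  -- the boundary terms are bounded, by pairing the equation with a fixed vector
  have hrest : Tendsto (fun n => -w n (ψ n) + ((e n - E : ℝ) : ℂ) • J (ψ n)) atTop (𝓝 0) := by
    simpa using hwψ.neg.add heJ
  have hbb : ∃ R, ∀ n, ‖b n‖ ≤ R := by
    obtain ⟨R, hR⟩ := hrest.norm.bddAbove_range
    refine ⟨(‖pencil incl coulombOp E‖ + R) / ‖dirac‖, fun n => ?_⟩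
    have hd : 0 < ‖dirac‖ := norm_pos_iff.2 fun h0 => rep_dirac_zero (by rw [h0, rep_zero]; rfl)
    rw [le_div_iff₀ hd, ← norm_smul]
    have e2 : b n • dirac = -pencil incl coulombOp E (ψ n)
        + (-w n (ψ n) + ((e n - E : ℝ) : ℂ) • J (ψ n)) := by
      rw [eq1, neg_smul]; abel
    rw [e2]
    refine (norm_add_le _ _).trans (add_le_add ?_ (hR (mem_range_self n)))
    rw [norm_neg]
    have := (pencil incl coulombOp E).le_opNorm (ψ n)
    rwa [hψ, mul_one] at this
  obtain ⟨R, hR⟩ := hbb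
  -- the interaction is compact and the free part invertible, so the `ψₙ` converge with their images
  have hc := (isCompact_potOp KC VC 0).isCompact_closure_image_closedBall 1
  obtain ⟨⟨β, y⟩, -, φ, hφ, hlim⟩ := ((isCompact_closedBall (0 : ℂ) R).prod hc).tendsto_subseq
    (x := fun n => (b n, potOp KC VC 0 (ψ n))) fun n => ⟨by simpa using hR n,
      subset_closure ⟨ψ n, by simp [hψ], rfl⟩⟩
  have hβ : Tendsto (fun n => b (φ n)) atTop (𝓝 β) := (continuous_fst.tendsto _).comp hlim
  have hy : Tendsto (fun n => potOp KC VC 0 (ψ (φ n))) atTop (𝓝 y) :=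
    (continuous_snd.tendsto _).comp hlim
  have hφt := hφ.tendsto_atTop
  have hpen : Tendsto (fun n => pencil incl coulombOp E (ψ (φ n))) atTop (𝓝 (-β • dirac)) := by
    have : Tendsto (fun n => -b (φ n) • dirac - w (φ n) (ψ (φ n))
        + ((e (φ n) - E : ℝ) : ℂ) • J (ψ (φ n))) atTop (𝓝 (-β • dirac - 0 + 0)) :=
      ((hβ.neg.smul_const dirac).sub (hwψ.comp hφt)).add (heJ.comp hφt)
    rw [sub_zero, add_zero] at this
    refine this.congr fun n => (eq1 _).symm
  have hfree : Tendsto (fun n => freeOp E (ψ (φ n))) atTop (𝓝 (-β • dirac + y)) := by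
    refine (hpen.add hy).congr fun n => ?_
    rw [coulombOp, pencil_formOp, sub_apply, sub_add_cancel]
  have hu : IsUnit (freeOp E) := isUnit_of_coercive (γ := min (1 / 2) (-E)) (by
    rw [lt_min_iff]; constructor <;> linarith) fun ψ => coercive_freeOp ψ
  set χ := Ring.inverse (freeOp E) (-β • dirac + y) with hχ
  have hψχ : Tendsto (ψ ∘ φ) atTop (𝓝 χ) := by
    refine (((Ring.inverse (freeOp E)).continuous.tendsto _).comp hfree).congr fun n => ?_
    exact inverse_apply_self hu _
  refine ⟨φ, χ, β, hφ, hψχ, ?_, ?_, hβ, ?_⟩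
  · refine tendsto_nhds_unique hψχ.norm ?_
    simp [hψ]
  · have h1 : Tendsto (fun n => rep (ψ (φ n)) 0) atTop (𝓝 (rep χ 0)) :=
      ((evalAt 0).continuous.tendsto _).comp hψχ
    have h2 : Tendsto (fun n => ((t (φ n) : ℂ))⁻¹ * b (φ n)) atTop (𝓝 (0 * β)) := by
      refine Tendsto.mul ?_ hβ
      have h3 := (tendsto_inv_atBot_zero.comp (ht.comp hφt))
      have h4 := (Complex.continuous_ofReal.tendsto 0).comp h3
      rw [Complex.ofReal_zero] at h4
      refine h4.congr fun n => ?_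
      simp
    rw [zero_mul] at h2
    refine tendsto_nhds_unique h1 (h2.congr' ?_)
    filter_upwards [(ht.comp hφt).eventually_lt_atBot 0] with n hn
    have : (t (φ n) : ℂ) ≠ 0 := by exact_mod_cast ne_of_lt hn
    rw [hb]
    field_simp
  · exact tendsto_nhds_unique (((pencil incl coulombOp E).continuous.tendsto _).comp hψχ) hpen

lemma exists_deriv_zero_coulomb {ψ : Sob} (h0 : rep ψ 0 = 0) {E : ℝ}
    (h : pencil incl coulombOp E ψ = 0) : ∃ c : ℂ, HasDerivAt (rep ψ) c 0 ∧ (c = 0 → ψ = 0) := by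
  refine exists_deriv_zero measurable_coulomb (fun x _ => ⟨by positivity, le_rfl⟩) h0 (E := E)
    fun φ => ?_
  rw [← inner_formOp_of_rep_zero 0 φ h0, ← sub_eq_zero, ← inner_pencil]
  change inner ℂ φ (pencil incl coulombOp E ψ) = 0
  rw [h, inner_zero_right]

lemma deriv_zero_of_even {ψ : Sob} (hψ : ψ ∈ paritySob 1) {c : ℂ} (hd : HasDerivAt (rep ψ) c 0) :
    c = 0 := by
  have h1 : (fun x => rep ψ (-x)) = rep ψ := funext fun x => by
    have := mem_paritySob_iff_rep.1 hψ x
    simpa using this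
  have hd' : HasDerivAt (rep ψ) c (-0) := by simpa using hd
  have h2 := hd'.scomp (0 : ℝ) (hasDerivAt_neg (0 : ℝ))
  have h3 : (rep ψ : ℝ → ℂ) ∘ Neg.neg = rep ψ := h1
  rw [h3] at h2
  have := hd.unique h2
  simp only [neg_smul, one_smul] at this
  exact self_eq_neg.1 this

/-- An even solution of the Coulomb equation that vanishes at the origin is zero. -/
lemma eq_zero_of_even {ψ : Sob} (hψ : ψ ∈ paritySob 1) (h0 : rep ψ 0 = 0) {E : ℝ}
    (h : pencil incl coulombOp E ψ = 0) : ψ = 0 := by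
  obtain ⟨c, hd, hc⟩ := exists_deriv_zero_coulomb h0 h
  exact hc (deriv_zero_of_even hψ hd)

lemma commRefl_coulombOp : CommRefl coulombOp := commRefl_formOp KC_odd VC_even

lemma rep_zero_of_odd {ψ : Sob} (hψ : ψ ∈ paritySob (-1)) : rep ψ 0 = 0 := by
  have := mem_paritySob_iff_rep.1 hψ 0
  rw [neg_zero] at this
  simp only [Units.val_neg, Units.val_one, Int.cast_neg, Int.cast_one, neg_mul, one_mul] at this
  exact self_eq_neg.1 this

/-- On odd functions the Dirac distribution plays no role. -/
lemma coeff_zero_of_odd {ψ : Sob} (hψ : ψ ∈ paritySob (-1)) {E : ℝ} {β : ℂ}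
    (h : pencil incl coulombOp E ψ = -β • dirac) : β = 0 := by
  have h1 : pencil incl coulombOp E ψ ∈ paritySob (-1) := by
    rw [mem_paritySob_iff, ← commRefl_pencil commRefl_coulombOp, mem_paritySob_iff.1 hψ, map_smul]
  rw [h] at h1
  have h2 := rep_zero_of_odd h1
  rw [rep_smul, ContinuousMap.smul_apply, smul_eq_mul, mul_eq_zero] at h2
  rcases h2 with h2 | h2
  · exact neg_eq_zero.1 h2
  · exact absurd h2 rep_dirac_zero

lemma incl_ne_zero {ψ : Sob} (h : ψ ≠ 0) : incl ψ ≠ 0 := fun h0 =>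
  h (incl_injective (by rw [h0, map_zero]))

/-- Suppose that a combination of two orthogonal vectors, the second one non-zero, vanishes as soon as
the corresponding combination of boundary values `β`, `β'` does. Then the first vector is zero. -/
lemma eq_zero_of_combination {ψ χ : Sob} {β β' : ℂ}
    (ho : inner ℂ (incl ψ) (incl χ) = 0) (hχ : χ ≠ 0)
    (h : ∀ x y : ℂ, x * β + y * β' = 0 → x • ψ + y • χ = 0) : ψ = 0 := by
  by_contra hψ
  have h1 := h β' (-β) (by ring)
  have h2 : inner ℂ (incl ψ) (incl (β' • ψ + -β • χ)) = 0 := by rw [h1, map_zero, inner_zero_right]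
  rw [map_add, map_smul, map_smul, inner_add_right, inner_smul_right, inner_smul_right, ho, mul_zero,
    add_zero, mul_eq_zero, inner_self_eq_zero] at h2
  have hβ' : β' = 0 := h2.resolve_right (incl_ne_zero hψ)
  have h3 := h 0 1 (by rw [hβ']; ring)
  rw [zero_smul, one_smul, zero_add] at h3
  exact hχ h3

end Nanotube

/-! ### Eigenvalues near a fixed energy -/

namespace Nanotube

open ContinuousLinearMap

/-- `E` is an eigenvalue of parity `s` of the operator generated by the form of `A`. -/
def SecEig (A : Sob →L[ℂ] Sob) (s : ℤˣ) (E : ℝ) : Prop :=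
  ∃ u ∈ paritySob s, u ≠ 0 ∧ pencil incl A E u = 0

/-- The operator of the form of `H_C`. -/
noncomputable def opC (r : ℝ) : Sob →L[ℂ] Sob := formOp KC VC (2 * Real.log r)

/-- The operator of the form of the effective operator. -/
noncomputable def opE (r : ℝ) : Sob →L[ℂ] Sob := formOp 0 (VE r) 0

lemma exists_unit_eigen {A : Sob →L[ℂ] Sob} {s : ℤˣ} {E : ℝ} {u : Sob} (hu : u ∈ paritySob s)
    (h0 : u ≠ 0) (h : pencil incl A E u = 0) :
    ((‖u‖⁻¹ : ℝ) : ℂ) • u ∈ paritySob s ∧ ‖((‖u‖⁻¹ : ℝ) : ℂ) • u‖ = 1 ∧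
      pencil incl A E (((‖u‖⁻¹ : ℝ) : ℂ) • u) = 0 := by
  refine ⟨Submodule.smul_mem _ _ hu, ?_, by rw [map_smul, h, smul_zero]⟩
  rw [norm_smul, Complex.norm_real, norm_inv, norm_norm, inv_mul_cancel₀ (norm_ne_zero_iff.2 h0)]

lemma SecEig.exists_unit {A : Sob →L[ℂ] Sob} {s : ℤˣ} {E : ℝ} (h : SecEig A s E) :
    ∃ u ∈ paritySob s, ‖u‖ = 1 ∧ pencil incl A E u = 0 := by
  obtain ⟨u, hu, h0, h⟩ := h
  obtain ⟨h1, h2, h3⟩ := exists_unit_eigen hu h0 h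
  exact ⟨_, h1, h2, h3⟩

lemma inner_incl_eq_zero_of_ne {A : Sob →L[ℂ] Sob} (hA : IsSelfAdjoint A) {E E' : ℝ} {u v : Sob}
    (hu : pencil incl A E u = 0) (hv : pencil incl A E' v = 0) (hne : E ≠ E') :
    inner ℂ (incl u) (incl v) = 0 := by
  have h1 := inner_pencil incl A E' u v
  rw [hv, inner_zero_right] at h1
  have h2 := inner_pencil incl A E v u
  rw [hu, inner_zero_right] at h2
  have h3 : inner ℂ v (A u) = (starRingEnd ℂ) (inner ℂ u (A v)) := by
    rw [inner_conj_symm]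
    exact ((isSelfAdjoint_iff_isSymmetric.1 hA) v u).symm
  rw [h3, ← inner_conj_symm (incl v)] at h2
  have h4 := congrArg (starRingEnd ℂ) h2
  simp only [map_sub, map_mul, map_zero, RingHomCompTriple.comp_apply, RingHom.id_apply,
    Complex.conj_ofReal] at h4
  have h5 : ((E : ℂ) - E') * inner ℂ (incl u) (incl v) = 0 := by linear_combination h4 - h1
  rcases mul_eq_zero.1 h5 with h6 | h6
  · exact absurd (by exact_mod_cast sub_eq_zero.1 h6) hne
  · exact h6

lemma tendsto_two_log {r : ℕ → ℝ} (hr : Tendsto r atTop (𝓝[>] 0)) :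
    Tendsto (fun n => 2 * Real.log (r n)) atTop atBot :=
  (Real.tendsto_log_nhdsGT_zero.comp hr).const_mul_atBot two_pos

/-- Even eigenvalues keep a distance of order `1 / |log r|` from any fixed energy `a < 0`: otherwise
the limiting eigenfunction would be an even solution vanishing at the origin without a Dirac term. -/
lemma exists_no_even_near {w : ℝ → Sob →L[ℂ] Sob}
    (hw : Tendsto (fun r => ‖w r‖ * |Real.log r|) (𝓝[>] 0) (𝓝 0))
    (hw0 : Tendsto (fun r => ‖w r‖) (𝓝[>] 0) (𝓝 0)) {a : ℝ} (ha : a < 0) :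
    ∃ c : ℝ, 0 < c ∧ ∀ᶠ r in 𝓝[>] 0, ∀ E, |E - a| * |Real.log r| ≤ c →
      ¬ SecEig (opC r + w r) 1 E := by
  by_contra hcon
  push Not at hcon
  have hl1 : ∀ᶠ r : ℝ in 𝓝[>] 0, Real.log r ≤ -1 :=
    Real.tendsto_log_nhdsGT_zero.eventually_le_atBot (-1)
  have hex : ∀ n : ℕ, ∃ r E : ℝ, ∃ u ∈ paritySob 1, 0 < r ∧ r < 1 / ((n : ℝ) + 1) ∧
      Real.log r ≤ -1 ∧ |E - a| * |Real.log r| ≤ 1 / ((n : ℝ) + 1) ∧ ‖u‖ = 1 ∧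
      pencil incl (opC r + w r) E u = 0 := by
    intro n
    have hn : (0 : ℝ) < 1 / ((n : ℝ) + 1) := by positivity
    have hm : ∀ᶠ r : ℝ in 𝓝[>] 0, r < 1 / ((n : ℝ) + 1) := nhdsWithin_le_nhds (Iio_mem_nhds hn)
    obtain ⟨r, ⟨E, h1, h2⟩, h3, h4, h5⟩ := ((hcon _ hn).and_eventually
      (hm.and (hl1.and self_mem_nhdsWithin))).exists
    obtain ⟨u, hu, hu1, hu2⟩ := h2.exists_unit
    exact ⟨r, E, u, hu, h5, h3, h4, h1, hu1, hu2⟩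
  choose r e ψ hψp hr0 hrn hrl hea hψ1 hψ using hex
  have hn0 : Tendsto (fun n : ℕ => 1 / ((n : ℝ) + 1)) atTop (𝓝 0) :=
    tendsto_one_div_add_atTop_nhds_zero_nat
  have hr : Tendsto r atTop (𝓝[>] 0) := tendsto_nhdsWithin_iff.2
    ⟨squeeze_zero (fun n => (hr0 n).le) (fun n => (hrn n).le) hn0, Eventually.of_forall hr0⟩
  have hel : Tendsto (fun n => |e n - a| * |Real.log (r n)|) atTop (𝓝 0) :=
    squeeze_zero (fun n => by positivity) hea hn0
  have he : Tendsto e atTop (𝓝 a) := by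
    rw [tendsto_iff_norm_sub_tendsto_zero]
    refine squeeze_zero (fun n => norm_nonneg _) (fun n => ?_) hel
    rw [Real.norm_eq_abs]
    refine le_mul_of_one_le_right (abs_nonneg _) ?_
    rw [abs_of_nonpos (by linarith [hrl n])]
    linarith [hrl n]
  obtain ⟨φ, χ, β, hφ, hlim, hχ1, hχ0, hβ, hχ⟩ :=
    exists_limit_eigenfunction (tendsto_two_log hr) he ha (hw0.comp hr) hψ1 hψ
  have hχp : χ ∈ paritySob 1 := (isClosed_paritySob 1).mem_of_tendsto hlim
    (Eventually.of_forall fun n => hψp _)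
  -- Pairing the equation of `ψₙ` with the limit, and multiplying by the coupling constant, expresses
  -- `‖β‖²` as a limit of quantities that vanish.
  have key : ∀ n, -(starRingEnd ℂ) β * (((2 * Real.log (r n) : ℝ) : ℂ) * rep (ψ n) 0)
      = ((2 * Real.log (r n) : ℝ) : ℂ) * (-inner ℂ χ (w (r n) (ψ n))
        + ((e n - a : ℝ) : ℂ) * inner ℂ (incl χ) (incl (ψ n))) := by
    intro n
    have h1 : inner ℂ χ (pencil incl coulombOp a (ψ n)) = -(starRingEnd ℂ) β * rep (ψ n) 0 := by
      have h2 := (isSelfAdjoint_iff_isSymmetric.1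
        (isSelfAdjoint_pencil incl isSelfAdjoint_coulombOp a)) χ (ψ n)
      have h3 : inner ℂ χ (pencil incl coulombOp a (ψ n))
        = inner ℂ (pencil incl coulombOp a χ) (ψ n) := h2.symm
      rw [h3, hχ, inner_smul_left, ← inner_conj_symm, inner_dirac, ← starRingEnd_apply,
        RingHomCompTriple.comp_apply, RingHom.id_apply, map_neg]
    rw [pencil_coulombOp_of_eigen (hψ n) a, inner_add_right, inner_sub_right, inner_smul_right,
      inner_smul_right, inner_dirac, hχ0, star_zero, mul_zero, zero_sub, comp_apply,
      adjoint_inner_right] at h1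
    rw [h1]; ring
  have hz : Tendsto (fun n => ((2 * Real.log (r n) : ℝ) : ℂ) * (-inner ℂ χ (w (r n) (ψ n))
        + ((e n - a : ℝ) : ℂ) * inner ℂ (incl χ) (incl (ψ n)))) atTop (𝓝 0) := by
    have hb : Tendsto (fun n => 2 * (‖w (r n)‖ * |Real.log (r n)|)
        + 2 * (|e n - a| * |Real.log (r n)|)) atTop (𝓝 0) := by
      simpa using ((hw.comp hr).const_mul 2).add (hel.const_mul 2)
    refine squeeze_zero_norm (fun n => ?_) hb
    have n1 : ‖inner ℂ χ (w (r n) (ψ n))‖ ≤ ‖w (r n)‖ := by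
      have := (norm_inner_le_norm (𝕜 := ℂ) χ (w (r n) (ψ n))).trans
        (mul_le_mul_of_nonneg_left ((w (r n)).le_opNorm (ψ n)) (norm_nonneg _))
      rwa [hχ1, hψ1, one_mul, mul_one] at this
    have n2 : ‖inner ℂ (incl χ) (incl (ψ n))‖ ≤ 1 := by
      calc ‖inner ℂ (incl χ) (incl (ψ n))‖ ≤ ‖incl χ‖ * ‖incl (ψ n)‖ := norm_inner_le_norm _ _
        _ ≤ ‖χ‖ * ‖ψ n‖ := by gcongr <;> exact norm_incl_apply_le _
        _ = 1 := by rw [hχ1, hψ1, one_mul]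
    rw [norm_mul, Complex.norm_real, Real.norm_eq_abs, abs_mul, abs_two]
    calc 2 * |Real.log (r n)| * ‖-inner ℂ χ (w (r n) (ψ n))
          + ((e n - a : ℝ) : ℂ) * inner ℂ (incl χ) (incl (ψ n))‖
        ≤ 2 * |Real.log (r n)| * (‖w (r n)‖ + |e n - a| * 1) := by
          gcongr
          refine (norm_add_le _ _).trans (add_le_add (by rwa [norm_neg]) ?_)
          rw [norm_mul, Complex.norm_real, Real.norm_eq_abs]
          gcongr
      _ = _ := by ring
  have hββ : -(starRingEnd ℂ) β * β = 0 := by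
    refine tendsto_nhds_unique (hβ.const_mul (-(starRingEnd ℂ) β)) ((hz.comp hφ.tendsto_atTop).congr
      fun n => ?_)
    exact (key (φ n)).symm
  have hβ0 : β = 0 := by
    rcases mul_eq_zero.1 hββ with h | h
    · simpa using h
    · exact h
  rw [hβ0, neg_zero, zero_smul] at hχ
  have := eq_zero_of_even hχp hχ0 hχ
  rw [this, norm_zero] at hχ1
  exact zero_ne_one hχ1

/-- In the limit there is at most one eigenvalue of each parity near a given energy, counted with
multiplicity. -/
lemma false_of_pair {s : ℤˣ} {t e e' : ℕ → ℝ} {w : ℕ → Sob →L[ℂ] Sob} {u v : ℕ → Sob} {E : ℝ}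
    (ht : Tendsto t atTop atBot) (he : Tendsto e atTop (𝓝 E)) (he' : Tendsto e' atTop (𝓝 E))
    (hE : E < 0) (hw : Tendsto (fun n => ‖w n‖) atTop (𝓝 0)) (hu : ∀ n, u n ∈ paritySob s)
    (hv : ∀ n, v n ∈ paritySob s) (hu1 : ∀ n, ‖u n‖ = 1) (hv1 : ∀ n, ‖v n‖ = 1)
    (ho : ∀ n, inner ℂ (incl (u n)) (incl (v n)) = 0)
    (h : ∀ n, pencil incl (formOp KC VC (t n) + w n) (e n) (u n) = 0)
    (h' : ∀ n, pencil incl (formOp KC VC (t n) + w n) (e' n) (v n) = 0) : False := by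
  obtain ⟨φ, ψ, β, hφ, hψl, hψ1, hψ0, -, hψ⟩ := exists_limit_eigenfunction ht he hE hw hu1 h
  have hφt := hφ.tendsto_atTop
  obtain ⟨φ', χ, β', hφ', hχl, hχ1, hχ0, -, hχ⟩ := exists_limit_eigenfunction (ht.comp hφt)
    (he'.comp hφt) hE (hw.comp hφt) (fun n => hv1 (φ n)) (fun n => h' (φ n))
  have hψp : ψ ∈ paritySob s := (isClosed_paritySob s).mem_of_tendsto hψl
    (Eventually.of_forall fun n => hu _)
  have hχp : χ ∈ paritySob s := (isClosed_paritySob s).mem_of_tendsto hχl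
    (Eventually.of_forall fun n => hv _)
  have ho' : inner ℂ (incl ψ) (incl χ) = 0 := by
    have h1 := ((incl.continuous.tendsto _).comp (hψl.comp hφ'.tendsto_atTop)).inner (𝕜 := ℂ)
      ((incl.continuous.tendsto _).comp hχl)
    exact tendsto_nhds_unique h1 (tendsto_const_nhds.congr fun n => (ho _).symm)
  have hχne : χ ≠ 0 := by rintro rfl; simp at hχ1
  have hψz : ψ = 0 := by
    have hr0 : ∀ x y : ℂ, rep (x • ψ + y • χ) 0 = 0 := fun x y => by
      simp [rep_add, rep_smul, hψ0, hχ0]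
    have hpen : ∀ x y : ℂ, pencil incl coulombOp E (x • ψ + y • χ)
        = -(x * β + y * β') • dirac := fun x y => by
      rw [map_add, map_smul, map_smul, hψ, hχ]
      simp only [smul_smul, ← add_smul]
      congr 1; ring
    rcases Int.units_eq_one_or s with rfl | rfl
    · -- even functions: a combination without Dirac term
      refine eq_zero_of_combination ho' hχne (β := β) (β' := β') fun x y hxy => ?_
      refine eq_zero_of_even (E := E) (Submodule.add_mem _ (Submodule.smul_mem _ _ hψp)
        (Submodule.smul_mem _ _ hχp)) (hr0 x y) ?_
      rw [hpen, hxy, neg_zero, zero_smul]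
    · -- odd functions: a combination whose derivative vanishes at the origin
      rw [coeff_zero_of_odd hψp hψ, coeff_zero_of_odd hχp hχ] at hpen
      obtain ⟨c, hc, -⟩ := exists_deriv_zero_coulomb hψ0 (E := E) (by simpa using hpen 1 0)
      obtain ⟨c', hc', -⟩ := exists_deriv_zero_coulomb hχ0 (E := E) (by simpa using hpen 0 1)
      refine eq_zero_of_combination ho' hχne (β := c) (β' := c') fun x y hxy => ?_
      obtain ⟨c'', hd, hz⟩ := exists_deriv_zero_coulomb (hr0 x y) (E := E) (by simpa using hpen x y)
      refine hz (hd.unique ?_)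
      rw [← hxy]
      have := (hc.const_mul x).add (hc'.const_mul y)
      refine this.congr_of_eventuallyEq (Eventually.of_forall fun z => ?_)
      simp [rep_add, rep_smul]
  rw [hψz, norm_zero] at hψ1
  exact zero_ne_one hψ1

lemma pencil_odd_eq {K V : L2} (α E : ℝ) {u : Sob} (hu : u ∈ paritySob (-1)) :
    pencil incl (formOp K V α) E u = pencil incl (formOp K V 0) E u := by
  rw [pencil_formOp_eq_add, rep_zero_of_odd hu, mul_zero, zero_smul, add_zero]

lemma secEig_odd_iff (r E : ℝ) : SecEig (opC r) (-1) E ↔ SecEig coulombOp (-1) E := by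
  constructor <;> rintro ⟨u, hu, h0, h⟩ <;> refine ⟨u, hu, h0, ?_⟩
  · rw [coulombOp, ← pencil_odd_eq (2 * Real.log r) E hu]; exact h
  · rw [opC, pencil_odd_eq (2 * Real.log r) E hu]; exact h

/-- The odd eigenvalues, which do not depend on `r`, are isolated. -/
lemma exists_odd_isolated {E : ℝ} (hE : E < 0) : ∃ δ : ℝ, 0 < δ ∧ ∀ x, x ≠ E → |x - E| ≤ δ →
    ¬ SecEig coulombOp (-1) x := by
  by_contra hcon
  push Not at hcon
  have hex : ∀ n : ℕ, ∃ x : ℝ, ∃ u ∈ paritySob (-1), x ≠ E ∧ |x - E| ≤ 1 / ((n : ℝ) + 1) ∧ ‖u‖ = 1 ∧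
      pencil incl coulombOp x u = 0 := by
    intro n
    obtain ⟨x, h1, h2, h3⟩ := hcon (1 / ((n : ℝ) + 1)) (by positivity)
    obtain ⟨u, hu, hu1, hu2⟩ := h3.exists_unit
    exact ⟨x, u, hu, h1, h2, hu1, hu2⟩
  choose e ψ hψp hne hea hψ1 hψ using hex
  have he : Tendsto e atTop (𝓝 E) := by
    rw [tendsto_iff_norm_sub_tendsto_zero]
    exact squeeze_zero (fun n => norm_nonneg _) hea tendsto_one_div_add_atTop_nhds_zero_nat
  obtain ⟨φ, χ, β, hφ, hlim, hχ1, hχ0, -, hχ⟩ := exists_limit_eigenfunction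
    (t := fun n => -(n : ℝ)) (w := fun _ => 0) (tendsto_neg_atTop_atBot.comp
      tendsto_natCast_atTop_atTop) he hE (by simp) hψ1 (fun n => by
        rw [add_zero, pencil_odd_eq _ _ (hψp n)]; exact hψ n)
  have hχp : χ ∈ paritySob (-1) := (isClosed_paritySob (-1)).mem_of_tendsto hlim
    (Eventually.of_forall fun n => hψp _)
  rw [coeff_zero_of_odd hχp hχ, neg_zero, zero_smul] at hχ
  have h1 := ((incl.continuous.tendsto _).comp hlim).inner (𝕜 := ℂ)
    (tendsto_const_nhds (x := incl χ))
  have h2 : inner ℂ (incl χ) (incl χ) = 0 :=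
    tendsto_nhds_unique h1 (tendsto_const_nhds.congr fun n =>
      (inner_incl_eq_zero_of_ne isSelfAdjoint_coulombOp (hψ _) hχ (hne _)).symm)
  rw [inner_self_eq_zero] at h2
  have hχne : χ ≠ 0 := by rintro rfl; simp at hχ1
  exact incl_ne_zero hχne h2

end Nanotube

/-! ### Spectral comparison -/

namespace Nanotube

open ContinuousLinearMap

/-- A constant `l` such that the form of `H_C` is bounded below by `-l`. -/
noncomputable def lowerConst (r : ℝ) : ℝ :=
  2 + 32 * (1 + 8 * ‖KC‖ ^ 2 + ‖VC‖ ^ 2 + |2 * Real.log r|) ^ 2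

lemma one_le_lowerConst (r : ℝ) : 1 ≤ lowerConst r := by
  unfold lowerConst
  have : 0 ≤ 32 * (1 + 8 * ‖KC‖ ^ 2 + ‖VC‖ ^ 2 + |2 * Real.log r|) ^ 2 := by positivity
  linarith

lemma coercive_opC (r : ℝ) (ψ : Sob) :
    1 / 4 * ‖ψ‖ ^ 2 ≤ (inner ℂ ψ (opC r ψ)).re + lowerConst r * ‖incl ψ‖ ^ 2 :=
  coercive_formOp KC VC le_rfl ψ

lemma re_inner_sub_le (A B : Sob →L[ℂ] Sob) (ψ : Sob) :
    (inner ℂ ψ (A ψ)).re - ‖B - A‖ * ‖ψ‖ ^ 2 ≤ (inner ℂ ψ (B ψ)).re := by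
  have h1 : (inner ℂ ψ (B ψ)).re - (inner ℂ ψ (A ψ)).re = (inner ℂ ψ ((B - A) ψ)).re := by
    rw [sub_apply, inner_sub_right, Complex.sub_re]
  have h2 : |(inner ℂ ψ ((B - A) ψ)).re| ≤ ‖B - A‖ * ‖ψ‖ ^ 2 :=
    calc |(inner ℂ ψ ((B - A) ψ)).re| ≤ ‖ψ‖ * ‖(B - A) ψ‖ :=
          (Complex.abs_re_le_norm _).trans (norm_inner_le_norm _ _)
      _ ≤ ‖ψ‖ * (‖B - A‖ * ‖ψ‖) := by gcongr; exact le_opNorm _ _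
      _ = _ := by ring
  have := (abs_le.1 h2).1
  linarith

lemma coercive_opC' (r : ℝ) (ψ : Sob) :
    1 / 8 * ‖ψ‖ ^ 2 ≤ (inner ℂ ψ (opC r ψ)).re + lowerConst r * ‖incl ψ‖ ^ 2 := by
  have := coercive_opC r ψ
  nlinarith [sq_nonneg ‖ψ‖]

lemma coercive_opE {r : ℝ} (h : ‖opE r - opC r‖ ≤ 1 / 8) (ψ : Sob) :
    1 / 8 * ‖ψ‖ ^ 2 ≤ (inner ℂ ψ (opE r ψ)).re + lowerConst r * ‖incl ψ‖ ^ 2 := by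
  have h1 := coercive_opC r ψ
  have h2 := re_inner_sub_le (opC r) (opE r) ψ
  have h3 : ‖opE r - opC r‖ * ‖ψ‖ ^ 2 ≤ 1 / 8 * ‖ψ‖ ^ 2 := by gcongr
  linarith

lemma eventually_log_le : ∀ᶠ r : ℝ in 𝓝[>] 0, Real.log r ≤ -1 :=
  Real.tendsto_log_nhdsGT_zero.eventually_le_atBot (-1)

/-- The forms converge faster than any power of `1 / |log r|`. The power needed below arises from the
lower bounds of the forms, which grow like `(log r)²`. -/
lemma tendsto_norm_sub_mul :
    Tendsto (fun r => ‖opE r - opC r‖ * lowerConst r ^ 2 * |Real.log r|) (𝓝[>] 0) (𝓝 0) := by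
  obtain ⟨C, hC, hCb⟩ := exists_norm_sub_le
  set D := 2 + 32 * (1 + 8 * ‖KC‖ ^ 2 + ‖VC‖ ^ 2 + 2) ^ 2 with hD
  have hD0 : 0 ≤ D := by positivity
  -- The logarithms contribute a fifth power, and `r^{1/4}` is the fifth power of `r^{1/20}`.
  have h1 : Tendsto (fun r : ℝ => C * D ^ 2 * |Real.log r * r ^ (1 / 20 : ℝ)| ^ 5) (𝓝[>] 0) (𝓝 0) := by
    have := ((tendsto_log_mul_rpow_nhdsGT_zero (r := 1 / 20) (by norm_num)).abs.pow 5).const_mul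
      (C * D ^ 2)
    simpa using this
  refine squeeze_zero' (Eventually.of_forall fun r => by positivity) ?_ h1
  filter_upwards [eventually_log_le, self_mem_nhdsWithin,
    nhdsWithin_le_nhds (Iic_mem_nhds (zero_lt_one' ℝ))] with r hl hr hr1
  have hr : 0 < r := hr
  set y := |Real.log r| with hy
  have hy1 : 1 ≤ y := by rw [hy, abs_of_nonpos (by linarith)]; linarith
  have hlb : lowerConst r ≤ D * y ^ 2 := by
    have e : |2 * Real.log r| = 2 * y := by rw [abs_mul, abs_two]
    rw [lowerConst, e, hD]
    have k0 : 0 ≤ 1 + 8 * ‖KC‖ ^ 2 + ‖VC‖ ^ 2 := by positivity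
    have k1 : 1 + 8 * ‖KC‖ ^ 2 + ‖VC‖ ^ 2 + 2 * y ≤ (1 + 8 * ‖KC‖ ^ 2 + ‖VC‖ ^ 2 + 2) * y := by
      nlinarith
    have k2 : (1 + 8 * ‖KC‖ ^ 2 + ‖VC‖ ^ 2 + 2 * y) ^ 2
        ≤ ((1 + 8 * ‖KC‖ ^ 2 + ‖VC‖ ^ 2 + 2) * y) ^ 2 := by gcongr
    have k3 : 1 ≤ y ^ 2 := by nlinarith
    rw [mul_pow] at k2
    nlinarith
  have hpow : (r ^ (1 / 20 : ℝ)) ^ 5 = r ^ (1 / 4 : ℝ) := by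
    rw [← Real.rpow_natCast, ← Real.rpow_mul hr.le]; norm_num
  have hl0 : 0 ≤ lowerConst r := zero_le_one.trans (one_le_lowerConst r)
  calc ‖opE r - opC r‖ * lowerConst r ^ 2 * y ≤ C * r ^ (1 / 4 : ℝ) * (D * y ^ 2) ^ 2 * y := by
        gcongr
        exact hCb r hr hr1
    _ = C * D ^ 2 * (y * r ^ (1 / 20 : ℝ)) ^ 5 := by rw [mul_pow y, hpow]; ring
    _ = _ := by rw [abs_mul, abs_of_nonneg (by positivity : 0 ≤ r ^ (1 / 20 : ℝ))]

lemma tendsto_norm_sub_log :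
    Tendsto (fun r => ‖opE r - opC r‖ * |Real.log r|) (𝓝[>] 0) (𝓝 0) := by
  refine squeeze_zero (fun r => by positivity) (fun r => ?_) tendsto_norm_sub_mul
  have := one_le_lowerConst r
  gcongr
  exact le_mul_of_one_le_right (norm_nonneg _) (one_le_pow₀ this)

lemma tendsto_norm_sub : Tendsto (fun r => ‖opE r - opC r‖) (𝓝[>] 0) (𝓝 0) := by
  refine squeeze_zero' (Eventually.of_forall fun r => norm_nonneg _) ?_ tendsto_norm_sub_log
  filter_upwards [eventually_log_le] with r hl
  refine le_mul_of_one_le_right (norm_nonneg _) ?_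
  rw [abs_of_nonpos (by linarith)]; linarith

lemma norm_subtypeL_le (s : ℤˣ) : ‖(paritySob s).subtypeL‖ ≤ 1 :=
  opNorm_le_bound _ zero_le_one fun u => by rw [one_mul]; rfl

lemma norm_incl_sector_le (s : ℤˣ) : ‖incl.comp (paritySob s).subtypeL‖ ≤ 1 :=
  opNorm_le_bound _ zero_le_one fun u => by
    rw [one_mul]; exact norm_incl_apply_le (u : Sob)

lemma norm_compress_sub_le (s : ℤˣ) (A B : Sob →L[ℂ] Sob) :
    ‖compress (paritySob s).subtypeL A - compress (paritySob s).subtypeL B‖ ≤ ‖A - B‖ := by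
  have e : compress (paritySob s).subtypeL A - compress (paritySob s).subtypeL B
      = compress (paritySob s).subtypeL (A - B) := by
    simp only [compress, sub_comp, comp_sub]
  have hj := norm_subtypeL_le s
  have hj' : ‖adjoint (paritySob s).subtypeL‖ ≤ 1 := by
    rw [LinearIsometryEquiv.norm_map]; exact hj
  rw [e]
  calc ‖compress (paritySob s).subtypeL (A - B)‖
      ≤ ‖adjoint (paritySob s).subtypeL‖ * (‖A - B‖ * ‖(paritySob s).subtypeL‖) :=
        (opNorm_comp_le _ _).trans (by gcongr; exact opNorm_comp_le _ _)
    _ ≤ 1 * (‖A - B‖ * 1) := by gcongr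
    _ = _ := by ring

lemma coercive_compress {A : Sob →L[ℂ] Sob} {γ l : ℝ} (s : ℤˣ)
    (h : ∀ ψ, γ * ‖ψ‖ ^ 2 ≤ (inner ℂ ψ (A ψ)).re + l * ‖incl ψ‖ ^ 2) (ψ : paritySob s) :
    γ * ‖ψ‖ ^ 2 ≤ (inner ℂ ψ (compress (paritySob s).subtypeL A ψ)).re
      + l * ‖(incl.comp (paritySob s).subtypeL) ψ‖ ^ 2 := by
  rw [inner_compress]
  exact h (ψ : Sob)

lemma pencil_compress_eq_zero {A : Sob →L[ℂ] Sob} {s : ℤˣ} {E : ℝ} {u : Sob}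
    (hu : u ∈ paritySob s) (h : pencil incl A E u = 0) :
    pencil (incl.comp (paritySob s).subtypeL) (compress (paritySob s).subtypeL A) E ⟨u, hu⟩ = 0 := by
  rw [pencil_compress]
  change adjoint (paritySob s).subtypeL (pencil incl A E u) = 0
  rw [h, map_zero]

/-- Comparison of the eigenvalues of given parity of two operators whose forms are close: apply
`exists_pencil_near` to the compressions of the forms to the parity sector. -/
lemma exists_secEig_near {K₂ V₂ : L2} {α₂ : ℝ} {A₁ : Sob →L[ℂ] Sob}
    (hR : CommRefl (formOp K₂ V₂ α₂)) (hS : IsSelfAdjoint (formOp K₂ V₂ α₂)) {l c : ℝ}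
    (h₁ : ∀ ψ, 1 / 8 * ‖ψ‖ ^ 2 ≤ (inner ℂ ψ (A₁ ψ)).re + l * ‖incl ψ‖ ^ 2)
    (h₂ : ∀ ψ, 1 / 8 * ‖ψ‖ ^ 2 ≤ (inner ℂ ψ (formOp K₂ V₂ α₂ ψ)).re + l * ‖incl ψ‖ ^ 2)
    (hc : ‖A₁ - formOp K₂ V₂ α₂‖ ≤ c) (hsmall : 2 * l * (c / (1 / 8) ^ 2) ≤ 1) {s : ℤˣ} {E : ℝ}
    (hE : E < 0) (hlt : 2 * (c / (1 / 8) ^ 2) * l ^ 2 < -E) (h : SecEig A₁ s E) :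
    ∃ E', E' < 0 ∧ |E' - E| ≤ 2 * (c / (1 / 8) ^ 2) * l ^ 2 ∧ SecEig (formOp K₂ V₂ α₂) s E' := by
  obtain ⟨u, hu, h0, hE0⟩ := h
  obtain ⟨E', h1, h2⟩ := exists_pencil_near (norm_incl_sector_le s) (isSelfAdjoint_compress _ hS)
    (by norm_num : (0 : ℝ) < 1 / 8) (coercive_compress s h₁) (coercive_compress s h₂)
    ((norm_compress_sub_le s _ _).trans hc) hsmall hE (ψ := ⟨u, hu⟩)
    (fun h => h0 (congrArg Subtype.val h)) (pencil_compress_eq_zero hu hE0)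
  have hE' : E' < 0 := by
    have := (abs_le.1 h1).2
    linarith
  refine ⟨E', hE', h1, ?_⟩
  by_contra hcon
  refine h2 (isUnit_pencil_sector hR s hE' fun v hv hv0 => ?_)
  by_contra hvne
  exact hcon ⟨v, hv, hvne, hv0⟩

lemma commRefl_opC (r : ℝ) : CommRefl (opC r) := commRefl_formOp KC_odd VC_even
lemma commRefl_opE {r : ℝ} (hr : 0 < r) : CommRefl (opE r) := commRefl_formOp zero_odd (VE_even hr)
lemma isSelfAdjoint_opC (r : ℝ) : IsSelfAdjoint (opC r) := isSelfAdjoint_formOp KC star_VC _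
lemma isSelfAdjoint_opE {r : ℝ} (hr : 0 < r) : IsSelfAdjoint (opE r) :=
  isSelfAdjoint_formOp 0 (star_VE hr) 0

/-- For small `r`, eigenvalues of one operator are close to eigenvalues of the other of the same
parity, with an error that is small even compared with `1 / |log r|`. -/
lemma eventually_near {b ε : ℝ} (hb : b < 0) (hε : 0 < ε) : ∀ᶠ r in 𝓝[>] 0, ∀ s : ℤˣ, ∀ E ≤ b,
    (SecEig (opE r) s E → ∃ E', E' < 0 ∧ |E' - E| * |Real.log r| ≤ ε ∧ SecEig (opC r) s E') ∧
    (SecEig (opC r) s E → ∃ E', E' < 0 ∧ |E' - E| * |Real.log r| ≤ ε ∧ SecEig (opE r) s E') := by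
  set η := min (min ε (-b / 2)) 1 with hη
  have hη0 : 0 < η := lt_min (lt_min hε (by linarith)) one_pos
  have hηε : η ≤ ε := (min_le_left _ _).trans (min_le_left _ _)
  have hηb : η ≤ -b / 2 := (min_le_left _ _).trans (min_le_right _ _)
  have hη1 : η ≤ 1 := min_le_right _ _
  have h1 := tendsto_norm_sub_mul.eventually_le_const (by positivity : 0 < η / 128)
  filter_upwards [h1, eventually_log_le, self_mem_nhdsWithin] with r h1 hl hr s E hE
  have hr : 0 < r := hr
  set c := ‖opE r - opC r‖ with hc
  set l := lowerConst r with hld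
  have hl1 : 1 ≤ l := one_le_lowerConst r
  have hl2 : 1 ≤ l ^ 2 := one_le_pow₀ hl1
  have hy1 : 1 ≤ |Real.log r| := by rw [abs_of_nonpos (by linarith)]; linarith
  have hc0 : 0 ≤ c := norm_nonneg _
  have k1 : c * l ^ 2 ≤ η / 128 := le_trans (le_mul_of_one_le_right (by positivity) hy1) h1
  have k2 : c ≤ η / 128 := le_trans (le_mul_of_one_le_right hc0 hl2) k1
  have k3 : c * l ≤ η / 128 := le_trans (by
    have : l ≤ l ^ 2 := by nlinarith
    gcongr) k1
  have hc8 : c ≤ 1 / 8 := by linarith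
  have hsmall : 2 * l * (c / (1 / 8) ^ 2) ≤ 1 := by
    have : 2 * l * (c / (1 / 8) ^ 2) = 128 * (c * l) := by ring
    linarith
  have e2 : 2 * (c / (1 / 8) ^ 2) * l ^ 2 = 128 * (c * l ^ 2) := by ring
  have hlt : 2 * (c / (1 / 8) ^ 2) * l ^ 2 < -E := by linarith
  have hfin : ∀ E', |E' - E| ≤ 2 * (c / (1 / 8) ^ 2) * l ^ 2 → |E' - E| * |Real.log r| ≤ ε := by
    intro E' h
    calc |E' - E| * |Real.log r| ≤ 128 * (c * l ^ 2) * |Real.log r| := by rw [← e2]; gcongr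
      _ = 128 * (c * l ^ 2 * |Real.log r|) := by ring
      _ ≤ ε := by linarith
  have hE0 : E < 0 := by linarith
  constructor
  · intro h
    obtain ⟨E', h2, h3, h4⟩ := exists_secEig_near (commRefl_opC r) (isSelfAdjoint_opC r)
      (coercive_opE hc8) (coercive_opC' r) le_rfl hsmall hE0 hlt h
    exact ⟨E', h2, hfin E' h3, h4⟩
  · intro h
    obtain ⟨E', h2, h3, h4⟩ := exists_secEig_near (commRefl_opE hr) (isSelfAdjoint_opE hr)
      (coercive_opC' r) (coercive_opE hc8) (norm_sub_rev (opC r) (opE r)).le hsmall hE0 hlt h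
    exact ⟨E', h2, hfin E' h3, h4⟩

/-- On odd functions the effective operator lies above `H_C`, hence its eigenvalues do not approach
a fixed energy from below. -/
lemma exists_no_odd_below {a : ℝ} (ha : a < 0) : ∃ δ : ℝ, 0 < δ ∧ ∀ᶠ r in 𝓝[>] 0,
    ∀ E, a - δ < E → E < a → ¬ SecEig (opE r) (-1) E := by
  obtain ⟨δ, hδ, hiso⟩ := exists_odd_isolated ha
  -- On odd functions the point interaction drops out, so that the lower bound may be taken at `r = 1`.
  -- It is lowered further to lie below `a - δ`.
  set l := max (lowerConst 1) (δ - a + 1) with hl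
  have hl1 : lowerConst 1 ≤ l := le_max_left _ _
  have hl2 : δ - a + 1 ≤ l := le_max_right _ _
  have hp : 0 < a - δ + l := by linarith
  -- the distance of the eigenvalues `1 / (a - δ + l)` and `1 / (a - δ / 2 + l)` of the resolvent
  set κ := (a - δ + l)⁻¹ - (a - δ / 2 + l)⁻¹ with hκ
  have hκ0 : 0 < κ := by
    rw [hκ, sub_pos]
    exact inv_strictAnti₀ hp (by linarith)
  have hev := tendsto_norm_sub.eventually_lt_const
    (by positivity : 0 < min (1 / 8) (κ / 64))
  refine ⟨δ / 2, by positivity, ?_⟩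
  filter_upwards [hev, self_mem_nhdsWithin] with r hc hr E haE hEa hE
  have hr : 0 < r := hr
  obtain ⟨u, hu, h0, hE0⟩ := hE
  have hodd : ∀ ψ : paritySob (-1), (inner ℂ (ψ : Sob) (opC r ψ)).re
      = (inner ℂ (ψ : Sob) (coulombOp ψ)).re := fun ψ => by
    rw [opC, formOp_eq_add, rep_zero_of_odd ψ.2, mul_zero, zero_smul, add_zero]; rfl
  have hcoC : ∀ ψ : paritySob (-1), 1 / 4 * ‖ψ‖ ^ 2 ≤ (inner ℂ (ψ : Sob) (opC r ψ)).re
      + l * ‖incl (ψ : Sob)‖ ^ 2 := fun ψ => by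
    have h1 := coercive_opC 1 (ψ : Sob)
    have h2 : opC 1 = coulombOp := by rw [opC, Real.log_one, mul_zero]; rfl
    have h3 : lowerConst 1 * ‖incl (ψ : Sob)‖ ^ 2 ≤ l * ‖incl (ψ : Sob)‖ ^ 2 := by gcongr
    rw [h2] at h1
    rw [hodd]
    exact h1.trans (by linarith)
  have hz := pencil_injective_of_gap (norm_incl_sector_le (-1))
    (fun x y hxy => Subtype.ext (incl_injective hxy))
    (isSelfAdjoint_compress (paritySob (-1)).subtypeL (isSelfAdjoint_opC r))
    (isSelfAdjoint_compress (paritySob (-1)).subtypeL (isSelfAdjoint_opE hr))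
    (γ := 1 / 8) (l := l) (by norm_num)
    (fun ψ => by
      rw [inner_compress]
      refine le_trans ?_ (hcoC ψ)
      nlinarith [sq_nonneg ‖ψ‖])
    (fun ψ => by
      rw [inner_compress]
      have h1 := hcoC ψ
      have h2 := re_inner_sub_le (opC r) (opE r) (ψ : Sob)
      have h3 : ‖opE r - opC r‖ * ‖(ψ : Sob)‖ ^ 2 ≤ 1 / 8 * ‖ψ‖ ^ 2 := by
        have := hc.le.trans (min_le_left _ _)
        have e : ‖(ψ : Sob)‖ = ‖ψ‖ := rfl
        rw [e]; gcongr
      change _ ≤ (inner ℂ (ψ : Sob) (opE r ψ)).re + l * ‖incl (ψ : Sob)‖ ^ 2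
      linarith)
    (fun ψ => by
      rw [inner_compress, inner_compress]
      exact re_inner_formOp_le hr _ (rep_zero_of_odd ψ.2))
    ((norm_compress_sub_le (-1) _ _).trans (norm_sub_rev _ _).le)
    (a' := a - δ) (a := a) (E := E) hp
    (fun x hx => isUnit_pencil_sector (commRefl_opC r) (-1) (hx.2.trans ha) fun v hv hv0 => by
      by_contra hvne
      refine hiso x hx.2.ne ?_ ((secEig_odd_iff r x).1 ⟨v, hv, hvne, hv0⟩)
      rw [abs_le]; constructor <;> linarith [hx.1, hx.2])
    hEa (by linarith)
    (by
      have h1 : (E + l)⁻¹ < (a - δ / 2 + l)⁻¹ := inv_strictAnti₀ (by linarith) (by linarith)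
      have h2 : ‖opE r - opC r‖ / (1 / 8) ^ 2 ≤ κ := by
        have := hc.le.trans (min_le_right _ _)
        rw [div_le_iff₀ (by norm_num)]; linarith
      linarith)
    (pencil_compress_eq_zero hu hE0)
  exact h0 (congrArg Subtype.val hz)

end Nanotube

/-! ### Eigenvalues below a fixed energy -/

namespace Nanotube

open ContinuousLinearMap

lemma isParityEigenvalue_HC (r : ℝ) (s : ℤˣ) (E : ℝ) :
    IsParityEigenvalue (HC r) s E ↔ SecEig (opC r) s E :=
  isParityEigenvalue_iff (formC_toH1 r) s E

lemma isParityEigenvalue_Heff {r : ℝ} (hr : 0 < r) (s : ℤˣ) (E : ℝ) :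
    IsParityEigenvalue (Heff r) s E ↔ SecEig (opE r) s E :=
  isParityEigenvalue_iff (formEff_toH1 hr) s E

lemma exists_secEig_HC {r E : ℝ} (hE : E < 0) (h : E ∈ realSpectrum (HC r)) :
    ∃ s, SecEig (opC r) s E := by
  obtain ⟨s, hs⟩ := exists_parity_of_mem_realSpectrum (formC_toH1 r) (commRefl_opC r) hE h
  exact ⟨s, (isParityEigenvalue_HC r s E).1 hs⟩

lemma exists_secEig_Heff {r E : ℝ} (hr : 0 < r) (hE : E < 0) (h : E ∈ realSpectrum (Heff r)) :
    ∃ s, SecEig (opE r) s E := by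
  obtain ⟨s, hs⟩ := exists_parity_of_mem_realSpectrum (formEff_toH1 hr) (commRefl_opE hr) hE h
  exact ⟨s, (isParityEigenvalue_Heff hr s E).1 hs⟩

lemma SecEig.mem_HC {r E : ℝ} {s : ℤˣ} (h : SecEig (opC r) s E) : E ∈ realSpectrum (HC r) :=
  mem_realSpectrum_of_parity (formC_toH1 r) ((isParityEigenvalue_HC r s E).2 h)

lemma SecEig.mem_Heff {r E : ℝ} {s : ℤˣ} (hr : 0 < r) (h : SecEig (opE r) s E) :
    E ∈ realSpectrum (Heff r) :=
  mem_realSpectrum_of_parity (formEff_toH1 hr) ((isParityEigenvalue_Heff hr s E).2 h)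

lemma exists_of_eventually {p : ℝ → Prop} (h : ∀ᶠ r in 𝓝[>] (0 : ℝ), p r) :
    ∃ r₀ : ℝ, 0 < r₀ ∧ ∀ r, 0 < r → r < r₀ → p r := by
  obtain ⟨r₀, h0, h1⟩ := mem_nhdsGT_iff_exists_Ioo_subset.1 h
  exact ⟨r₀, h0, fun r hr hr' => h1 ⟨hr, hr'⟩⟩

lemma eventually_of_lt {p : ℝ → Prop} {r₀ : ℝ} (h0 : 0 < r₀) (h : ∀ r, 0 < r → r < r₀ → p r) :
    ∀ᶠ r in 𝓝[>] (0 : ℝ), p r :=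
  mem_nhdsGT_iff_exists_Ioo_subset.2 ⟨r₀, h0, fun r hr => h r hr.1 hr.2⟩

/-- For small `r`, corresponding eigenvalues of the two operators lie on the same side of a fixed
energy `a`, with one exception: if `a` is itself an odd eigenvalue of `H_C`, the corresponding
eigenvalue of the effective operator may lie above `a`. -/
lemma exists_same_side {a : ℝ} (ha : a < 0) : ∃ c : ℝ, 0 < c ∧ ∀ᶠ r in 𝓝[>] 0, ∀ s E E',
    |E' - E| * |Real.log r| ≤ c →
    (SecEig (opE r) s E → SecEig (opC r) s E' → (E ≤ a → E' ≤ a) ∧ (a ≤ E → a ≤ E')) ∧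
    (SecEig (opC r) s E → SecEig (opE r) s E' → (E ≤ a → E ≠ a → E' ≤ a) ∧ (a ≤ E → a ≤ E')) := by
  obtain ⟨c₁, hc₁, h₁⟩ := exists_no_even_near (w := fun _ => 0) (by simp) (by simp) ha
  obtain ⟨c₂, hc₂, h₂⟩ := exists_no_even_near (w := fun r => opE r - opC r) tendsto_norm_sub_log
    tendsto_norm_sub ha
  obtain ⟨δ, hδ, hiso⟩ := exists_odd_isolated ha
  obtain ⟨δ', hδ', hbel⟩ := exists_no_odd_below ha
  refine ⟨min (min c₁ c₂) (min δ (δ' / 2)), by positivity, ?_⟩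
  filter_upwards [h₁, h₂, hbel, eventually_log_le] with r h₁ h₂ h₃ hl s E E' hEE
  simp only [add_zero, add_sub_cancel] at h₁ h₂
  have hy1 : 1 ≤ |Real.log r| := by rw [abs_of_nonpos (by linarith)]; linarith
  have hd : |E' - E| ≤ min δ (δ' / 2) := (le_mul_of_one_le_right (abs_nonneg _) hy1).trans
    (hEE.trans (min_le_right _ _))
  have hdδ : |E' - E| ≤ δ := hd.trans (min_le_left _ _)
  have hdδ' : |E' - E| ≤ δ' / 2 := hd.trans (min_le_right _ _)
  have hc1 : |E' - E| * |Real.log r| ≤ c₁ := hEE.trans ((min_le_left _ _).trans (min_le_left _ _))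
  have hc2 : |E' - E| * |Real.log r| ≤ c₂ := hEE.trans ((min_le_left _ _).trans (min_le_right _ _))
  have b1 : E ≤ a → a < E' → |E - a| ≤ |E' - E| ∧ |E' - a| ≤ |E' - E| := fun h h' => by
    rw [abs_of_nonpos (by linarith : E - a ≤ 0), abs_of_nonneg (by linarith : 0 ≤ E' - a),
      abs_of_nonneg (by linarith : 0 ≤ E' - E)]
    constructor <;> linarith
  have b2 : a ≤ E → E' < a → |E - a| ≤ |E' - E| ∧ |E' - a| ≤ |E' - E| := fun h h' => by
    rw [abs_of_nonneg (by linarith : 0 ≤ E - a), abs_of_nonpos (by linarith : E' - a ≤ 0),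
      abs_of_nonpos (by linarith : E' - E ≤ 0)]
    constructor <;> linarith
  have mulc : ∀ {c : ℝ}, |E' - E| * |Real.log r| ≤ c → |E - a| ≤ |E' - E| →
      |E - a| * |Real.log r| ≤ c := fun h h' => le_trans (by gcongr) h
  rcases Int.units_eq_one_or s with rfl | rfl
  · refine ⟨fun hE hE' => ⟨fun h => ?_, fun h => ?_⟩, fun hE hE' => ⟨fun h hne => ?_, fun h => ?_⟩⟩ <;>
      by_contra hcon <;> rw [not_le] at hcon
    · exact h₂ E (mulc hc2 (b1 h hcon).1) hE
    · exact h₂ E (mulc hc2 (b2 h hcon).1) hE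
    · exact h₁ E (mulc hc1 (b1 h hcon).1) hE
    · exact h₁ E (mulc hc1 (b2 h hcon).1) hE
  · refine ⟨fun hE hE' => ⟨fun h => ?_, fun h => ?_⟩, fun hE hE' => ⟨fun h hne => ?_, fun h => ?_⟩⟩ <;>
      by_contra hcon <;> rw [not_le] at hcon
    · exact hiso E' hcon.ne' ((b1 h hcon).2.trans hdδ) ((secEig_odd_iff r E').1 hE')
    · exact hiso E' hcon.ne ((b2 h hcon).2.trans hdδ) ((secEig_odd_iff r E').1 hE')
    · exact hiso E hne ((b1 h hcon).1.trans hdδ) ((secEig_odd_iff r E).1 hE)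
    · refine h₃ E' ?_ hcon hE'
      have := (abs_le.1 ((b2 h hcon).2.trans hdδ')).1
      linarith

/-- Every eigenvalue in `(-∞, b]` of the effective operator, and every eigenvalue in `(-∞, b)` of
`H_C`, has a close partner of the same parity in `(-∞, b]`, which is in `[a, b]` if the given
eigenvalue is. -/
lemma eventually_partner {a b ε : ℝ} (hab : a ≤ b) (hb : b < 0) (hε : 0 < ε) :
    ∀ᶠ r in 𝓝[>] 0, ∀ s, ∀ E ≤ b,
      (SecEig (opE r) s E → ∃ E' ≤ b, (a ≤ E → a ≤ E') ∧ |E' - E| ≤ ε ∧ SecEig (opC r) s E') ∧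
      (SecEig (opC r) s E → E ≠ b →
        ∃ E' ≤ b, (a ≤ E → a ≤ E') ∧ |E' - E| ≤ ε ∧ SecEig (opE r) s E') := by
  obtain ⟨ca, hca, ha'⟩ := exists_same_side (hab.trans_lt hb)
  obtain ⟨cb, hcb, hb'⟩ := exists_same_side hb
  filter_upwards [ha', hb', eventually_near hb (by positivity : 0 < min ε (min ca cb)),
    eventually_log_le] with r ha' hb' hnear hl s E hE
  have hy1 : 1 ≤ |Real.log r| := by rw [abs_of_nonpos (by linarith)]; linarith
  have hle : ∀ E', |E' - E| * |Real.log r| ≤ min ε (min ca cb) →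
      |E' - E| ≤ ε ∧ |E' - E| * |Real.log r| ≤ ca ∧ |E' - E| * |Real.log r| ≤ cb := fun E' h =>
    ⟨(le_mul_of_one_le_right (abs_nonneg _) hy1).trans (h.trans (min_le_left _ _)),
      h.trans ((min_le_right _ _).trans (min_le_left _ _)),
      h.trans ((min_le_right _ _).trans (min_le_right _ _))⟩
  constructor
  · intro h
    obtain ⟨E', -, h1, h2⟩ := (hnear s E hE).1 h
    obtain ⟨k1, k2, k3⟩ := hle E' h1
    exact ⟨E', ((hb' s E E' k3).1 h h2).1 hE, ((ha' s E E' k2).1 h h2).2, k1, h2⟩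
  · intro h hne
    obtain ⟨E', -, h1, h2⟩ := (hnear s E hE).2 h
    obtain ⟨k1, k2, k3⟩ := hle E' h1
    exact ⟨E', ((hb' s E E' k3).2 h h2).1 hE hne, ((ha' s E E' k2).2 h h2).2, k1, h2⟩

lemma spectrum_Heff_subset {a : ℝ} (ha : a < 0) {ε : ℝ} (hε : 0 < ε) :
    ∃ rε : ℝ, 0 < rε ∧ ∀ r : ℝ, 0 < r → r < rε → realSpectrum (Heff r) ∩ Iic a ⊆
      ⋃ x ∈ realSpectrum (HC r) ∩ Iic a, Metric.ball x ε := by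
  refine exists_of_eventually ?_
  filter_upwards [eventually_partner le_rfl ha (half_pos hε), self_mem_nhdsWithin] with r h hr E hE
  obtain ⟨s, hs⟩ := exists_secEig_Heff hr (lt_of_le_of_lt hE.2 ha) hE.1
  obtain ⟨E', h1, -, h2, h3⟩ := (h s E hE.2).1 hs
  refine mem_biUnion (x := E') ⟨h3.mem_HC, h1⟩ ?_
  rw [Metric.mem_ball, dist_comm, Real.dist_eq]
  linarith

/-- The regularity of `a` is needed only to exclude that `a` itself is an eigenvalue, whose partner
might lie above `a`. -/
lemma spectrum_HC_subset {a : ℝ} (ha : a < 0)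
    (hreg : ∃ r₀ : ℝ, 0 < r₀ ∧ ∀ r : ℝ, 0 < r → r < r₀ → a ∉ realSpectrum (HC r)) {ε : ℝ}
    (hε : 0 < ε) :
    ∃ rε : ℝ, 0 < rε ∧ ∀ r : ℝ, 0 < r → r < rε → realSpectrum (HC r) ∩ Iic a ⊆
      ⋃ x ∈ realSpectrum (Heff r) ∩ Iic a, Metric.ball x ε := by
  obtain ⟨r₀, hr₀, hreg⟩ := hreg
  refine exists_of_eventually ?_
  filter_upwards [eventually_partner le_rfl ha (half_pos hε), eventually_of_lt hr₀ hreg,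
    self_mem_nhdsWithin] with r h hra hr E hE
  obtain ⟨s, hs⟩ := exists_secEig_HC (lt_of_le_of_lt hE.2 ha) hE.1
  obtain ⟨E', h1, -, h2, h3⟩ := (h s E hE.2).2 hs (by rintro rfl; exact hra hE.1)
  refine mem_biUnion (x := E') ⟨h3.mem_Heff hr, h1⟩ ?_
  rw [Metric.mem_ball, dist_comm, Real.dist_eq]
  linarith

lemma finrank_eq_one_of_orthogonal {W : Submodule ℂ L2} {f : L2} (hf : f ∈ W) (h0 : f ≠ 0)
    (h : ∀ g ∈ W, inner ℂ f g = 0 → g = 0) : Module.finrank ℂ W = 1 := by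
  rw [finrank_eq_one_iff_of_nonzero' (⟨f, hf⟩ : W) (fun h' => h0 (congrArg Subtype.val h'))]
  rintro ⟨g, hg⟩
  refine ⟨inner ℂ f g / inner ℂ f f, Subtype.ext ?_⟩
  have hff : inner ℂ f f ≠ 0 := inner_self_ne_zero.2 h0
  have := h (g - (inner ℂ f g / inner ℂ f f) • f) (W.sub_mem hg (W.smul_mem _ hf)) (by
    rw [inner_sub_right, inner_smul_right, div_mul_cancel₀ _ hff, sub_self])
  exact (sub_eq_zero.1 this).symm

/-- If `H_C` has a single eigenvalue of the given parity in `[a, b]`, then for small `r` the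
effective operator does not have two orthogonal eigenfunctions with energies in this interval. -/
lemma eventually_no_pair {a b : ℝ} {s : ℤˣ} {EC : ℝ → ℝ} (hab : a ≤ b) (hb : b < 0)
    (hEC : ∀ᶠ r in 𝓝[>] 0, ∀ E ∈ Icc a b, SecEig (opC r) s E ↔ E = EC r)
    (hmem : ∀ᶠ r in 𝓝[>] 0, EC r ∈ Icc a b) :
    ∀ᶠ r in 𝓝[>] 0, ∀ E ∈ Icc a b, ∀ E' ∈ Icc a b, ∀ u ∈ paritySob s, ∀ v ∈ paritySob s,
      u ≠ 0 → v ≠ 0 → pencil incl (opE r) E u = 0 → pencil incl (opE r) E' v = 0 →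
      inner ℂ (incl u) (incl v) ≠ 0 := by
  have hclose : ∀ ε : ℝ, 0 < ε → ∀ᶠ r in 𝓝[>] 0, ∀ E ∈ Icc a b, SecEig (opE r) s E →
      |E - EC r| ≤ ε := by
    intro ε hε
    filter_upwards [eventually_partner hab hb hε, hEC] with r h1 h2 E hE h
    obtain ⟨E', h3, h4, h5, h6⟩ := (h1 s E hE.2).1 h
    rw [(h2 E' ⟨h4 hE.1, h3⟩).1 h6] at h5
    rwa [abs_sub_comm]
  by_contra hcon
  obtain ⟨r, hr, hrP⟩ := exists_seq_forall_of_frequently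
    ((not_eventually.1 hcon).and_eventually hmem)
  have hrP' : ∀ n, ∃ E ∈ Icc a b, ∃ E' ∈ Icc a b, ∃ u ∈ paritySob s, ∃ v ∈ paritySob s,
      u ≠ 0 ∧ v ≠ 0 ∧ pencil incl (opE (r n)) E u = 0 ∧ pencil incl (opE (r n)) E' v = 0 ∧
      inner ℂ (incl u) (incl v) = 0 := fun n => by
    have := (hrP n).1
    push Not at this
    exact this
  choose e he e' he' u hu v hv hu0 hv0 hue hve ho using hrP'
  obtain ⟨E, hE, φ, hφ, hlim⟩ := isCompact_Icc.tendsto_subseq fun n => (hrP n).2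
  have hφt := hφ.tendsto_atTop
  have hrφ := hr.comp hφt
  have conv : ∀ x : ℕ → ℝ, (∀ n, x n ∈ Icc a b) → (∀ n, SecEig (opE (r n)) s (x n)) →
      Tendsto (fun n => x (φ n)) atTop (𝓝 E) := by
    intro x hx hxe
    have h0 : Tendsto (fun n => x (φ n) - EC (r (φ n))) atTop (𝓝 0) := by
      rw [Metric.tendsto_nhds]
      intro ε hε
      filter_upwards [hrφ.eventually (hclose (ε / 2) (half_pos hε))] with n hn
      rw [dist_zero_right, Real.norm_eq_abs]
      have h9 : |x (φ n) - EC (r (φ n))| ≤ ε / 2 := hn _ (hx _) (hxe _)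
      linarith
    simpa using h0.add hlim
  refine false_of_pair (s := s) (t := fun n => 2 * Real.log (r (φ n)))
    (w := fun n => opE (r (φ n)) - opC (r (φ n)))
    (u := fun n => ((‖u (φ n)‖⁻¹ : ℝ) : ℂ) • u (φ n)) (v := fun n => ((‖v (φ n)‖⁻¹ : ℝ) : ℂ) • v (φ n))
    (tendsto_two_log hrφ) (conv e he fun n => ⟨u n, hu n, hu0 n, hue n⟩)
    (conv e' he' fun n => ⟨v n, hv n, hv0 n, hve n⟩) (hE.2.trans_lt hb)
    (tendsto_norm_sub.comp hrφ)
    (fun n => (exists_unit_eigen (hu _) (hu0 _) (hue _)).1)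
    (fun n => (exists_unit_eigen (hv _) (hv0 _) (hve _)).1)
    (fun n => (exists_unit_eigen (hu _) (hu0 _) (hue _)).2.1)
    (fun n => (exists_unit_eigen (hv _) (hv0 _) (hve _)).2.1)
    (fun n => by rw [map_smul, map_smul, inner_smul_left, inner_smul_right, ho, mul_zero, mul_zero])
    (fun n => ?_) (fun n => ?_)
  · change pencil incl (opC (r (φ n)) + (opE (r (φ n)) - opC (r (φ n)))) _ _ = 0
    rw [add_sub_cancel]
    exact (exists_unit_eigen (hu _) (hu0 _) (hue _)).2.2
  · change pencil incl (opC (r (φ n)) + (opE (r (φ n)) - opC (r (φ n)))) _ _ = 0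
    rw [add_sub_cancel]
    exact (exists_unit_eigen (hv _) (hv0 _) (hve _)).2.2

/-- Existence comes from `eventually_partner`, uniqueness and simplicity from the absence of
orthogonal pairs of eigenfunctions. -/
lemma exists_simple_eigenvalue {a b : ℝ} {s : ℤˣ} {r₀ : ℝ} {EC : ℝ → ℝ} (hab : a ≤ b) (hb : b < 0)
    (hr₀ : 0 < r₀)
    (h : ∀ r : ℝ, 0 < r → r < r₀ →
      {E : ℝ | E ∈ Icc a b ∧ IsParityEigenvalue (HC r) s E} = {EC r} ∧ EC r ≠ b) :
    ∃ (r₁ : ℝ) (Eeff : ℝ → ℝ), 0 < r₁ ∧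
      (∀ r : ℝ, 0 < r → r < r₁ →
        {E : ℝ | E ∈ Icc a b ∧ IsParityEigenvalue (Heff r) s E} = {Eeff r} ∧
        Module.finrank ℂ (eigenspace (Heff r) (Eeff r) ⊓ paritySector s : Submodule ℂ L2) = 1) ∧
      Tendsto (fun r : ℝ => |Eeff r - EC r|) (𝓝[>] 0) (𝓝 0) := by
  have hE := eventually_of_lt hr₀ h
  have hmem' : ∀ᶠ r in 𝓝[>] 0, EC r ∈ Icc a b ∧ SecEig (opC r) s (EC r) ∧ EC r ≠ b := by
    filter_upwards [hE] with r hr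
    have : EC r ∈ {E : ℝ | E ∈ Icc a b ∧ IsParityEigenvalue (HC r) s E} := by
      rw [hr.1]; exact mem_singleton _
    exact ⟨this.1, (isParityEigenvalue_HC r s _).1 this.2, hr.2⟩
  have hiff : ∀ᶠ r in 𝓝[>] 0, ∀ E ∈ Icc a b, SecEig (opC r) s E ↔ E = EC r := by
    filter_upwards [hE, hmem'] with r hr hm E hEab
    refine ⟨fun h' => ?_, fun h' => h' ▸ hm.2.1⟩
    have : E ∈ {E : ℝ | E ∈ Icc a b ∧ IsParityEigenvalue (HC r) s E} :=
      ⟨hEab, (isParityEigenvalue_HC r s E).2 h'⟩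
    rw [hr.1] at this
    exact this
  have hpair := eventually_no_pair hab hb hiff (hmem'.mono fun r hr => hr.1)
  have hex : ∀ᶠ r in 𝓝[>] 0, ∃ E ∈ Icc a b, SecEig (opE r) s E := by
    filter_upwards [eventually_partner hab hb one_pos, hmem'] with r h1 h2
    obtain ⟨E', h3, h4, -, h5⟩ := (h1 s (EC r) h2.1.2).2 h2.2.1 h2.2.2
    exact ⟨E', ⟨h4 h2.1.1, h3⟩, h5⟩
  obtain ⟨r₁, hr₁, hall⟩ := exists_of_eventually (hpair.and hex)
  classical
  set Eeff : ℝ → ℝ := fun r => if h : ∃ E ∈ Icc a b, SecEig (opE r) s E then h.choose else 0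
    with hEeff
  have hspec : ∀ r, (∃ E ∈ Icc a b, SecEig (opE r) s E) →
      Eeff r ∈ Icc a b ∧ SecEig (opE r) s (Eeff r) := fun r h => by
    rw [hEeff]
    simp only [dif_pos h]
    exact h.choose_spec
  refine ⟨r₁, Eeff, hr₁, fun r hr hr' => ?_, ?_⟩
  · obtain ⟨hnp, hexr⟩ := hall r hr hr'
    obtain ⟨hm, hs⟩ := hspec r hexr
    obtain ⟨u, hu, hu0, hue⟩ := hs
    constructor
    · ext E
      rw [mem_singleton_iff]
      constructor
      · rintro ⟨hEab, hEe⟩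
        obtain ⟨v, hv, hv0, hve⟩ := (isParityEigenvalue_Heff hr s E).1 hEe
        by_contra hne
        exact hnp E hEab _ hm v hv u hu hv0 hu0 hve hue
          (inner_incl_eq_zero_of_ne (isSelfAdjoint_opE hr) hve hue hne)
      · rintro rfl
        exact ⟨hm, (isParityEigenvalue_Heff hr s _).2 (hspec r hexr).2⟩
    · refine finrank_eq_one_of_orthogonal (f := incl u)
        ⟨(mem_eigenspace_iff (formEff_toH1 hr) _ _).2 ⟨u, rfl, hue⟩, hu⟩ (incl_ne_zero hu0) ?_
      rintro g ⟨hg1, hg2⟩ ho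
      obtain ⟨v, rfl, hve⟩ := (mem_eigenspace_iff (formEff_toH1 hr) _ _).1 hg1
      by_contra hv0
      exact hnp _ hm _ hm u hu v hg2 hu0 (fun h' => hv0 (by rw [h', map_zero])) hue hve ho
  · rw [Metric.tendsto_nhds]
    intro ε hε
    filter_upwards [eventually_partner hab hb (half_pos hε), hiff, hex] with r h1 h2 h3
    obtain ⟨hm, hs⟩ := hspec r h3
    obtain ⟨E', k1, k2, k3, k4⟩ := (h1 s _ hm.2).1 hs
    rw [(h2 E' ⟨k2 hm.1, k1⟩).1 k4, abs_sub_comm] at k3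
    rw [dist_zero_right, Real.norm_eq_abs, abs_abs]
    linarith

end Nanotube

/-! ### The ground state -/

namespace Nanotube

open ContinuousLinearMap

lemma re_inner_formOp_effective {r : ℝ} (hr : 0 < r) (ψ : Sob) :
    (inner ℂ ψ (formOp 0 (VE r) 0 ψ)).re
      = 1 / 2 * ‖der ψ‖ ^ 2 - ∫ x, Veff r x * ‖rep ψ x‖ ^ 2 := by
  have e : (1 / 2 : ℂ) = ((1 / 2 : ℝ) : ℂ) := by push_cast; rfl
  rw [inner_formOp_effective hr, integral_mul_hprod_self, Complex.sub_re, Complex.ofReal_re, e,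
    Complex.re_ofReal_mul, re_inner_self]

/-- The dilation `ψ(x) = f(κx)` of a compactly supported function multiplies the kinetic energy by
`κ`. -/
lemma exists_dilation {f : ℝ → ℝ} (hf : HasCompactSupport f) (hf' : ContDiff ℝ 1 f) {κ : ℝ}
    (hκ : 0 < κ) :
    ∃ ψ : Sob, (∀ x, rep ψ x = f (κ * x)) ∧ ‖der ψ‖ ^ 2 = κ * ∫ x, deriv f x ^ 2 := by
  have hc : ContDiff ℝ 1 fun x => (f (κ * x) : ℂ) :=
    Complex.ofRealCLM.contDiff.comp (hf'.comp (contDiff_const.mul contDiff_id))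
  have hs : HasCompactSupport fun x => (f (κ * x) : ℂ) :=
    (hf.comp_left (g := Complex.ofReal) rfl).comp_homeomorph (Homeomorph.mulLeft₀ κ hκ.ne')
  refine ⟨smoothSob _ hc hs, rep_smoothSob _ hc hs, ?_⟩
  rw [norm_sq_L2]
  have h1 : ∫ x, ‖der (smoothSob _ hc hs) x‖ ^ 2
      = ∫ x, (fun y => κ ^ 2 * deriv f y ^ 2) (κ * x) := by
    refine integral_congr_ae ?_
    filter_upwards [der_smoothSob_ae _ hc hs] with x hx
    have h2 : HasDerivAt (fun x => (f (κ * x) : ℂ)) ((deriv f (κ * x) * κ : ℝ) : ℂ) x := by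
      have h3 : HasDerivAt (fun x => κ * x) κ x := by simpa using (hasDerivAt_id x).const_mul κ
      exact (((hf'.differentiable (by simp) (κ * x)).hasDerivAt.comp x h3)).ofReal_comp
    rw [hx, h2.deriv, Complex.norm_real, Real.norm_eq_abs, sq_abs]
    ring
  rw [h1, Measure.integral_comp_mul_left (fun y => κ ^ 2 * deriv f y ^ 2), integral_const_mul, abs_of_pos (inv_pos.2 hκ),
    smul_eq_mul]
  field_simp

lemma le_integral_Veff_dilation {r : ℝ} (hr : 0 < r) {f : ℝ → ℝ} {R : ℝ} (hR0 : 0 ≤ R)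
    (hR : ∀ x, f x ≠ 0 → |x| ≤ R) (hfi : Integrable fun x => f x ^ 2) {κ : ℝ} (hκ : 0 < κ)
    (hκ1 : κ ≤ 1) {ψ : Sob} (hψ : ∀ x, rep ψ x = f (κ * x)) :
    (∫ x, f x ^ 2) / (R + 2 * r) ≤ ∫ x, Veff r x * ‖rep ψ x‖ ^ 2 := by
  have hrep : ∀ x, ‖rep ψ x‖ ^ 2 = f (κ * x) ^ 2 := fun x => by
    rw [hψ, Complex.norm_real, Real.norm_eq_abs, sq_abs]
  have h1 : (∫ x, f x ^ 2) / (R + 2 * r) = ∫ x, κ / (R + 2 * r) * f (κ * x) ^ 2 := by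
    rw [integral_const_mul, Measure.integral_comp_mul_left (fun y => f y ^ 2),
      abs_of_pos (inv_pos.2 hκ), smul_eq_mul]
    field_simp
  rw [h1]
  refine integral_mono_ae ((hfi.comp_mul_left' hκ.ne').const_mul _)
    (integrable_mul_sq_rep (integrable_Veff r (toH1 ψ) (toH1 ψ))) ?_
  filter_upwards [ae_ne_zero] with x hx
  simp only [hrep]
  by_cases h0 : f (κ * x) = 0
  · simp [h0]
  refine mul_le_mul_of_nonneg_right ?_ (sq_nonneg _)
  refine le_trans ?_ (le_Veff hr hx)
  have h2 : κ * |x| ≤ R := by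
    have := hR _ h0
    rwa [abs_mul, abs_of_pos hκ] at this
  have h3 : √(x ^ 2 + 4 * r ^ 2) ≤ |x| + 2 * r := by
    rw [Real.sqrt_le_left (by positivity)]
    nlinarith [sq_abs x, mul_nonneg (abs_nonneg x) hr.le]
  have h4 : 0 < √(x ^ 2 + 4 * r ^ 2) := by positivity
  have h5 : κ * √(x ^ 2 + 4 * r ^ 2) ≤ κ * (|x| + 2 * r) := by gcongr
  rw [div_le_div_iff₀ (by positivity) h4]
  nlinarith

/-- The effective form takes negative values for every `r`, already on functions vanishing at the
origin: for a bump function `f` supported away from the origin and `ψ(x) = f(κx)` with `κ` small,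
the kinetic energy is of order `κ` and the potential energy is bounded below. -/
lemma exists_effective_neg {r : ℝ} (hr : 0 < r) :
    ∃ ψ : Sob, rep ψ 0 = 0 ∧ (inner ℂ ψ (formOp 0 (VE r) 0 ψ)).re < 0 := by
  obtain ⟨f, hsub, hf, hf', -, hf1⟩ := exists_contDiff_tsupport_subset (E := ℝ) (n := 1)
    (Ioi_mem_nhds (zero_lt_one' ℝ))
  have hf0 : f 0 = 0 := by
    by_contra h
    exact lt_irrefl (0 : ℝ) (hsub (subset_tsupport _ h))
  obtain ⟨R, hR⟩ := hf.isCompact.isBounded.subset_closedBall 0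
  have hR' : ∀ x, f x ≠ 0 → |x| ≤ R := fun x hx => by
    have := hR (subset_tsupport f hx)
    rwa [mem_closedBall_zero_iff, Real.norm_eq_abs] at this
  have hR0 : 0 ≤ R := (abs_nonneg 1).trans (hR' 1 (by rw [hf1]; exact one_ne_zero))
  have hcs : HasCompactSupport fun x => f x ^ 2 :=
    hf.comp_left (g := fun y : ℝ => y ^ 2) (by norm_num)
  have hfc : Continuous fun x => f x ^ 2 := hf'.continuous.pow 2
  have hfi : Integrable fun x => f x ^ 2 := hfc.integrable_of_hasCompactSupport hcs
  have hD0 : 0 ≤ ∫ x, deriv f x ^ 2 := integral_nonneg fun x => sq_nonneg _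
  have hN0 : 0 < ∫ x, f x ^ 2 :=
    hfc.integral_pos_of_hasCompactSupport_nonneg_nonzero hcs (fun x => sq_nonneg _)
      (x := 1) (by rw [hf1]; norm_num)
  generalize hD : ∫ x, deriv f x ^ 2 = D at hD0
  have hP : 0 < (∫ x, f x ^ 2) / (R + 2 * r) := by positivity
  generalize hNP : (∫ x, f x ^ 2) / (R + 2 * r) = P at hP
  obtain ⟨κ, hκ, hκ1, hκP⟩ : ∃ κ : ℝ, 0 < κ ∧ κ ≤ 1 ∧ κ * (D + 1) ≤ P :=
    ⟨min 1 (P / (D + 1)), by positivity, min_le_left _ _,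
      (le_div_iff₀ (by positivity)).1 (min_le_right _ _)⟩
  obtain ⟨ψ, hψ, hψ'⟩ := exists_dilation hf hf' hκ
  have hpot := le_integral_Veff_dilation hr hR0 hR' hfi hκ hκ1 hψ
  rw [hNP] at hpot
  rw [hD] at hψ'
  refine ⟨ψ, by rw [hψ, mul_zero, hf0]; rfl, ?_⟩
  rw [re_inner_formOp_effective hr, hψ']
  have : 0 ≤ κ * D := by positivity
  linarith

/-- If the form takes a negative value, then the spectrum has a least element, which is the largest
lower bound of the form. -/
lemma exists_isLeast {t : H1 → H1 →ₗ[ℂ] ℂ} {K V : L2} {α : ℝ}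
    (ht : ∀ φ ψ, t (toH1 φ) (toH1 ψ) = inner ℂ φ (formOp K V α ψ))
    (hV : ∀ᵐ x, star (V x) = V x) {ψ₀ : Sob} (h0 : (inner ℂ ψ₀ (formOp K V α ψ₀)).re < 0) :
    ∃ E < 0, IsLeast (realSpectrum (formOperator t)) E ∧
      ∀ ψ, E * ‖incl ψ‖ ^ 2 ≤ (inner ℂ ψ (formOp K V α ψ)).re := by
  obtain ⟨E, hE, hu, hlow⟩ := exists_ground_level norm_incl_le (isSelfAdjoint_formOp K hV α)
    (by norm_num : (0 : ℝ) < 1 / 4) (coercive_formOp K V le_rfl) h0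
  have key : ∀ E' < 0, ¬ IsUnit (pencil incl (formOp K V α) E') →
      ∃ u, pencil incl (formOp K V α) E' u = 0 ∧ u ≠ 0 := by
    intro E' hE' h
    by_contra! hc
    exact h (isUnit_pencil_formOp K V α hE' hc)
  refine ⟨E, hE, ⟨?_, fun E' hE' => ?_⟩, hlow⟩
  · obtain ⟨u, h1, h2⟩ := key E hE hu
    exact mem_realSpectrum ht h2 h1
  · by_contra! hlt
    obtain ⟨u, h1, h2⟩ := key E' (hlt.trans hE) fun h => notMem_realSpectrum ht h hE'
    have h3 := re_inner_pencil incl (formOp K V α) E' u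
    rw [h1, inner_zero_right, Complex.zero_re] at h3
    have h4 := hlow u
    have h5 : 0 < ‖incl u‖ ^ 2 := by
      have := norm_pos_iff.2 (incl_ne_zero h2)
      positivity
    nlinarith

lemma exists_isLeast_Heff {r : ℝ} (hr : 0 < r) :
    ∃ E < 0, IsLeast (realSpectrum (Heff r)) E ∧
      ∀ ψ, E * ‖incl ψ‖ ^ 2 ≤ (inner ℂ ψ (opE r ψ)).re := by
  obtain ⟨ψ, -, h⟩ := exists_effective_neg hr
  exact exists_isLeast (formEff_toH1 hr) (star_VE hr) h

lemma exists_isLeast_HC (r : ℝ) :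
    ∃ E < 0, IsLeast (realSpectrum (HC r)) E ∧
      ∀ ψ, E * ‖incl ψ‖ ^ 2 ≤ (inner ℂ ψ (opC r ψ)).re := by
  obtain ⟨ψ, h0, h⟩ := exists_effective_neg one_pos
  exact exists_isLeast (formC_toH1 r) star_VC ((re_inner_formOp_le one_pos _ h0).trans_lt h)

/-- A nonnegative self-adjoint operator annihilates the vectors on which its form vanishes. -/
lemma eq_zero_of_re_inner_eq_zero {B : Sob →L[ℂ] Sob} (hB : IsSelfAdjoint B)
    (h : ∀ ψ, 0 ≤ (inner ℂ ψ (B ψ)).re) {χ : Sob} (hχ : (inner ℂ χ (B χ)).re = 0) : B χ = 0 := by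
  have hsym : ∀ x y, inner ℂ (B x) y = inner ℂ x (B y) := fun x y => by
    rw [← adjoint_inner_right, ← star_eq_adjoint, hB.star_eq]
  set n := ‖B χ‖ ^ 2 with hn
  set c := (inner ℂ (B χ) (B (B χ))).re
  have hq : ∀ s : ℝ, 0 ≤ -2 * s * n + s ^ 2 * c := by
    intro s
    have h1 := h (χ - (s : ℂ) • B χ)
    rw [map_sub, map_smul, inner_sub_left, inner_sub_right, inner_sub_right, inner_smul_left,
      inner_smul_left, inner_smul_right, inner_smul_right, ← hsym χ (B χ)] at h1
    simp only [Complex.sub_re, Complex.conj_ofReal, Complex.re_ofReal_mul, hχ, re_inner_self,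
      ← hn] at h1
    change 0 ≤ 0 - s * n - (s * n - s * (s * c)) at h1
    linarith
  have hc0 : 0 ≤ c := h _
  have hn0 : 0 ≤ n := sq_nonneg _
  have h2 := hq (n / (c + 1))
  have h3 : n = 0 := by
    have e : -2 * (n / (c + 1)) * n + (n / (c + 1)) ^ 2 * c
        = -(n ^ 2 * ((c + 2) / (c + 1) ^ 2)) := by field_simp; ring
    rw [e] at h2
    have h4 : 0 < (c + 2) / (c + 1) ^ 2 := by positivity
    by_contra hne
    have : 0 < n ^ 2 * ((c + 2) / (c + 1) ^ 2) := by positivity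
    linarith
  exact norm_eq_zero.1 (pow_eq_zero_iff two_ne_zero |>.1 h3)

/-- A ground state of the effective operator does not vanish at the origin: otherwise its product
with the sign function is a ground state as well, and their sum vanishes on a half-line. -/
lemma eq_zero_of_ground_state {r E : ℝ} (hr : 0 < r)
    (hE : ∀ ψ, E * ‖incl ψ‖ ^ 2 ≤ (inner ℂ ψ (opE r ψ)).re) {ψ : Sob}
    (hψ : pencil incl (opE r) E ψ = 0) (h0 : rep ψ 0 = 0) : ψ = 0 := by
  obtain ⟨χ, hχ, hχ'⟩ := exists_sgn_mul h0
  have hnn : ∀ φ, 0 ≤ (inner ℂ φ (pencil incl (opE r) E φ)).re := fun φ => by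
    rw [re_inner_pencil]; linarith [hE φ]
  have hrepn : ∀ x, ‖rep χ x‖ = ‖rep ψ x‖ := fun x => by rw [hχ, norm_mul, norm_sgn, one_mul]
  have hincl : ‖incl χ‖ ^ 2 = ‖incl ψ‖ ^ 2 := by
    rw [norm_sq_L2, norm_sq_L2]
    refine integral_congr_ae ?_
    filter_upwards [rep_ae χ, rep_ae ψ] with x h1 h2
    rw [h1, h2, hrepn]
  have hder : ‖der χ‖ ^ 2 = ‖der ψ‖ ^ 2 := by
    rw [norm_sq_L2, norm_sq_L2]
    refine integral_congr_ae ?_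
    filter_upwards [hχ'] with x h1
    rw [h1, norm_mul, norm_sgn, one_mul]
  have hχker : pencil incl (opE r) E χ = 0 := by
    refine eq_zero_of_re_inner_eq_zero (isSelfAdjoint_pencil _ (isSelfAdjoint_opE hr) E) hnn ?_
    have h1 : (inner ℂ ψ (pencil incl (opE r) E ψ)).re = 0 := by
      rw [hψ, inner_zero_right, Complex.zero_re]
    rw [re_inner_pencil, opE, re_inner_formOp_effective hr] at h1 ⊢
    simpa only [hrepn, hincl, hder] using h1
  have hsum : pencil incl (opE r) E (ψ + χ) = 0 := by rw [map_add, hψ, hχker, add_zero]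
  have hs0 : rep (ψ + χ) 0 = 0 := by
    rw [rep_add, ContinuousMap.add_apply, hχ, h0, mul_zero, add_zero]
  obtain ⟨c, hc, hc0⟩ := exists_deriv_zero (measurable_Veff hr)
    (fun x hx => ⟨Veff_nonneg hr x, Veff_le_inv hr hx⟩) hs0 (E := E) (fun φ => by
      have h1 := inner_pencil incl (opE r) E φ (ψ + χ)
      rw [hsum, inner_zero_right, opE, inner_formOp_effective hr] at h1
      exact sub_eq_zero.1 h1.symm)
  have hneg : ∀ x ≤ 0, rep (ψ + χ) x = 0 := fun x hx => by
    rw [rep_add, ContinuousMap.add_apply, hχ, sgn, if_neg (not_lt.2 hx)]; ring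
  have hc' : c = 0 := by
    refine (uniqueDiffWithinAt_Iic (0 : ℝ)).eq_deriv _ hc.hasDerivWithinAt ?_
    exact (hasDerivWithinAt_const (0 : ℝ) (Iic 0) (0 : ℂ)).congr hneg (hneg 0 le_rfl)
  have hz := hc0 hc'
  -- Hence `ψ` vanishes on the right half-line, and the same argument applies to `ψ` itself.
  have hpos : ∀ x, 0 ≤ x → rep ψ x = 0 := fun x hx => by
    rcases hx.eq_or_lt with rfl | hx
    · exact h0
    have h1 : rep (ψ + χ) x = 0 := by
      rw [hz, rep_zero]; rfl
    rw [rep_add, ContinuousMap.add_apply, hχ, sgn, if_pos hx, one_mul, ← two_mul] at h1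
    exact (mul_eq_zero.1 h1).resolve_left two_ne_zero
  obtain ⟨d, hd, hd0⟩ := exists_deriv_zero (measurable_Veff hr)
    (fun x hx => ⟨Veff_nonneg hr x, Veff_le_inv hr hx⟩) h0 (E := E) (fun φ => by
      have h1 := inner_pencil incl (opE r) E φ ψ
      rw [hψ, inner_zero_right, opE, inner_formOp_effective hr] at h1
      exact sub_eq_zero.1 h1.symm)
  refine hd0 ((uniqueDiffWithinAt_Ici (0 : ℝ)).eq_deriv _ hd.hasDerivWithinAt ?_)
  exact (hasDerivWithinAt_const (0 : ℝ) (Ici 0) (0 : ℂ)).congr (fun x hx => hpos x hx) h0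

/-- The ground state of the effective operator is non-degenerate and even, since evaluation at the
origin is injective on the ground state eigenspace. -/
lemma exists_ground_state {r : ℝ} (hr : 0 < r) :
    ∃ E : ℝ, IsLeast (realSpectrum (Heff r)) E ∧
      Module.finrank ℂ (eigenspace (Heff r) E) = 1 ∧ eigenspace (Heff r) E ≤ paritySector 1 := by
  obtain ⟨E, hE, hleast, hlow⟩ := exists_isLeast_Heff hr
  obtain ⟨s, u, -, hu0, hu⟩ := exists_secEig_Heff hr hE hleast.1
  have hmem := mem_eigenspace_iff (formEff_toH1 hr) E
  refine ⟨E, hleast, ?_, fun f hf => ?_⟩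
  · rw [finrank_eq_one_iff_of_nonzero' (⟨incl u, (hmem _).2 ⟨u, rfl, hu⟩⟩ : eigenspace (Heff r) E)
      (fun h => incl_ne_zero hu0 (congrArg Subtype.val h))]
    rintro ⟨g, hg⟩
    obtain ⟨v, rfl, hv⟩ := (hmem g).1 hg
    have hur : rep u 0 ≠ 0 := fun h => hu0 (eq_zero_of_ground_state hr hlow hu h)
    have h1 : v - (rep v 0 / rep u 0) • u = 0 := by
      refine eq_zero_of_ground_state hr hlow ?_ ?_
      · change pencil incl (opE r) E v = 0 at hv
        rw [map_sub, map_smul, hu, hv, smul_zero, sub_zero]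
      · rw [rep_sub, rep_smul, ContinuousMap.sub_apply, ContinuousMap.smul_apply, smul_eq_mul,
          div_mul_cancel₀ _ hur, sub_self]
    refine ⟨rep v 0 / rep u 0, Subtype.ext ?_⟩
    change (rep v 0 / rep u 0) • incl u = incl v
    rw [← map_smul, ← sub_eq_zero.1 h1]
  · obtain ⟨v, rfl, hv⟩ := (hmem f).1 hf
    change pencil incl (opE r) E v = 0 at hv
    rw [← mem_paritySob_iff_incl, mem_paritySob_iff, Units.val_one, Int.cast_one, one_smul]
    refine sub_eq_zero.1 (eq_zero_of_ground_state hr hlow (ψ := refl v - v) ?_ ?_)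
    · have h0 : refl 0 = 0 := by simpa using refl_smul 0 0
      rw [map_sub, commRefl_pencil (commRefl_opE hr) E v, hv, h0, sub_zero]
    · rw [rep_sub, ContinuousMap.sub_apply, rep_refl, neg_zero, sub_self]

lemma sInf_Heff_mul_le {r : ℝ} (hr : 0 < r) (ψ : Sob) :
    sInf (realSpectrum (Heff r)) * ‖incl ψ‖ ^ 2 ≤ (inner ℂ ψ (opE r ψ)).re := by
  obtain ⟨E, -, h, hlow⟩ := exists_isLeast_Heff hr
  rw [h.csInf_eq]
  exact hlow ψ

/-- The ground state energy diverges: on a function that does not vanish at the origin the form of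
`H_C` is dominated by the point interaction. -/
lemma tendsto_sInf_Heff :
    Tendsto (fun r => sInf (realSpectrum (Heff r))) (𝓝[>] 0) atBot := by
  have hd0 : dirac ≠ 0 := fun h => rep_dirac_zero (by
    rw [← star_eq_zero, ← inner_dirac, h, inner_zero_right])
  have hi : 0 < ‖incl dirac‖ ^ 2 := by
    have := norm_pos_iff.2 (incl_ne_zero hd0)
    positivity
  have hrd : 0 < ‖rep dirac 0‖ ^ 2 := by
    have := norm_pos_iff.2 rep_dirac_zero
    positivity
  have hlin : Tendsto (fun r => (((inner ℂ dirac (coulombOp dirac)).re + ‖dirac‖ ^ 2)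
      + 2 * Real.log r * ‖rep dirac 0‖ ^ 2) / ‖incl dirac‖ ^ 2) (𝓝[>] 0) atBot := by
    refine Tendsto.atBot_div_const hi (tendsto_atBot_add_const_left _ _ ?_)
    exact (Real.tendsto_log_nhdsGT_zero.const_mul_atBot two_pos).atBot_mul_const hrd
  refine tendsto_atBot_mono' _ ?_ hlin
  filter_upwards [self_mem_nhdsWithin, tendsto_norm_sub.eventually_le_const zero_lt_one]
    with r hr hw
  rw [le_div_iff₀ hi]
  refine (sInf_Heff_mul_le hr dirac).trans ?_
  have h1 := re_inner_sub_le (opE r) (opC r) dirac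
  have h2 : (inner ℂ dirac (opC r dirac)).re
      = (inner ℂ dirac (coulombOp dirac)).re + 2 * Real.log r * ‖rep dirac 0‖ ^ 2 := by
    rw [opC, formOp_eq_add, inner_add_right, inner_smul_right, inner_dirac, Complex.add_re,
      mul_assoc, Complex.re_ofReal_mul]
    congr 2
    rw [← Complex.ofReal_re (‖rep dirac 0‖ ^ 2)]
    congr 1
    push_cast
    exact Complex.mul_conj' _
  have h3 : ‖opC r - opE r‖ * ‖dirac‖ ^ 2 ≤ 1 * ‖dirac‖ ^ 2 := by
    rw [norm_sub_rev]; gcongr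
  linarith

/-- The ground state energies approach each other, since each has a partner in the other spectrum;
for small `r` both are below a fixed negative energy. -/
lemma tendsto_sInf_sub :
    Tendsto (fun r => |sInf (realSpectrum (HC r)) - sInf (realSpectrum (Heff r))|)
      (𝓝[>] 0) (𝓝 0) := by
  rw [Metric.tendsto_nhds]
  intro ε hε
  filter_upwards [eventually_near (by norm_num : (-1 : ℝ) < 0)
    (lt_min (half_pos hε) (one_pos : (0 : ℝ) < 1)), eventually_log_le, self_mem_nhdsWithin,
    tendsto_sInf_Heff.eventually_le_atBot (-2)] with r hnear hl hr hinf
  have hr : 0 < r := hr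
  have hy1 : 1 ≤ |Real.log r| := by rw [abs_of_nonpos (by linarith)]; linarith
  obtain ⟨E, hE, hEl, -⟩ := exists_isLeast_Heff hr
  obtain ⟨F, hF, hFl, -⟩ := exists_isLeast_HC r
  rw [hEl.csInf_eq] at hinf
  rw [hEl.csInf_eq, hFl.csInf_eq, dist_zero_right, Real.norm_eq_abs, abs_abs]
  have hle : ∀ x : ℝ, |x| * |Real.log r| ≤ min (ε / 2) 1 → |x| ≤ ε / 2 ∧ |x| ≤ 1 := fun x h => by
    have := (le_mul_of_one_le_right (abs_nonneg x) hy1).trans h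
    exact ⟨this.trans (min_le_left _ _), this.trans (min_le_right _ _)⟩
  obtain ⟨s, hs⟩ := exists_secEig_Heff hr hE hEl.1
  obtain ⟨E', -, h1, h2⟩ := (hnear s E (by linarith)).1 hs
  have h3 := abs_le.1 (hle _ h1).1
  have h3' := abs_le.1 (hle _ h1).2
  have h4 : F ≤ E' := hFl.2 h2.mem_HC
  obtain ⟨s', hs'⟩ := exists_secEig_HC hF hFl.1
  obtain ⟨F', -, h5, h6⟩ := (hnear s' F (by linarith)).2 hs'
  have h7 := abs_le.1 (hle _ h5).1
  have h8 : E ≤ F' := hEl.2 (h6.mem_Heff hr)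
  have : |F - E| ≤ ε / 2 := abs_le.2 ⟨by linarith, by linarith⟩
  linarith

end Nanotube

theorem mainTheorem2 :
    -- (i)
    ((∀ a : ℝ, a < 0 → ∀ ε : ℝ, 0 < ε → ∃ rε : ℝ, 0 < rε ∧ ∀ r : ℝ, 0 < r → r < rε →
        Nanotube.realSpectrum (Nanotube.Heff r) ∩ Set.Iic a ⊆
          ⋃ x ∈ Nanotube.realSpectrum (Nanotube.HC r) ∩ Set.Iic a, Metric.ball x ε) ∧
      (∀ a : ℝ, a < 0 →
        (∃ r₀ : ℝ, 0 < r₀ ∧ ∀ r : ℝ, 0 < r → r < r₀ →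
          a ∉ Nanotube.realSpectrum (Nanotube.HC r)) →
        ∀ ε : ℝ, 0 < ε → ∃ rε : ℝ, 0 < rε ∧ ∀ r : ℝ, 0 < r → r < rε →
          Nanotube.realSpectrum (Nanotube.HC r) ∩ Set.Iic a ⊆
            ⋃ x ∈ Nanotube.realSpectrum (Nanotube.Heff r) ∩ Set.Iic a, Metric.ball x ε)) ∧
    -- (ii)
    ((∀ r : ℝ, 0 < r → ∃ E : ℝ, IsLeast (Nanotube.realSpectrum (Nanotube.Heff r)) E ∧
        Module.finrank ℂ (Nanotube.eigenspace (Nanotube.Heff r) E) = 1 ∧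
        Nanotube.eigenspace (Nanotube.Heff r) E ≤ Nanotube.paritySector 1) ∧
      (∀ r : ℝ, 0 < r → (Nanotube.realSpectrum (Nanotube.HC r)).Nonempty ∧
        BddBelow (Nanotube.realSpectrum (Nanotube.HC r))) ∧
      Filter.Tendsto (fun r : ℝ => sInf (Nanotube.realSpectrum (Nanotube.Heff r)))
        (nhdsWithin 0 (Set.Ioi 0)) Filter.atBot ∧
      Filter.Tendsto (fun r : ℝ => |sInf (Nanotube.realSpectrum (Nanotube.HC r))
          - sInf (Nanotube.realSpectrum (Nanotube.Heff r))|)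
        (nhdsWithin 0 (Set.Ioi 0)) (nhds 0)) ∧
    -- (iii)
    (∀ (a b : ℝ) (s : ℤˣ) (r₀ : ℝ) (EC : ℝ → ℝ), a ≤ b → b < 0 → 0 < r₀ →
      (∀ r : ℝ, 0 < r → r < r₀ →
        {E : ℝ | E ∈ Set.Icc a b ∧ Nanotube.IsParityEigenvalue (Nanotube.HC r) s E} = {EC r} ∧
        EC r ≠ b) →
      ∃ (r₁ : ℝ) (Eeff : ℝ → ℝ), 0 < r₁ ∧
        (∀ r : ℝ, 0 < r → r < r₁ →
          {E : ℝ | E ∈ Set.Icc a b ∧ Nanotube.IsParityEigenvalue (Nanotube.Heff r) s E}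
            = {Eeff r} ∧
          Module.finrank ℂ
            (Nanotube.eigenspace (Nanotube.Heff r) (Eeff r) ⊓ Nanotube.paritySector s :
              Submodule ℂ Nanotube.L2) = 1) ∧
        Filter.Tendsto (fun r : ℝ => |Eeff r - EC r|) (nhdsWithin 0 (Set.Ioi 0)) (nhds 0)) := by
  refine ⟨⟨fun a ha ε hε => Nanotube.spectrum_Heff_subset ha hε,
    fun a ha hreg ε hε => Nanotube.spectrum_HC_subset ha hreg hε⟩,
    ⟨fun r hr => Nanotube.exists_ground_state hr, fun r _ => ?_, Nanotube.tendsto_sInf_Heff,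
      Nanotube.tendsto_sInf_sub⟩,
    fun a b s r₀ EC hab hb hr₀ h => Nanotube.exists_simple_eigenvalue hab hb hr₀ h⟩
  obtain ⟨E, -, hE, -⟩ := Nanotube.exists_isLeast_HC r
  exact ⟨⟨E, hE.1⟩, ⟨E, hE.2⟩⟩
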